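/- Let $q$ be real, $0<|q|<1$, let $n\ge 1$ and $\boldsymbol\iota=(\iota_0,\dots,\iota_n)\in\{\pm1\}^{n+1}$. **The $*$-algebra.** $U_q\mathfrak{sl}(n+1)$ is the complex algebra generated by $E_i,F_i,K_i^{\pm1}$ ($1\le i\le n$) with $K_iK_j=K_jK_i$, $K_iE_j=q^{-a_{ij}}E_jK_i$, $K_iF_j=q^{a_{ij}}F_jK_i$, $[E_i,F_j]=\delta_{ij}\frac{K_i-K_i^{-1}}{q^{-1}-q}$, $[E_i,E_j]=[F_i,F_j]=0$ if $|i-j|>1$, and the quantum Serre relations $E_i^2E_j-(q+q^{-1})E_iE_jE_i+E_jE_i^2=0$, $F_i^2F_j-(q+q^{-1})F_iF_jF_i+F_jF_i^2=0$ if $|i-j|=1$; here $a_{ii}=2$, $a_{ij}=-1$ if $|i-j|=1$, and $a_{ij}=0$ otherwise. $U_q\mathfrak{su}\langle\boldsymbol\iota\rangle$ is this algebra with the antilinear involutive antiautomorphism $E_i^\natural=\iota_{i-1}\iota_i\,qK_i^{-1}F_i$, $F_i^\natural=\iota_{i-1}\iota_i\,q^{-1}E_iK_i$, $K_i^\natural=K_i$.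 **The algebra of functions.** $\mathrm{Func}(\mathcal O_V)_q$ is generated by $z_0,\dots,z_n,\hat z_0,\dots,\hat z_n$ and the complex functions $f(x_0,\dots,x_{n+1})$ on the set of real points with all $x_j\ne0$ and $x_{i-1}x_{i+1}>0$ ($1\le i\le n$). The functions are multiplied and added pointwise, and the other relations are $z_iz_j=qz_jz_i$ and $\hat z_i\hat z_j=q^{-1}\hat z_j\hat z_i$ for $i<j$; $z_i\hat z_j=q\hat z_jz_i$ for $i\neq j$; $z_i\hat z_i=x_i-x_{i+1}$; $z_i\hat z_i-\hat z_iz_i=(q^{-2}-1)x_{i+1}$; $z_if(x)=f(x_0,\dots,x_i,q^{2}x_{i+1},\dots,q^{2}x_{n+1})z_i$; and $\hat z_if(x)=f(x_0,\dots,x_i,q^{-2}x_{i+1},\dots,q^{-2}x_{n+1})\hat z_i$. $\mathrm{Func}(X)_q$ is the subalgebra of elements invariant under all automorphisms $z_i\mapsto\alpha z_i$, $\hat z_i\mapsto\bar\alpha\hat z_i$, $f\mapsto f$ with $|\alpha|=1$, and $\mathrm{Func}(X)_q^{\rm inv}$ is its commutative subalgebra of functions $f(x)$. The quantum moment map $J:U_q\mathfrak{sl}(n+1)\to\mathrm{Func}(X)_q$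 is the homomorphism $$E_i\mapsto\frac{1}{q^2-1}\,x_i^{-1}z_{i-1}\hat z_i,\qquad F_i\mapsto\frac{1}{q-q^{-1}}\,(x_{i-1}x_{i+1})^{-1/2}z_i\hat z_{i-1},\qquad K_i\mapsto\frac{x_i}{(x_{i-1}x_{i+1})^{1/2}},$$ where $(x_{i-1}x_{i+1})^{1/2}$ is a real branch of the root that is multiplied by $q$ when $x_{i-1}x_{i+1}$ is multiplied by $q^2$ (the positive root if $q>0$). **The modules.** Let $\chi(f)=f(p)$ be the character of $\mathrm{Func}(X)_q^{\rm inv}$ given by a point $p$ of the above set with $\chi(x_i)=p_i>0$ for $i=1,\dots,n$. Let $W$ be the $\mathrm{Func}(X)_q$-module induced from $\chi$, with generator $\mathbf 1_\chi$, and let $\mathcal Q$ be the set of the joint eigenvalues $(\lambda_0,\dots,\lambda_{n+1})$ of $(x_0,\dots,x_{n+1})$ in $W$ (here $\lambda_0=p_0$ and $\lambda_{n+1}=p_{n+1}$ are constant). Let $W'$ be the truncated module, that is, the quotient of $W$ by the sum of all its submodules that do not contain $\mathbf 1_\chi$, and let $\mathcal Q'$ be its set of joint eigenvalues. Let $\pi$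 and $\pi'$ denote the actions of $\mathrm{Func}(X)_q$ in $W$ and $W'$, and let $I$ be any $*$-algebra automorphism of $U_q\mathfrak{su}\langle\boldsymbol\iota\rangle$. An action of a $*$-algebra $F$ in a vector space $M$ is called an *irreducible $*$-representation* if $M\neq0$ has a positive definite Hermitian scalar product with $(av_1,v_2)=(v_1,a^*v_2)$ for all $a\in F$, every $a\in F$ acts by a closable operator in the Hilbert space completion $H$ of $M$, and no closed subspace of $H$ other than $0$ and $H$ reduces the closures of all these operators. **Theorem.** (1) $\pi\circ J\circ I$ is an irreducible $*$-representation of $U_q\mathfrak{su}\langle\boldsymbol\iota\rangle$ if and only if for every $i=1,\dots,n$ and every $\lambda\in\mathcal Q$ (in particular, with non-zero denominators) $$\text{(a)}\ \ \iota_{i-1}\iota_i\,\frac{\lambda_{i-1}-\lambda_i}{\lambda_i-q^{-2}\lambda_{i+1}}>0,\qquad\qquad \text{(b)}\ \ \iota_{i-1}\iota_i\,\frac{q^2\lambda_{i-1}-\lambda_i}{\lambda_i-\lambda_{i+1}}>0 .$$ (2) $\pi'\circ J\circ I$ is an irreducible $*$-representation of $U_q\mathfrak{su}\langle\boldsymbol\iota\rangle$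 if and only if for every $i=1,\dots,n$ and every $\lambda\in\mathcal Q'$: (a) holds whenever the point obtained from $\lambda$ by replacing $\lambda_i$ with $q^2\lambda_i$ lies in $\mathcal Q'$, and (b) holds whenever the point obtained by replacing $\lambda_i$ with $q^{-2}\lambda_i$ lies in $\mathcal Q'$. -/

import Mathlib

namespace QOrbit

set_option linter.unusedSimpArgs false
set_option linter.unusedTactic false
set_option linter.unreachableTactic false

/-- The deformation parameter: a real number `q` with `0 < |q| < 1`. -/
abbrev Par : Type := {q : ℝ // 0 < |q| ∧ |q| < 1}

namespace Par

/-- The parameter as a complex number. -/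
def c (q : Par) : ℂ := (q.1 : ℂ)

theorem ne_zero (q : Par) : q.1 ≠ 0 := abs_pos.mp q.2.1

theorem c_ne (q : Par) : q.c ≠ 0 := by
  have h := q.ne_zero
  unfold c
  exact_mod_cast h

theorem sq_pos (q : Par) : 0 < q.1 ^ 2 := by
  have h := q.ne_zero
  positivity

theorem sq_lt_one (q : Par) : q.1 ^ 2 < 1 := by
  have h := q.2
  rw [← sq_abs]
  nlinarith [h.1, h.2]

theorem c_sq_ne (q : Par) : q.c ^ 2 - 1 ≠ 0 := by
  have h : q.1 ^ 2 - 1 ≠ 0 := by linarith [q.sq_lt_one]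
  unfold c
  exact_mod_cast h

theorem conj_c (q : Par) : (starRingEnd ℂ) q.c = q.c := Complex.conj_ofReal _

end Par

/-- `a b = t b a`. -/
def QC {B : Type*} [Ring B] [Algebra ℂ B] (t : ℂ) (a b : B) : Prop := a * b = t • (b * a)

namespace QC
variable {B : Type*} [Ring B] [Algebra ℂ B] {a a' b b' : B} {t s u : ℂ}

theorem mul_left (h : QC t a b) (h' : QC s a' b) : QC (t * s) (a * a') b := by
  unfold QC at *
  rw [mul_assoc, h', mul_smul_comm, ← mul_assoc, h, smul_mul_assoc, smul_smul, mul_assoc, mul_comm s]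

theorem mul_right (h : QC t a b) (h' : QC s a b') : QC (t * s) a (b * b') := by
  unfold QC at *
  rw [← mul_assoc, h, smul_mul_assoc, mul_assoc, h', mul_smul_comm, smul_smul, mul_assoc]

theorem smul_left (h : QC t a b) (r : ℂ) : QC t (r • a) b := by
  unfold QC at *
  rw [smul_mul_assoc, h, mul_smul_comm, smul_comm]

theorem smul_right (h : QC t a b) (r : ℂ) : QC t a (r • b) := by
  unfold QC at *
  rw [smul_mul_assoc, mul_smul_comm, h, smul_comm]

theorem symm (h : QC t a b) (hu : t * u = 1) : QC u b a := by
  unfold QC at *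
  rw [h, smul_smul, mul_comm, hu, one_smul]

theorem cast (h : QC t a b) (e : t = s) : QC s a b := e ▸ h

end QC

/-! ### The quantized enveloping algebra of `sl(n+1)`

The index `i : Fin n` stands for the index `i + 1` in `1, …, n`. -/

/-- Generators of the quantized enveloping algebra. -/
inductive UGen (n : ℕ) : Type
  | E (i : Fin n)
  | F (i : Fin n)
  | K (i : Fin n)
  | Kinv (i : Fin n)

/-- The Cartan matrix of type `A_n`. -/
def cartan {n : ℕ} (i j : Fin n) : ℤ :=
  if i = j then 2 else if i.1 + 1 = j.1 ∨ j.1 + 1 = i.1 then -1 else 0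

theorem cartan_comm {n : ℕ} (i j : Fin n) : cartan i j = cartan j i := by
  unfold cartan; simp only [eq_comm (a := i), or_comm]

open FreeAlgebra UGen in
/-- The defining relations of `U_q sl(n+1)`. -/
inductive URel (q : Par) (n : ℕ) : FreeAlgebra ℂ (UGen n) → FreeAlgebra ℂ (UGen n) → Prop
  | K_Kinv (i : Fin n) : URel q n (ι ℂ (K i) * ι ℂ (Kinv i)) 1
  | Kinv_K (i : Fin n) : URel q n (ι ℂ (Kinv i) * ι ℂ (K i)) 1
  | K_K (i j : Fin n) : URel q n (ι ℂ (K i) * ι ℂ (K j)) (ι ℂ (K j) * ι ℂ (K i))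
  | K_E (i j : Fin n) :
      URel q n (ι ℂ (K i) * ι ℂ (E j)) (q.c ^ (-cartan i j) • (ι ℂ (E j) * ι ℂ (K i)))
  | K_F (i j : Fin n) :
      URel q n (ι ℂ (K i) * ι ℂ (F j)) (q.c ^ (cartan i j) • (ι ℂ (F j) * ι ℂ (K i)))
  | E_F (i : Fin n) :
      URel q n (ι ℂ (E i) * ι ℂ (F i) - ι ℂ (F i) * ι ℂ (E i))
        ((q.c⁻¹ - q.c)⁻¹ • (ι ℂ (K i) - ι ℂ (Kinv i)))
  | E_F_ne (i j : Fin n) (h : i ≠ j) :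
      URel q n (ι ℂ (E i) * ι ℂ (F j) - ι ℂ (F j) * ι ℂ (E i)) 0
  | E_E (i j : Fin n) (h : cartan i j = 0) :
      URel q n (ι ℂ (E i) * ι ℂ (E j)) (ι ℂ (E j) * ι ℂ (E i))
  | F_F (i j : Fin n) (h : cartan i j = 0) :
      URel q n (ι ℂ (F i) * ι ℂ (F j)) (ι ℂ (F j) * ι ℂ (F i))
  | serre_E (i j : Fin n) (h : cartan i j = -1) :
      URel q n (ι ℂ (E i) * ι ℂ (E i) * ι ℂ (E j)
        - (q.c + q.c⁻¹) • (ι ℂ (E i) * ι ℂ (E j) * ι ℂ (E i))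
        + ι ℂ (E j) * ι ℂ (E i) * ι ℂ (E i)) 0
  | serre_F (i j : Fin n) (h : cartan i j = -1) :
      URel q n (ι ℂ (F i) * ι ℂ (F i) * ι ℂ (F j)
        - (q.c + q.c⁻¹) • (ι ℂ (F i) * ι ℂ (F j) * ι ℂ (F i))
        + ι ℂ (F j) * ι ℂ (F i) * ι ℂ (F i)) 0

/-- The algebra `U_q sl(n+1)`. -/
abbrev U (q : Par) (n : ℕ) : Type := RingQuot (URel q n)

namespace U
variable {q : Par} {n : ℕ}

/-- A generator of `U_q sl(n+1)`. -/
noncomputable def gen (g : UGen n) : U q n := RingQuot.mkAlgHom ℂ (URel q n) (FreeAlgebra.ι ℂ g)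

/-- The generator `E_i`. -/
noncomputable def E (i : Fin n) : U q n := gen (.E i)
/-- The generator `F_i`. -/
noncomputable def F (i : Fin n) : U q n := gen (.F i)
/-- The generator `K_i`. -/
noncomputable def K (i : Fin n) : U q n := gen (.K i)
/-- The generator `K_i⁻¹`. -/
noncomputable def Kinv (i : Fin n) : U q n := gen (.Kinv i)

/-- The relations of `U_q sl(n+1)` for a family of elements of an algebra. -/
structure Sat {B : Type*} [Ring B] [Algebra ℂ B] (q : Par) (e f k l : Fin n → B) : Prop where
  k_l (i) : k i * l i = 1
  l_k (i) : l i * k i = 1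
  k_k (i j) : k i * k j = k j * k i
  k_e (i j) : QC (q.c ^ (-cartan i j)) (k i) (e j)
  k_f (i j) : QC (q.c ^ (cartan i j)) (k i) (f j)
  e_f (i) : e i * f i - f i * e i = (q.c⁻¹ - q.c)⁻¹ • (k i - l i)
  e_f_ne (i j) (h : i ≠ j) : e i * f j = f j * e i
  e_e (i j) (h : cartan i j = 0) : e i * e j = e j * e i
  f_f (i j) (h : cartan i j = 0) : f i * f j = f j * f i
  serre_e (i j) (h : cartan i j = -1) : e i * e i * e j - (q.c + q.c⁻¹) • (e i * e j * e i)
    + e j * e i * e i = 0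
  serre_f (i j) (h : cartan i j = -1) : f i * f i * f j - (q.c + q.c⁻¹) • (f i * f j * f i)
    + f j * f i * f i = 0

theorem sat : Sat (B := U q n) q E F K Kinv where
  k_l i := by
    have := RingQuot.mkAlgHom_rel ℂ (URel.K_Kinv (q := q) i)
    simpa only [E, F, K, Kinv, gen, map_mul, map_one] using this
  l_k i := by
    have := RingQuot.mkAlgHom_rel ℂ (URel.Kinv_K (q := q) i)
    simpa only [E, F, K, Kinv, gen, map_mul, map_one] using this
  k_k i j := by
    have := RingQuot.mkAlgHom_rel ℂ (URel.K_K (q := q) i j)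
    simpa only [E, F, K, Kinv, gen, map_mul, map_one] using this
  k_e i j := by
    have := RingQuot.mkAlgHom_rel ℂ (URel.K_E (q := q) i j)
    rwa [map_mul, map_smul, map_mul] at this
  k_f i j := by
    have := RingQuot.mkAlgHom_rel ℂ (URel.K_F (q := q) i j)
    rwa [map_mul, map_smul, map_mul] at this
  e_f i := by
    have := RingQuot.mkAlgHom_rel ℂ (URel.E_F (q := q) i)
    rwa [map_sub, map_mul, map_mul, map_smul, map_sub] at this
  e_f_ne i j h := by
    have := RingQuot.mkAlgHom_rel ℂ (URel.E_F_ne (q := q) i j h)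
    rw [map_sub, map_mul, map_mul, map_zero] at this
    exact sub_eq_zero.mp this
  e_e i j h := by
    have := RingQuot.mkAlgHom_rel ℂ (URel.E_E (q := q) i j h)
    simpa only [E, F, K, Kinv, gen, map_mul, map_one] using this
  f_f i j h := by
    have := RingQuot.mkAlgHom_rel ℂ (URel.F_F (q := q) i j h)
    simpa only [E, F, K, Kinv, gen, map_mul, map_one] using this
  serre_e i j h := by
    have := RingQuot.mkAlgHom_rel ℂ (URel.serre_E (q := q) i j h)
    simpa only [E, F, gen, map_add, map_sub, map_mul, map_smul, map_zero] using this
  serre_f i j h := by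
    have := RingQuot.mkAlgHom_rel ℂ (URel.serre_F (q := q) i j h)
    simpa only [E, F, gen, map_add, map_sub, map_mul, map_smul, map_zero] using this

/-- The values of a homomorphism on the generators. -/
def genVal {B : Type*} (e f k l : Fin n → B) : UGen n → B
  | .E i => e i
  | .F i => f i
  | .K i => k i
  | .Kinv i => l i

/-- The homomorphism out of `U_q sl(n+1)` with given values on the generators. -/
noncomputable def lift {B : Type*} [Ring B] [Algebra ℂ B] {e f k l : Fin n → B}
    (h : Sat q e f k l) : U q n →ₐ[ℂ] B :=
  RingQuot.liftAlgHom ℂ ⟨FreeAlgebra.lift ℂ (genVal e f k l), by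
    intro x y r
    cases r with
    | K_Kinv i => simpa [genVal] using h.k_l i
    | Kinv_K i => simpa [genVal] using h.l_k i
    | K_K i j => simpa [genVal] using h.k_k i j
    | K_E i j => simpa [genVal, QC] using h.k_e i j
    | K_F i j => simpa [genVal, QC] using h.k_f i j
    | E_F i => simpa [genVal] using h.e_f i
    | E_F_ne i j hij => simpa [genVal, sub_eq_zero] using h.e_f_ne i j hij
    | E_E i j hij => simpa [genVal] using h.e_e i j hij
    | F_F i j hij => simpa [genVal] using h.f_f i j hij
    | serre_E i j hij =>
      simpa only [map_add, map_sub, map_mul, map_smul, map_zero, FreeAlgebra.lift_ι_apply, genVal]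
        using h.serre_e i j hij
    | serre_F i j hij =>
      simpa only [map_add, map_sub, map_mul, map_smul, map_zero, FreeAlgebra.lift_ι_apply, genVal]
        using h.serre_f i j hij⟩

theorem lift_gen {B : Type*} [Ring B] [Algebra ℂ B] {e f k l : Fin n → B}
    (h : Sat q e f k l) (g : UGen n) : lift h (gen g) = genVal e f k l g := by
  simp [lift, gen]

end U

/-! ### The real forms -/

/-- The opposite algebra with conjugated scalars: algebra homomorphisms into it are antilinear
antihomomorphisms. -/
def ConjOp (B : Type*) : Type _ := Bᵐᵒᵖ

namespace ConjOp
variable {B : Type*} [Ring B]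

instance : Ring (ConjOp B) := inferInstanceAs (Ring Bᵐᵒᵖ)

noncomputable instance [Algebra ℂ B] : Algebra ℂ (ConjOp B) :=
  ((algebraMap ℂ Bᵐᵒᵖ).comp (starRingEnd ℂ)).toAlgebra' (fun r x =>
    Algebra.commutes (R := ℂ) (A := Bᵐᵒᵖ) (starRingEnd ℂ r) x)

/-- The element `b` of `B` as an element of the conjugate opposite algebra. -/
def mk (b : B) : ConjOp B := MulOpposite.op b
/-- The underlying element of `B`. -/
def out (b : ConjOp B) : B := MulOpposite.unop b

theorem mk_mul (a b : B) : mk a * mk b = mk (b * a) := rfl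
theorem mk_sub (a b : B) : mk a - mk b = mk (a - b) := rfl
theorem mk_add (a b : B) : mk a + mk b = mk (a + b) := rfl
theorem mk_zero : (0 : ConjOp B) = mk 0 := rfl
theorem mk_one : (1 : ConjOp B) = mk 1 := rfl
theorem smul_mk [Algebra ℂ B] (t : ℂ) (b : B) : t • mk b = mk (starRingEnd ℂ t • b) := by
  rw [Algebra.smul_def]
  change mk (b * algebraMap ℂ B (starRingEnd ℂ t)) = _
  rw [Algebra.smul_def, Algebra.commutes]

theorem qc [Algebra ℂ B] {t : ℂ} (ht : starRingEnd ℂ t = t) {a b : B} (h : QC t b a) : QC t (mk a) (mk b) := by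
  unfold QC at *
  rw [mk_mul, mk_mul, smul_mk, h, ht]

end ConjOp


namespace U
variable {q : Par} {n : ℕ}

theorem conj_zpow (q : Par) (k : ℤ) : starRingEnd ℂ (q.c ^ k) = q.c ^ k := by
  rw [map_zpow₀, q.conj_c]

namespace Sat
variable {B : Type*} [Ring B] [Algebra ℂ B] {e f k l : Fin n → B}

theorem l_QC (h : Sat q e f k l) {i : Fin n} {x : B} {t u : ℂ} (hx : QC t (k i) x)
    (hu : t * u = 1) : QC u (l i) x := by
  unfold QC at *
  have h1 : l i * (k i * x) * l i = x * l i := by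
    rw [← mul_assoc, h.l_k, one_mul]
  rw [hx, mul_smul_comm, smul_mul_assoc, mul_assoc, mul_assoc, h.k_l, mul_one] at h1
  rw [← h1, smul_smul, mul_comm, hu, one_smul]

theorem pow_mul_pow (q : Par) (a b : ℤ) (h : a + b = 0) : q.c ^ a * q.c ^ b = 1 := by
  rw [← zpow_add₀ q.c_ne, h, zpow_zero]

theorem l_e (h : Sat q e f k l) (i j) : QC (q.c ^ (cartan i j)) (l i) (e j) :=
  h.l_QC (h.k_e i j) (pow_mul_pow q _ _ (by ring))

theorem l_f (h : Sat q e f k l) (i j) : QC (q.c ^ (-cartan i j)) (l i) (f j) :=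
  h.l_QC (h.k_f i j) (pow_mul_pow q _ _ (by ring))

theorem qkk (h : Sat q e f k l) (i j) : QC 1 (k i) (k j) := by
  simpa [QC] using h.k_k i j

theorem qlk (h : Sat q e f k l) (i j) : QC 1 (l i) (k j) := h.l_QC (h.qkk i j) (by simp)

theorem qkl (h : Sat q e f k l) (i j) : QC 1 (k i) (l j) := (h.qlk j i).symm (by simp)

theorem qll (h : Sat q e f k l) (i j) : QC 1 (l i) (l j) := h.l_QC (h.qkl i j) (by simp)

theorem triple {a1 b1 a2 b2 a3 b3 : B} {t12 t13 t23 : ℂ} (h12 : QC t12 b1 a2)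
    (h13 : QC t13 b1 a3) (h23 : QC t23 b2 a3) :
    (a1 * b1) * (a2 * b2) * (a3 * b3) = (t12 * t13 * t23) • (a1 * a2 * a3 * (b1 * b2 * b3)) := by
  unfold QC at *
  calc (a1 * b1) * (a2 * b2) * (a3 * b3) = a1 * (b1 * a2) * (b2 * a3) * b3 := by noncomm_ring
    _ = (t12 * t23) • (a1 * a2 * (b1 * a3) * b2 * b3) := by
        rw [h12, h23]
        simp only [mul_smul_comm, smul_mul_assoc, smul_smul]
        rw [mul_comm t12]
        congr 1
        noncomm_ring
    _ = _ := by
        rw [h13]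
        simp only [mul_smul_comm, smul_mul_assoc, smul_smul]
        congr 1
        · ring
        · noncomm_ring

theorem conj (h : Sat q e f k l) {r s : Fin n → ℂ} (hrs : ∀ i, r i * s i = 1) :
    Sat q (fun i => ConjOp.mk (r i • (l i * f i))) (fun i => ConjOp.mk (s i • (e i * k i)))
      (fun i => ConjOp.mk (k i)) (fun i => ConjOp.mk (l i)) where
  k_l i := congrArg ConjOp.mk (h.l_k i)
  l_k i := congrArg ConjOp.mk (h.k_l i)
  k_k i j := congrArg ConjOp.mk (h.k_k j i)
  k_e i j := by
    refine ConjOp.qc (conj_zpow q _) (QC.smul_left ?_ _)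
    exact ((h.qlk j i).mul_left ((h.k_f i j).symm (u := q.c ^ (-cartan i j))
      (pow_mul_pow q _ _ (by ring)))).cast (by simp)
  k_f i j := by
    refine ConjOp.qc (conj_zpow q _) (QC.smul_left ?_ _)
    exact (((h.k_e i j).symm (u := q.c ^ (cartan i j))
      (pow_mul_pow q _ _ (by ring))).mul_left (h.qkk j i)).cast (by simp)
  e_f i := by
    have h1 : (e i * k i) * (l i * f i) = e i * f i := by
      rw [mul_assoc, ← mul_assoc (k i), h.k_l, one_mul]
    have h3 : QC 1 (k i) (f i * e i) := ((h.k_f i i).mul_right (h.k_e i i)).cast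
      (pow_mul_pow q _ _ (by ring))
    have h2 : (l i * f i) * (e i * k i) = f i * e i := by
      unfold QC at h3
      rw [one_smul] at h3
      calc (l i * f i) * (e i * k i) = l i * (f i * e i * k i) := by noncomm_ring
        _ = l i * k i * (f i * e i) := by rw [← h3]; noncomm_ring
        _ = _ := by rw [h.l_k, one_mul]
    have hsr : s i * r i = 1 := by rw [mul_comm, hrs]
    rw [ConjOp.mk_mul, ConjOp.mk_mul, ConjOp.mk_sub, ConjOp.mk_sub, ConjOp.smul_mk]
    congr 1
    simp only [mul_smul_comm, smul_mul_assoc, smul_smul, h1, h2, hrs, hsr, one_smul]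
    rw [h.e_f]
    simp [q.conj_c]
  e_f_ne i j hij := by
    rw [ConjOp.mk_mul, ConjOp.mk_mul]
    congr 1
    simp only [mul_smul_comm, smul_mul_assoc]
    rw [smul_comm]
    congr 2
    have hef : QC 1 (e j) (f i) := by simpa [QC] using h.e_f_ne j i (Ne.symm hij)
    have h1 : QC (q.c ^ (-cartan j i)) (e j) (l i * f i) :=
      (((h.l_e i j).symm (u := q.c ^ (-cartan j i)) (pow_mul_pow q _ _ (by
        rw [cartan_comm]; ring))).mul_right hef).cast (by simp)
    have h2 : QC (q.c ^ (cartan j i)) (k j) (l i * f i) :=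
      ((h.qkl j i).mul_right (h.k_f j i)).cast (by simp)
    have h3 := (h1.mul_left h2).cast (s := 1) (pow_mul_pow q _ _ (by ring))
    simpa [QC] using h3
  e_e i j hij := by
    rw [ConjOp.mk_mul, ConjOp.mk_mul]
    congr 1
    simp only [mul_smul_comm, smul_mul_assoc]
    rw [smul_comm]
    congr 2
    have hji : cartan j i = 0 := by rw [cartan_comm, hij]
    have hff : QC 1 (f j) (f i) := by simpa [QC] using h.f_f j i hji
    have hlf : QC 1 (l j) (f i) := (h.l_f j i).cast (by simp [hji])
    have hfl : QC 1 (f j) (l i) := ((h.l_f i j).cast (s := 1) (by simp [hij])).symm (by simp)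
    have := (((h.qll j i).mul_right hlf)).mul_left (hfl.mul_right hff)
    simpa [QC] using this
  f_f i j hij := by
    rw [ConjOp.mk_mul, ConjOp.mk_mul]
    congr 1
    simp only [mul_smul_comm, smul_mul_assoc]
    rw [smul_comm]
    congr 2
    have hji : cartan j i = 0 := by rw [cartan_comm, hij]
    have hee : QC 1 (e j) (e i) := by simpa [QC] using h.e_e j i hji
    have hke : QC 1 (k j) (e i) := (h.k_e j i).cast (by simp [hji])
    have hek : QC 1 (e j) (k i) := ((h.k_e i j).cast (s := 1) (by simp [hij])).symm (by simp)
    have := (hee.mul_right hek).mul_left (hke.mul_right (h.qkk j i))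
    simpa [QC] using this
  serre_e i j hij := by
    have hji : cartan j i = -1 := by rw [cartan_comm, hij]
    have fl (a b : Fin n) : QC (q.c ^ (cartan b a)) (f a) (l b) :=
      (h.l_f b a).symm (pow_mul_pow q _ _ (by ring))
    have key : ∀ a b c : Fin n, (l a * f a) * ((l b * f b) * (l c * f c))
        = (q.c ^ (cartan b a) * q.c ^ (cartan c a) * q.c ^ (cartan c b)) •
          (l a * l b * l c * (f a * f b * f c)) := fun a b c => by
      rw [← mul_assoc]; exact triple (fl a b) (fl a c) (fl b c)
    have hll (a b : Fin n) : l a * l b = l b * l a := by simpa [QC] using h.qll a b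
    rw [ConjOp.mk_mul, ConjOp.mk_mul, ConjOp.mk_mul, ConjOp.mk_mul, ConjOp.mk_mul, ConjOp.mk_mul,
      ConjOp.smul_mk, ConjOp.mk_sub, ConjOp.mk_add, ConjOp.mk_zero]
    congr 1
    simp only [mul_smul_comm, smul_mul_assoc, smul_smul]
    rw [key j i i, key i j i, key i i j]
    simp only [smul_smul]
    have e1 : l j * l i * l i = l i * l i * l j := by rw [hll j i, mul_assoc, hll j i, mul_assoc]
    have e2 : l i * l j * l i = l i * l i * l j := by rw [mul_assoc, hll j i, mul_assoc]
    rw [e1, e2]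
    have hc : starRingEnd ℂ (q.c + q.c⁻¹) = q.c + q.c⁻¹ := by simp [q.conj_c]
    rw [hc]
    have hS := congrArg (fun x => (r i * r i * r j * (q.c ^ (cartan i i) * q.c ^ (cartan i j) *
      q.c ^ (cartan i j))) • (l i * l i * l j * x)) (h.serre_f i j hij)
    simp only [mul_zero, smul_zero, mul_add, mul_sub, mul_smul_comm, smul_add, smul_sub,
      smul_smul] at hS
    rw [← hS, hji, hij]
    simp only [mul_assoc]
    module
  serre_f i j hij := by
    have hji : cartan j i = -1 := by rw [cartan_comm, hij]
    have key : ∀ a b c : Fin n, (e a * k a) * ((e b * k b) * (e c * k c))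
        = (q.c ^ (-cartan a b) * q.c ^ (-cartan a c) * q.c ^ (-cartan b c)) •
          (e a * e b * e c * (k a * k b * k c)) :=
      fun a b c => by rw [← mul_assoc]; exact triple (h.k_e a b) (h.k_e a c) (h.k_e b c)
    have hll := h.k_k
    rw [ConjOp.mk_mul, ConjOp.mk_mul, ConjOp.mk_mul, ConjOp.mk_mul, ConjOp.mk_mul, ConjOp.mk_mul,
      ConjOp.smul_mk, ConjOp.mk_sub, ConjOp.mk_add, ConjOp.mk_zero]
    congr 1
    simp only [mul_smul_comm, smul_mul_assoc, smul_smul]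
    rw [key j i i, key i j i, key i i j]
    simp only [smul_smul]
    have e1 : k j * k i * k i = k i * k i * k j := by rw [hll j i, mul_assoc, hll j i, mul_assoc]
    have e2 : k i * k j * k i = k i * k i * k j := by rw [mul_assoc, hll j i, mul_assoc]
    rw [e1, e2]
    have hc : starRingEnd ℂ (q.c + q.c⁻¹) = q.c + q.c⁻¹ := by simp [q.conj_c]
    rw [hc]
    have hS := congrArg (fun x => (s i * s i * s j * (q.c ^ (-cartan i i) * q.c ^ (-cartan i j) *
      q.c ^ (-cartan i j))) • (x * (k i * k i * k j))) (h.serre_e i j hij)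
    simp only [zero_mul, smul_zero, add_mul, sub_mul, smul_mul_assoc, smul_add, smul_sub,
      smul_smul] at hS
    rw [← hS, hji, hij]
    simp only [mul_assoc]
    module

end Sat

/-- The sign `ι_{i-1} ι_i` attached to the `i`-th simple root. -/
def sgn {n : ℕ} (ι : Fin (n + 1) → ℤˣ) (i : Fin n) : ℤ := (ι i.castSucc * ι i.succ : ℤˣ)

theorem sgn_mul_self {n : ℕ} (ι : Fin (n + 1) → ℤˣ) (i : Fin n) : sgn ι i * sgn ι i = 1 := by
  unfold sgn
  rw [← Units.val_mul, Int.units_mul_self, Units.val_one]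

theorem sat_real (ι : Fin (n + 1) → ℤˣ) :
    Sat q (fun i => ConjOp.mk (((sgn ι i : ℂ) * q.c) • (Kinv i * F i : U q n)))
      (fun i => ConjOp.mk (((sgn ι i : ℂ) * q.c⁻¹) • (E i * K i : U q n)))
      (fun i => ConjOp.mk (K i : U q n)) (fun i => ConjOp.mk (Kinv i : U q n)) :=
  sat.conj (fun i => by
    have h : (sgn ι i : ℂ) * (sgn ι i : ℂ) = 1 := by exact_mod_cast sgn_mul_self ι i
    have := q.c_ne
    field_simp
    linear_combination h)

/-- The involution of the real form `U_q su⟨ι⟩`: the antilinear antiautomorphism with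
`E_i ↦ ι_{i-1} ι_i q K_i⁻¹ F_i`, `F_i ↦ ι_{i-1} ι_i q⁻¹ E_i K_i`, `K_i ↦ K_i`. -/
noncomputable def natStar (ι : Fin (n + 1) → ℤˣ) (a : U q n) : U q n :=
  ConjOp.out (lift (sat_real ι) a)

theorem star_add (ι : Fin (n + 1) → ℤˣ) (a b : U q n) : natStar ι (a + b) = natStar ι a + natStar ι b :=
  congrArg ConjOp.out (map_add (lift (sat_real ι)) a b)

theorem star_mul (ι : Fin (n + 1) → ℤˣ) (a b : U q n) : natStar ι (a * b) = natStar ι b * natStar ι a :=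
  congrArg ConjOp.out (map_mul (lift (sat_real ι)) a b)

theorem star_smul (ι : Fin (n + 1) → ℤˣ) (t : ℂ) (a : U q n) :
    natStar ι (t • a) = starRingEnd ℂ t • natStar ι a := by
  refine (congrArg ConjOp.out (map_smul (lift (sat_real ι)) t a)).trans ?_
  exact congrArg ConjOp.out (ConjOp.smul_mk t (natStar ι a))

theorem star_E (ι : Fin (n + 1) → ℤˣ) (i : Fin n) :
    natStar ι (E i : U q n) = ((sgn ι i : ℂ) * q.c) • (Kinv i * F i) :=
  congrArg ConjOp.out (lift_gen (sat_real ι) (.E i))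

theorem star_F (ι : Fin (n + 1) → ℤˣ) (i : Fin n) :
    natStar ι (F i : U q n) = ((sgn ι i : ℂ) * q.c⁻¹) • (E i * K i) :=
  congrArg ConjOp.out (lift_gen (sat_real ι) (.F i))

theorem star_K (ι : Fin (n + 1) → ℤˣ) (i : Fin n) : natStar ι (K i : U q n) = K i :=
  congrArg ConjOp.out (lift_gen (sat_real ι) (.K i))

theorem star_Kinv (ι : Fin (n + 1) → ℤˣ) (i : Fin n) : natStar ι (Kinv i : U q n) = Kinv i :=
  congrArg ConjOp.out (lift_gen (sat_real ι) (.Kinv i))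

end U

/-! ### The algebra of functions

The points `x = (x_0, …, x_{n+1})`; for `i : Fin n` the entries with indices `i.castSucc.castSucc`,
`i.succ.castSucc`, `i.succ.succ` are `x_{i-1}, x_i, x_{i+1}` of the (one-based) index `i`. -/

/-- The points at which all `x_i` are invertible and all roots `(x_{i-1} x_{i+1})^{1/2}` are
real and non-zero. -/
abbrev Dom (n : ℕ) : Type :=
  {x : Fin (n + 2) → ℝ // (∀ j, x j ≠ 0) ∧ ∀ i : Fin n, 0 < x i.castSucc.castSucc * x i.succ.succ}

/-- The substitution `(x_0, …, x_{n+1}) ↦ (x_0, …, x_k, t x_{k+1}, …, t x_{n+1})`. -/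
def shift {n : ℕ} (t : ℝ) (ht : 0 < t) (k : Fin (n + 1)) (x : Dom n) : Dom n :=
  ⟨fun j => (if k.1 < j.1 then t else 1) * x.1 j, by
    refine ⟨fun j => mul_ne_zero ?_ (x.2.1 j), fun i => ?_⟩
    · split_ifs
      · exact ht.ne'
      · exact one_ne_zero
    · have h := x.2.2 i
      rw [mul_mul_mul_comm]
      refine mul_pos (mul_pos ?_ ?_) h <;> split_ifs <;> first | exact ht | exact one_pos⟩

namespace Par

/-- A branch of the square root of `t > 0` with `root (q² t) = q root t`; the positive square root
if `q > 0`. -/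
noncomputable def root (q : Par) (t : ℝ) : ℝ :=
  Real.sqrt t * (if 0 < q.1 then 1 else (-1) ^ ⌊Real.log t / Real.log (q.1 ^ 2)⌋)

theorem root_mul_self (q : Par) {t : ℝ} (ht : 0 < t) : q.root t * q.root t = t := by
  unfold root
  rw [mul_mul_mul_comm, Real.mul_self_sqrt ht.le]
  split_ifs
  · simp
  · rw [← mul_zpow]; simp

theorem root_sq_mul (q : Par) {t : ℝ} (ht : 0 < t) : q.root (q.1 ^ 2 * t) = q.1 * q.root t := by
  unfold root
  have h1 : Real.log (q.1 ^ 2) ≠ 0 := (Real.log_neg q.sq_pos q.sq_lt_one).ne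
  rw [Real.log_mul q.sq_pos.ne' ht.ne', add_div, div_self h1, add_comm, Int.floor_add_one,
    Real.sqrt_mul q.sq_pos.le, Real.sqrt_sq_eq_abs, zpow_add_one₀ (by norm_num)]
  split_ifs with h
  · rw [abs_of_pos h]; ring
  · rw [abs_of_nonpos (not_lt.mp h)]; ring

theorem root_ne (q : Par) {t : ℝ} (ht : 0 < t) : q.root t ≠ 0 := by
  intro h
  have := q.root_mul_self ht
  rw [h] at this
  linarith

end Par

/-- Generators of the extended algebra: the coordinates `z_k`, `ẑ_k` and the functions of
`(x_0, …, x_{n+1})`. -/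
inductive OGen (n : ℕ) : Type
  | z (k : Fin (n + 1))
  | zh (k : Fin (n + 1))
  | fn (f : Dom n → ℂ)

/-- The function `x_j`. -/
def coord {n : ℕ} (j : Fin (n + 2)) : Dom n → ℂ := fun x => (x.1 j : ℂ)

open FreeAlgebra OGen in
/-- The defining relations of the algebra `ℂ[O_V]_q` extended by the functions of
`(x_0, …, x_{n+1})`. The relations `z_k ẑ_k = x_k - x_{k+1}` say that
`x_j = ∑_{k ≥ j} z_k ẑ_k + q c` with `q c = x_{n+1}`. -/
inductive ORel (q : Par) (n : ℕ) : FreeAlgebra ℂ (OGen n) → FreeAlgebra ℂ (OGen n) → Prop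
  | z_z (i j : Fin (n + 1)) (h : i < j) :
      ORel q n (ι ℂ (z i) * ι ℂ (z j)) (q.c • (ι ℂ (z j) * ι ℂ (z i)))
  | zh_zh (i j : Fin (n + 1)) (h : i < j) :
      ORel q n (ι ℂ (zh i) * ι ℂ (zh j)) (q.c⁻¹ • (ι ℂ (zh j) * ι ℂ (zh i)))
  | z_zh (i j : Fin (n + 1)) (h : i ≠ j) :
      ORel q n (ι ℂ (z i) * ι ℂ (zh j)) (q.c • (ι ℂ (zh j) * ι ℂ (z i)))
  | z_zh_self (k : Fin (n + 1)) :
      ORel q n (ι ℂ (z k) * ι ℂ (zh k)) (ι ℂ (fn (coord k.castSucc)) - ι ℂ (fn (coord k.succ)))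
  | zh_z_self (k : Fin (n + 1)) :
      ORel q n (ι ℂ (z k) * ι ℂ (zh k) - ι ℂ (zh k) * ι ℂ (z k))
        ((q.c⁻¹ ^ 2 - 1) • ι ℂ (fn (coord k.succ)))
  | z_fn (k : Fin (n + 1)) (f : Dom n → ℂ) :
      ORel q n (ι ℂ (z k) * ι ℂ (fn f))
        (ι ℂ (fn (fun x => f (shift (q.1 ^ 2) q.sq_pos k x))) * ι ℂ (z k))
  | zh_fn (k : Fin (n + 1)) (f : Dom n → ℂ) :
      ORel q n (ι ℂ (zh k) * ι ℂ (fn f))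
        (ι ℂ (fn (fun x => f (shift (q.1 ^ 2)⁻¹ (inv_pos.mpr q.sq_pos) k x))) * ι ℂ (zh k))
  | fn_add (f g : Dom n → ℂ) : ORel q n (ι ℂ (fn (f + g))) (ι ℂ (fn f) + ι ℂ (fn g))
  | fn_mul (f g : Dom n → ℂ) : ORel q n (ι ℂ (fn (f * g))) (ι ℂ (fn f) * ι ℂ (fn g))
  | fn_const (t : ℂ) :
      ORel q n (ι ℂ (fn (algebraMap ℂ (Dom n → ℂ) t))) (algebraMap ℂ (FreeAlgebra ℂ (OGen n)) t)

/-- The extended algebra `Func(O_V)_q`. -/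
abbrev O (q : Par) (n : ℕ) : Type := RingQuot (ORel q n)

namespace O
variable {q : Par} {n : ℕ}

/-- A generator of `Func(O_V)_q`. -/
noncomputable def gen (g : OGen n) : O q n := RingQuot.mkAlgHom ℂ (ORel q n) (FreeAlgebra.ι ℂ g)

/-- The element `z_k`. -/
noncomputable def z (k : Fin (n + 1)) : O q n := gen (.z k)
/-- The element `ẑ_k`. -/
noncomputable def zh (k : Fin (n + 1)) : O q n := gen (.zh k)
/-- The function `f(x)`. -/
noncomputable def fn (f : Dom n → ℂ) : O q n := gen (.fn f)

theorem fn_add (f g : Dom n → ℂ) : (fn (f + g) : O q n) = fn f + fn g := by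
  have := RingQuot.mkAlgHom_rel ℂ (ORel.fn_add (q := q) f g)
  rwa [map_add] at this

theorem fn_mul (f g : Dom n → ℂ) : (fn (f * g) : O q n) = fn f * fn g := by
  have := RingQuot.mkAlgHom_rel ℂ (ORel.fn_mul (q := q) f g)
  rwa [map_mul] at this

theorem fn_const (t : ℂ) : (fn (algebraMap ℂ (Dom n → ℂ) t) : O q n) = algebraMap ℂ _ t := by
  have := RingQuot.mkAlgHom_rel ℂ (ORel.fn_const (q := q) (n := n) t)
  rwa [AlgHom.commutes] at this

/-- The inclusion of the functions of `(x_0, …, x_{n+1})`. -/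
noncomputable def fnHom (q : Par) (n : ℕ) : (Dom n → ℂ) →ₐ[ℂ] O q n :=
  AlgHom.mk
    { toFun := fn
      map_one' := by simpa using fn_const (q := q) (n := n) 1
      map_mul' := fn_mul
      map_zero' := by simpa using fn_const (q := q) (n := n) 0
      map_add' := fn_add }
    fn_const

/-- Scaling of the generators by a complex number of modulus one. -/
noncomputable def kappaVal (α : Circle) : OGen n → O q n
  | .z k => (α : ℂ) • z k
  | .zh k => starRingEnd ℂ (α : ℂ) • zh k
  | .fn f => fn f

/-- The automorphism `κ_α : z_k ↦ α z_k, ẑ_k ↦ ᾱ ẑ_k, f(x) ↦ f(x)` for `|α| = 1`. -/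
noncomputable def kappa (α : Circle) : O q n →ₐ[ℂ] O q n :=
  RingQuot.liftAlgHom ℂ ⟨FreeAlgebra.lift ℂ (kappaVal α), by
    have hα : (α : ℂ) * starRingEnd ℂ (α : ℂ) = 1 := by
      rw [Complex.mul_conj, Circle.normSq_coe, Complex.ofReal_one]
    have rel := fun {x y} (h : ORel q n x y) => RingQuot.mkAlgHom_rel ℂ h
    intro x y r
    have hr := rel r
    cases r with
    | z_z i j h =>
      simp only [map_mul, map_smul, FreeAlgebra.lift_ι_apply, kappaVal] at hr ⊢
      simp only [smul_mul_smul_comm, z, gen, hr]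
      rw [smul_comm]
    | zh_zh i j h =>
      simp only [map_mul, map_smul, FreeAlgebra.lift_ι_apply, kappaVal] at hr ⊢
      simp only [smul_mul_smul_comm, zh, gen, hr]
      rw [smul_comm]
    | z_zh i j h =>
      simp only [map_mul, map_smul, FreeAlgebra.lift_ι_apply, kappaVal] at hr ⊢
      simp only [smul_mul_smul_comm, z, zh, gen, hr]
      rw [smul_comm, mul_comm (starRingEnd ℂ (α : ℂ))]
    | z_zh_self k =>
      simp only [map_mul, map_sub, FreeAlgebra.lift_ι_apply, kappaVal] at hr ⊢
      simp only [smul_mul_smul_comm, hα, one_smul, z, zh, fn, gen, hr]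
    | zh_z_self k =>
      simp only [map_mul, map_sub, map_smul, FreeAlgebra.lift_ι_apply, kappaVal] at hr ⊢
      simp only [smul_mul_smul_comm, mul_comm (starRingEnd ℂ (α : ℂ)), hα, one_smul, z, zh, fn,
        gen, hr]
    | z_fn k f =>
      simp only [map_mul, FreeAlgebra.lift_ι_apply, kappaVal] at hr ⊢
      simp only [smul_mul_assoc, mul_smul_comm, z, fn, gen, hr]
    | zh_fn k f =>
      simp only [map_mul, FreeAlgebra.lift_ι_apply, kappaVal] at hr ⊢
      simp only [smul_mul_assoc, mul_smul_comm, zh, fn, gen, hr]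
    | fn_add f g =>
      simpa only [map_add, FreeAlgebra.lift_ι_apply, kappaVal, fn, gen] using hr
    | fn_mul f g =>
      simpa only [map_mul, FreeAlgebra.lift_ι_apply, kappaVal, fn, gen] using hr
    | fn_const t =>
      simpa only [AlgHom.commutes, FreeAlgebra.lift_ι_apply, kappaVal, fn, gen] using hr⟩

theorem kappa_z (α : Circle) (k : Fin (n + 1)) : kappa α (z k : O q n) = (α : ℂ) • z k := by
  simp [kappa, z, gen, kappaVal]

theorem kappa_zh (α : Circle) (k : Fin (n + 1)) :
    kappa α (zh k : O q n) = starRingEnd ℂ (α : ℂ) • zh k := by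
  simp [kappa, zh, gen, kappaVal]

theorem kappa_fn (α : Circle) (f : Dom n → ℂ) : kappa α (fn f : O q n) = fn f := by
  simp [kappa, fn, gen, kappaVal]

end O

/-- The algebra `Func(X)_q` of the elements of `Func(O_V)_q` that are invariant under all `κ_α`. -/
noncomputable def FuncX (q : Par) (n : ℕ) : Subalgebra ℂ (O q n) :=
  ⨅ α : Circle, AlgHom.equalizer (O.kappa α) (AlgHom.id ℂ (O q n))

theorem mem_FuncX {q : Par} {n : ℕ} {a : O q n} :
    a ∈ FuncX q n ↔ ∀ α : Circle, O.kappa α a = a := by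
  simp [FuncX, Algebra.mem_iInf, AlgHom.mem_equalizer]

theorem fn_mem {q : Par} {n : ℕ} (f : Dom n → ℂ) : (O.fn f : O q n) ∈ FuncX q n :=
  mem_FuncX.mpr fun α => O.kappa_fn α f

theorem z_zh_mem {q : Par} {n : ℕ} (i j : Fin (n + 1)) :
    (O.z i * O.zh j : O q n) ∈ FuncX q n := by
  refine mem_FuncX.mpr fun α => ?_
  have hα : (α : ℂ) * starRingEnd ℂ (α : ℂ) = 1 := by
    rw [Complex.mul_conj, Circle.normSq_coe, Complex.ofReal_one]
  rw [map_mul, O.kappa_z, O.kappa_zh, smul_mul_smul_comm, hα, one_smul]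

/-! ### The moment map -/

/-- `f(x_0, …, x_k, q² x_{k+1}, …, q² x_{n+1}) = q^{w k} f(x)` for all `k`. -/
def Eigen {n : ℕ} (q : Par) (f : Dom n → ℂ) (w : Fin (n + 1) → ℤ) : Prop :=
  ∀ k x, f (shift (q.1 ^ 2) q.sq_pos k x) = q.c ^ w k * f x

/-- `1` if `k < j` and `0` otherwise. -/
def ex {n : ℕ} (k : Fin (n + 1)) (j : Fin (n + 2)) : ℤ := if k.1 < j.1 then 1 else 0

namespace Eigen
variable {q : Par} {n : ℕ} {f g : Dom n → ℂ} {w v : Fin (n + 1) → ℤ}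

theorem mul (hf : Eigen q f w) (hg : Eigen q g v) : Eigen q (f * g) (fun k => w k + v k) := by
  intro k x
  simp only [Pi.mul_apply]
  rw [hf, hg, zpow_add₀ q.c_ne]
  ring

theorem inv (hf : Eigen q f w) : Eigen q (f⁻¹) (fun k => -w k) := by
  intro k x
  simp only [Pi.inv_apply]
  rw [hf, mul_inv, zpow_neg]

theorem shift_shift_inv (k : Fin (n + 1)) (x : Dom n) :
    shift (q.1 ^ 2) q.sq_pos k (shift (q.1 ^ 2)⁻¹ (inv_pos.mpr q.sq_pos) k x) = x := by
  apply Subtype.ext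
  funext j
  simp only [shift]
  split_ifs
  · rw [← mul_assoc, mul_inv_cancel₀ q.sq_pos.ne', one_mul]
  · simp

theorem inv_shift (hf : Eigen q f w) (k : Fin (n + 1)) (x : Dom n) :
    f (shift (q.1 ^ 2)⁻¹ (inv_pos.mpr q.sq_pos) k x) = q.c ^ (-w k) * f x := by
  have h := hf k (shift (q.1 ^ 2)⁻¹ (inv_pos.mpr q.sq_pos) k x)
  rw [shift_shift_inv] at h
  rw [h, ← mul_assoc, ← zpow_add₀ q.c_ne]
  simp

theorem coord (j : Fin (n + 2)) : Eigen q (coord j) (fun k => 2 * ex k j) := by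
  intro k x
  simp only [QOrbit.coord, shift, ex, Par.c]
  split_ifs
  · push_cast; norm_cast
  · simp

end Eigen

/-- The function `(x_{i-1} x_{i+1})^{1/2}`. -/
noncomputable def rt {n : ℕ} (q : Par) (i : Fin n) : Dom n → ℂ :=
  fun x => (q.root (x.1 i.castSucc.castSucc * x.1 i.succ.succ) : ℂ)

theorem eigen_rt {n : ℕ} (q : Par) (i : Fin n) :
    Eigen q (rt q i) (fun k => ex k i.castSucc.castSucc + ex k i.succ.succ) := by
  intro k x
  have h := x.2.2 i
  have h2 := q.root_sq_mul h
  have h4 := q.root_sq_mul (mul_pos q.sq_pos h)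
  simp only [rt, shift, ex, Par.c]
  rw [mul_mul_mul_comm]
  have hl : i.castSucc.castSucc.1 < i.succ.succ.1 := by simp
  by_cases h1 : k.1 < i.castSucc.castSucc.1
  · have h3 : k.1 < i.succ.succ.1 := h1.trans hl
    rw [if_pos h1, if_pos h3, if_pos h1, if_pos h3, mul_assoc, h4, h2]
    norm_num
    ring
  · by_cases h3 : k.1 < i.succ.succ.1
    · rw [if_neg h1, if_pos h3, if_neg h1, if_pos h3, one_mul, h2]
      norm_num
    · rw [if_neg h1, if_neg h3, if_neg h1, if_neg h3]
      norm_num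

theorem coord_ne {n : ℕ} (j : Fin (n + 2)) (x : Dom n) : coord j x ≠ 0 := by
  have := x.2.1 j
  unfold coord
  exact_mod_cast this

theorem rt_ne {n : ℕ} (q : Par) (i : Fin n) (x : Dom n) : rt q i x ≠ 0 := by
  have := q.root_ne (x.2.2 i)
  unfold rt
  exact_mod_cast this

theorem rt_mul_self {n : ℕ} (q : Par) (i : Fin n) :
    rt q i * rt q i = coord i.castSucc.castSucc * coord i.succ.succ := by
  funext x
  have := q.root_mul_self (x.2.2 i)
  simp only [rt, coord, Pi.mul_apply]
  exact_mod_cast this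

namespace O
variable {q : Par} {n : ℕ}

theorem fn_smul (t : ℂ) (f : Dom n → ℂ) : (fn (t • f) : O q n) = t • fn f :=
  map_smul (fnHom q n) t f

theorem fn_sub (f g : Dom n → ℂ) : (fn (f - g) : O q n) = fn f - fn g := map_sub (fnHom q n) f g

theorem fn_one : (fn 1 : O q n) = 1 := map_one (fnHom q n)

theorem qc_fn (f g : Dom n → ℂ) : QC 1 (fn f : O q n) (fn g) := by
  unfold QC
  rw [← fn_mul, ← fn_mul, mul_comm, one_smul]

theorem qc_z_fn {f : Dom n → ℂ} {w : Fin (n + 1) → ℤ} (hf : Eigen q f w) (k : Fin (n + 1)) :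
    QC (q.c ^ w k) (z k : O q n) (fn f) := by
  have := RingQuot.mkAlgHom_rel ℂ (ORel.z_fn (q := q) k f)
  rw [map_mul, map_mul] at this
  have h : (fun x => f (shift (q.1 ^ 2) q.sq_pos k x)) = q.c ^ w k • f := funext fun x => hf k x
  rw [h] at this
  refine this.trans ?_
  change fn _ * _ = _
  rw [fn_smul, smul_mul_assoc]
  rfl

theorem qc_zh_fn {f : Dom n → ℂ} {w : Fin (n + 1) → ℤ} (hf : Eigen q f w) (k : Fin (n + 1)) :
    QC (q.c ^ (-w k)) (zh k : O q n) (fn f) := by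
  have := RingQuot.mkAlgHom_rel ℂ (ORel.zh_fn (q := q) k f)
  rw [map_mul, map_mul] at this
  have h : (fun x => f (shift (q.1 ^ 2)⁻¹ (inv_pos.mpr q.sq_pos) k x)) = q.c ^ (-w k) • f :=
    funext fun x => hf.inv_shift k x
  rw [h] at this
  refine this.trans ?_
  change fn _ * _ = _
  rw [fn_smul, smul_mul_assoc]
  rfl

/-- `1`, `-1`, `0` if `a < b`, `b < a`, `a = b`. -/
def sg (a b : Fin (n + 1)) : ℤ := if a.1 < b.1 then 1 else if b.1 < a.1 then -1 else 0

theorem qc_z_z (a b : Fin (n + 1)) : QC (q.c ^ sg a b) (z a : O q n) (z b) := by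
  have key : ∀ a b : Fin (n + 1), a < b → QC q.c (z a : O q n) (z b) := fun a b h => by
    have := RingQuot.mkAlgHom_rel ℂ (ORel.z_z (q := q) a b h)
    rwa [map_mul, map_smul, map_mul] at this
  unfold sg
  split_ifs with h1 h2
  · exact (key a b h1).cast (by simp)
  · exact ((key b a h2).symm (mul_inv_cancel₀ q.c_ne)).cast (by simp)
  · have : a = b := le_antisymm (not_lt.mp h2) (not_lt.mp h1)
    subst this
    simp [QC]

theorem qc_zh_zh (a b : Fin (n + 1)) : QC (q.c ^ (-sg a b)) (zh a : O q n) (zh b) := by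
  have key : ∀ a b : Fin (n + 1), a < b → QC q.c⁻¹ (zh a : O q n) (zh b) := fun a b h => by
    have := RingQuot.mkAlgHom_rel ℂ (ORel.zh_zh (q := q) a b h)
    rwa [map_mul, map_smul, map_mul] at this
  unfold sg
  split_ifs with h1 h2
  · exact (key a b h1).cast (by simp)
  · exact ((key b a h2).symm (inv_mul_cancel₀ q.c_ne)).cast (by simp)
  · have : a = b := le_antisymm (not_lt.mp h2) (not_lt.mp h1)
    subst this
    simp [QC]

theorem qc_z_zh {a b : Fin (n + 1)} (h : a ≠ b) : QC (q.c ^ (1 : ℤ)) (z a : O q n) (zh b) := by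
  have := RingQuot.mkAlgHom_rel ℂ (ORel.z_zh (q := q) a b h)
  rw [map_mul, map_smul, map_mul] at this
  rw [zpow_one]
  exact this

theorem qc_zh_z {a b : Fin (n + 1)} (h : a ≠ b) : QC (q.c ^ (-1 : ℤ)) (zh a : O q n) (z b) :=
  (qc_z_zh (Ne.symm h)).symm (U.Sat.pow_mul_pow q _ _ (by norm_num))

theorem z_zh_self (k : Fin (n + 1)) :
    (z k * zh k : O q n) = fn (coord k.castSucc) - fn (coord k.succ) := by
  have := RingQuot.mkAlgHom_rel ℂ (ORel.z_zh_self (q := q) k)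
  rwa [map_mul, map_sub] at this

theorem zh_z_self (k : Fin (n + 1)) :
    (zh k * z k : O q n) = fn (coord k.castSucc) - q.c⁻¹ ^ 2 • fn (coord k.succ) := by
  have := RingQuot.mkAlgHom_rel ℂ (ORel.zh_z_self (q := q) k)
  rw [map_sub, map_mul, map_mul, map_smul] at this
  have h2 : (z k * zh k - zh k * z k : O q n) = (q.c⁻¹ ^ 2 - 1) • fn (coord k.succ) := this
  rw [z_zh_self] at h2
  have h3 : (zh k * z k : O q n) = fn (coord k.castSucc) - fn (coord k.succ) -
    (fn (coord k.castSucc) - fn (coord k.succ) - zh k * z k) := by abel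
  rw [h3, h2]
  module

/-- The element `z_a ẑ_b`. -/
noncomputable def Y (q : Par) {n : ℕ} (a b : Fin (n + 1)) : O q n := z a * zh b

theorem qc_Y_fn {f : Dom n → ℂ} {w : Fin (n + 1) → ℤ} (hf : Eigen q f w) (a b : Fin (n + 1)) :
    QC (q.c ^ (w a - w b)) (Y q a b) (fn f) :=
  ((qc_z_fn hf a).mul_left (qc_zh_fn hf b)).cast (by rw [← zpow_add₀ q.c_ne, sub_eq_add_neg])

theorem qc_fn_Y {f : Dom n → ℂ} {w : Fin (n + 1) → ℤ} (hf : Eigen q f w) (a b : Fin (n + 1)) :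
    QC (q.c ^ (w b - w a)) (fn f) (Y q a b) :=
  (qc_Y_fn hf a b).symm (U.Sat.pow_mul_pow q _ _ (by ring))

theorem qc_Y_Y {a b c d : Fin (n + 1)} (h1 : a ≠ d) (h2 : b ≠ c) :
    QC (q.c ^ (sg a c - sg b d)) (Y q a b) (Y q c d) :=
  (((qc_z_z a c).mul_right (qc_z_zh h1)).mul_left
    ((qc_zh_z h2).mul_right (qc_zh_zh b d))).cast (by
      rw [← zpow_add₀ q.c_ne, ← zpow_add₀ q.c_ne, ← zpow_add₀ q.c_ne]; congr 1; ring)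

/-- Elements `f(x) z_a ẑ_b` commute up to a power of `q`. -/
theorem qc_fY {f g : Dom n → ℂ} {w v : Fin (n + 1) → ℤ} (hf : Eigen q f w) (hg : Eigen q g v)
    {a b c d : Fin (n + 1)} (h1 : a ≠ d) (h2 : b ≠ c) :
    QC (q.c ^ (w d - w c + (v a - v b) + (sg a c - sg b d)))
      (fn f * Y q a b) (fn g * Y q c d) :=
  (((qc_fn f g).mul_right (qc_fn_Y hf c d)).mul_left
    ((qc_Y_fn hg a b).mul_right (qc_Y_Y h1 h2))).cast (by
      rw [one_mul, ← zpow_add₀ q.c_ne, ← zpow_add₀ q.c_ne]; congr 1; ring)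

theorem double {B : Type*} [Ring B] [Algebra ℂ B] {a1 b1 a2 b2 : B} {t : ℂ} (h : QC t b1 a2) :
    (a1 * b1) * (a2 * b2) = t • (a1 * a2 * (b1 * b2)) := by
  unfold QC at h
  calc (a1 * b1) * (a2 * b2) = a1 * (b1 * a2) * b2 := by noncomm_ring
    _ = _ := by rw [h]; simp only [mul_smul_comm, smul_mul_assoc]; congr 1; noncomm_ring

theorem mul_fY {f g : Dom n → ℂ} {v : Fin (n + 1) → ℤ} (hg : Eigen q g v)
    (a b c d : Fin (n + 1)) :
    (fn f * Y q a b) * (fn g * Y q c d)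
      = q.c ^ (v a - v b) • (fn (f * g) * (Y q a b * Y q c d)) := by
  rw [double (qc_Y_fn hg a b), fn_mul]

/-- `z_a (ẑ_b z_b) ẑ_d`. -/
theorem Y_mul_Y (a b d : Fin (n + 1)) :
    Y q a b * Y q b d = fn ((q.c ^ (2 * ex a b.castSucc)) • coord b.castSucc
      - (q.c ^ (2 * ex a b.succ - 2)) • coord b.succ) * Y q a d := by
  have e1 := qc_z_fn (q := q) (Eigen.coord b.castSucc) a
  have e2 := qc_z_fn (q := q) (Eigen.coord b.succ) a
  unfold QC at e1 e2
  calc Y q a b * Y q b d = z a * (zh b * z b) * zh d := by unfold Y; noncomm_ring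
    _ = _ := by
      rw [zh_z_self, mul_sub, mul_smul_comm, e1, e2, fn_sub, fn_smul, fn_smul, smul_smul]
      have h : q.c⁻¹ ^ 2 * q.c ^ (2 * ex a b.succ) = q.c ^ (2 * ex a b.succ - 2) := by
        rw [zpow_sub₀ q.c_ne, inv_pow, div_eq_mul_inv, mul_comm]; norm_cast
      rw [h]
      unfold Y
      simp only [sub_mul, smul_mul_assoc, mul_assoc]

/-- `z_b ẑ_d z_a ẑ_b` for distinct indices. -/
theorem Y_mul_Y' {a b d : Fin (n + 1)} (hda : d ≠ a) :
    Y q b d * Y q a b = q.c ^ (sg b a - sg d b - 1) •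
      (fn ((q.c ^ (2 * ex a b.castSucc)) • coord b.castSucc
      - (q.c ^ (2 * ex a b.succ)) • coord b.succ) * Y q a d) := by
  have e1 := qc_z_fn (q := q) (Eigen.coord b.castSucc) a
  have e2 := qc_z_fn (q := q) (Eigen.coord b.succ) a
  have e3 := qc_zh_z (q := q) hda
  have e4 := qc_z_z (q := q) b a
  have e5 := qc_zh_zh (q := q) d b
  unfold QC at e1 e2 e3 e4 e5
  calc Y q b d * Y q a b = z b * (zh d * z a) * zh b := by unfold Y; noncomm_ring
    _ = q.c ^ (-1 : ℤ) • ((z b * z a) * (zh d * zh b)) := by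
      rw [e3]; simp only [mul_smul_comm, smul_mul_assoc]; congr 1; noncomm_ring
    _ = q.c ^ (sg b a - sg d b - 1) • (z a * (z b * zh b) * zh d) := by
      rw [e4, e5, smul_mul_smul_comm, smul_smul, ← zpow_add₀ q.c_ne, ← zpow_add₀ q.c_ne]
      congr 1
      · congr 1; ring
      · noncomm_ring
    _ = _ := by
      rw [z_zh_self, mul_sub, e1, e2, fn_sub, fn_smul, fn_smul]
      unfold Y
      simp only [sub_mul, smul_mul_assoc, mul_assoc]

/-- The image `x_i⁻¹ z_{i-1} ẑ_i / (q² - 1)` of `E_i` under the moment map. -/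
noncomputable def JE (q : Par) {n : ℕ} (i : Fin n) : O q n :=
  (q.c ^ 2 - 1)⁻¹ • (fn (coord i.castSucc.succ)⁻¹ * (z i.castSucc * zh i.succ))
/-- The image `(x_{i-1} x_{i+1})^{-1/2} z_i ẑ_{i-1} / (q - q⁻¹)` of `F_i`. -/
noncomputable def JF (q : Par) {n : ℕ} (i : Fin n) : O q n :=
  (q.c - q.c⁻¹)⁻¹ • (fn (rt q i)⁻¹ * (z i.succ * zh i.castSucc))
/-- The image `x_i (x_{i-1} x_{i+1})^{-1/2}` of `K_i`. -/
noncomputable def JK (q : Par) {n : ℕ} (i : Fin n) : O q n :=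
  fn (coord i.castSucc.succ * (rt q i)⁻¹)
/-- The image of `K_i⁻¹`. -/
noncomputable def JKinv (q : Par) {n : ℕ} (i : Fin n) : O q n :=
  fn (rt q i * (coord i.castSucc.succ)⁻¹)

theorem serre_aux {B : Type*} [Ring B] [Algebra ℂ B] (q : Par) {a b x : B}
    (hx : a * b - q.c • (b * a) = x) (h : QC q.c⁻¹ a x) :
    a * a * b - (q.c + q.c⁻¹) • (a * b * a) + b * a * a = 0 := by
  have hq := q.c_ne
  unfold QC at h
  rw [← hx] at h
  simp only [mul_sub, sub_mul, mul_smul_comm, smul_mul_assoc, smul_sub, smul_smul,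
    inv_mul_cancel₀ hq, one_smul, ← mul_assoc] at h
  have h2 := sub_eq_zero.mpr h
  rw [← h2]
  module

theorem serre_aux' {B : Type*} [Ring B] [Algebra ℂ B] (q : Par) {a b x : B}
    (hx : a * b - q.c • (b * a) = x) (h : QC q.c⁻¹ x b) :
    b * b * a - (q.c + q.c⁻¹) • (b * a * b) + a * b * b = 0 := by
  have hq := q.c_ne
  unfold QC at h
  rw [← hx] at h
  simp only [mul_sub, sub_mul, mul_smul_comm, smul_mul_assoc, smul_sub, smul_smul,
    inv_mul_cancel₀ hq, one_smul, ← mul_assoc] at h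
  have h2 := sub_eq_zero.mpr h
  rw [← h2]
  module

theorem eigen_xinv (i : Fin n) :
    Eigen q (coord i.castSucc.succ)⁻¹ (fun k => -(2 * ex k i.castSucc.succ)) :=
  (Eigen.coord i.castSucc.succ).inv

theorem eigen_rinv (i : Fin n) : Eigen q (rt q i)⁻¹
    (fun k => -(ex k i.castSucc.castSucc + ex k i.succ.succ)) := (eigen_rt q i).inv

theorem adjE {i j : Fin n} (hij : i.1 + 1 = j.1) : JE q i * JE q j - q.c • (JE q j * JE q i)
    = (q.c ^ 2 - 1)⁻¹ • (fn (coord i.castSucc.succ)⁻¹ * Y q i.castSucc j.succ) := by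
  have hs : j.castSucc = i.succ := by ext; simp [hij]
  have hq := q.c_sq_ne
  have h1 : i.castSucc ≠ i.succ := by simp [Fin.ext_iff]
  have h2 : j.succ ≠ i.castSucc := by simp [Fin.ext_iff]; omega
  have h3 : i.succ ≠ j.succ := by simp [Fin.ext_iff]; omega
  unfold JE
  change ((_ : ℂ) • (_ * Y q _ _)) * ((_ : ℂ) • (_ * Y q _ _))
    - q.c • (((_ : ℂ) • (_ * Y q _ _)) * ((_ : ℂ) • (_ * Y q _ _))) = _
  rw [smul_mul_smul_comm, smul_mul_smul_comm, mul_fY (eigen_xinv j), mul_fY (eigen_xinv i), hs,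
    Y_mul_Y, Y_mul_Y' h2]
  have x1 : ex i.castSucc i.succ.succ = 1 := by simp only [ex, Fin.val_castSucc, Fin.val_succ]; split_ifs <;> omega
  have x2 : ex i.succ i.succ.succ = 1 := by simp only [ex, Fin.val_castSucc, Fin.val_succ]; split_ifs <;> omega
  have x3 : ex i.castSucc i.succ.castSucc = 1 := by simp only [ex, Fin.val_castSucc, Fin.val_succ]; split_ifs <;> omega
  have x4 : ex i.succ i.castSucc.succ = 0 := by simp only [ex, Fin.val_castSucc, Fin.val_succ]; split_ifs <;> omega
  have x5 : ex j.succ i.castSucc.succ = 0 := by simp only [ex, Fin.val_castSucc, Fin.val_succ]; split_ifs <;> omega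
  have x6 : ex i.castSucc j.castSucc.succ = 1 := by simp only [ex, Fin.val_castSucc, Fin.val_succ]; split_ifs <;> omega
  have x7 : ex i.succ j.castSucc.succ = 1 := by simp only [ex, Fin.val_castSucc, Fin.val_succ]; split_ifs <;> omega
  have s1 : sg i.succ i.castSucc = -1 := by simp only [sg, Fin.val_castSucc, Fin.val_succ]; split_ifs <;> omega
  have s2 : sg j.succ i.succ = -1 := by simp only [sg, Fin.val_castSucc, Fin.val_succ]; split_ifs <;> omega
  rw [x1, x3, x4, x5, s1, s2, x2]
  simp only [← mul_assoc, mul_smul_comm, ← fn_mul, smul_smul, ← smul_mul_assoc, ← fn_smul]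
  rw [← sub_mul, ← fn_sub]
  congr 2
  funext x
  have c1 := coord_ne i.castSucc.succ x
  have c2 := coord_ne i.succ.succ x
  have c3 : (i.succ.castSucc : Fin (n + 2)) = i.castSucc.succ := rfl
  have hq' := q.c_ne
  simp only [Pi.mul_apply, Pi.sub_apply, Pi.smul_apply, Pi.inv_apply, smul_eq_mul, c3]
  norm_num
  field_simp
  ring

theorem adjF {i j : Fin n} (hij : i.1 + 1 = j.1) : JF q i * JF q j - q.c • (JF q j * JF q i)
    = ((q.c - q.c⁻¹)⁻¹ * (q.c - q.c⁻¹)⁻¹ * (1 - q.c ^ 2)) •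
      (fn ((rt q i)⁻¹ * (rt q j)⁻¹ * coord i.castSucc.succ) * Y q j.succ i.castSucc) := by
  have hs : j.castSucc = i.succ := by ext; simp [hij]
  have h2 : i.castSucc ≠ j.succ := by simp [Fin.ext_iff]; omega
  unfold JF
  change ((_ : ℂ) • (_ * Y q _ _)) * ((_ : ℂ) • (_ * Y q _ _))
    - q.c • (((_ : ℂ) • (_ * Y q _ _)) * ((_ : ℂ) • (_ * Y q _ _))) = _
  rw [smul_mul_smul_comm, smul_mul_smul_comm, mul_fY (eigen_rinv j), mul_fY (eigen_rinv i), hs,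
    Y_mul_Y, Y_mul_Y' h2]
  have x1 : ex j.succ i.succ.succ = 0 := by
    simp only [ex, Fin.val_castSucc, Fin.val_succ]; split_ifs <;> omega
  have x2 : ex j.succ i.succ.castSucc = 0 := by
    simp only [ex, Fin.val_castSucc, Fin.val_succ]; split_ifs <;> omega
  have x3 : ex i.succ j.castSucc.castSucc - ex i.castSucc j.castSucc.castSucc = -1 := by
    simp only [ex, Fin.val_castSucc, Fin.val_succ]; split_ifs <;> omega
  have x4 : ex i.succ j.succ.succ - ex i.castSucc j.succ.succ = 0 := by
    simp only [ex, Fin.val_castSucc, Fin.val_succ]; split_ifs <;> omega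
  have x5 : ex j.succ i.castSucc.castSucc - ex i.succ i.castSucc.castSucc = 0 := by
    simp only [ex, Fin.val_castSucc, Fin.val_succ]; split_ifs <;> omega
  have x6 : ex j.succ i.succ.succ - ex i.succ i.succ.succ = -1 := by
    simp only [ex, Fin.val_castSucc, Fin.val_succ]; split_ifs <;> omega
  have s1 : sg i.succ j.succ = 1 := by
    simp only [sg, Fin.val_castSucc, Fin.val_succ]; split_ifs <;> omega
  have s2 : sg i.castSucc i.succ = 1 := by
    simp only [sg, Fin.val_castSucc, Fin.val_succ]; split_ifs <;> omega
  have t1 : -(ex i.succ j.castSucc.castSucc + ex i.succ j.succ.succ)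
      - -(ex i.castSucc j.castSucc.castSucc + ex i.castSucc j.succ.succ) = 1 := by linarith
  have t2 : -(ex j.succ i.castSucc.castSucc + ex j.succ i.succ.succ)
      - -(ex i.succ i.castSucc.castSucc + ex i.succ i.succ.succ) = 1 := by linarith
  rw [hs] at t1
  rw [t1, t2, x1, x2, s1, s2]
  simp only [← mul_assoc, mul_smul_comm, ← fn_mul, smul_smul, ← smul_mul_assoc, ← fn_smul]
  rw [← sub_mul, ← fn_sub]
  congr 2
  funext x
  have c3 : (i.succ.castSucc : Fin (n + 2)) = i.castSucc.succ := rfl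
  have hq' := q.c_ne
  simp only [Pi.mul_apply, Pi.sub_apply, Pi.smul_apply, Pi.inv_apply, smul_eq_mul, c3]
  norm_num
  have hz : (q.c : ℂ) ^ (-2 : ℤ) = (q.c ^ 2)⁻¹ := by rw [zpow_neg]; norm_cast
  try rw [hz]
  field_simp
  ring

theorem ex_succ (a : Fin n) (j : Fin (n + 2)) :
    ex a.succ j = ex a.castSucc j - if j.1 = a.1 + 1 then 1 else 0 := by
  simp only [ex, Fin.val_castSucc, Fin.val_succ]
  split_ifs <;> omega

theorem JE_serre {i j : Fin n} (hij : i.1 + 1 = j.1) :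
    (JE q i * JE q i * JE q j - (q.c + q.c⁻¹) • (JE q i * JE q j * JE q i)
      + JE q j * JE q i * JE q i = 0) ∧
    (JE q j * JE q j * JE q i - (q.c + q.c⁻¹) • (JE q j * JE q i * JE q j)
      + JE q i * JE q j * JE q j = 0) := by
  have hs : j.castSucc = i.succ := by ext; simp [hij]
  refine ⟨serre_aux q (adjE hij) (QC.smul_right ?_ _), serre_aux' q (adjE hij) (QC.smul_left ?_ _)⟩
  · refine (QC.smul_left (qc_fY (eigen_xinv i) (eigen_xinv i) (a := i.castSucc) (b := i.succ)
      (by simp [Fin.ext_iff]; omega) (by simp [Fin.ext_iff])) _).cast ?_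
    rw [← zpow_neg_one]
    congr 1
    simp only [hs, ex_succ, sg, Fin.val_castSucc, Fin.val_succ]
    split_ifs <;> omega
  · refine (QC.smul_right (qc_fY (eigen_xinv i) (eigen_xinv j) (c := j.castSucc) (d := j.succ)
      (by simp [Fin.ext_iff]; omega) (by simp [Fin.ext_iff])) _).cast ?_
    rw [← zpow_neg_one]
    congr 1
    simp only [hs, ex_succ, sg, Fin.val_castSucc, Fin.val_succ]
    split_ifs <;> omega

theorem JF_serre {i j : Fin n} (hij : i.1 + 1 = j.1) :
    (JF q i * JF q i * JF q j - (q.c + q.c⁻¹) • (JF q i * JF q j * JF q i)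
      + JF q j * JF q i * JF q i = 0) ∧
    (JF q j * JF q j * JF q i - (q.c + q.c⁻¹) • (JF q j * JF q i * JF q j)
      + JF q i * JF q j * JF q j = 0) := by
  have hX := (((eigen_rinv (q := q) i).mul (eigen_rinv j)).mul (Eigen.coord i.castSucc.succ))
  have hs : j.castSucc = i.succ := by ext; simp [hij]
  refine ⟨serre_aux q (adjF hij) (QC.smul_right ?_ _), serre_aux' q (adjF hij) (QC.smul_left ?_ _)⟩
  · refine (QC.smul_left (qc_fY (eigen_rinv i) hX (a := i.succ) (b := i.castSucc)
      (by simp [Fin.ext_iff]) (by simp [Fin.ext_iff]; omega)) _).cast ?_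
    rw [← zpow_neg_one]
    congr 1
    simp only [hs, ex_succ, sg, Fin.val_castSucc, Fin.val_succ, ← hij]
    norm_num
    split_ifs <;> omega
  · refine (QC.smul_right (qc_fY hX (eigen_rinv j) (c := j.succ) (d := j.castSucc)
      (by simp [Fin.ext_iff]) (by simp [Fin.ext_iff]; omega)) _).cast ?_
    rw [← zpow_neg_one]
    congr 1
    simp only [hs, ex_succ, sg, Fin.val_castSucc, Fin.val_succ, ← hij]
    norm_num
    split_ifs <;> omega

theorem eigen_JK (i : Fin n) : Eigen q (coord i.castSucc.succ * (rt q i)⁻¹) (fun k =>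
    2 * ex k i.castSucc.succ + -(ex k i.castSucc.castSucc + ex k i.succ.succ)) :=
  (Eigen.coord _).mul (eigen_rinv i)

theorem JE_JF (i : Fin n) : JE q i * JF q i - JF q i * JE q i
    = (q.c⁻¹ - q.c)⁻¹ • (JK q i - JKinv q i) := by
  have h2 : i.succ ≠ i.castSucc := by simp [Fin.ext_iff]
  unfold JE JF JK JKinv
  change ((_ : ℂ) • (_ * Y q _ _)) * ((_ : ℂ) • (_ * Y q _ _))
    - (((_ : ℂ) • (_ * Y q _ _)) * ((_ : ℂ) • (_ * Y q _ _))) = _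
  have hY : ∀ a : Fin (n + 1), Y q a a = fn (coord a.castSucc - coord a.succ) := fun a => by
    rw [fn_sub]; exact z_zh_self a
  rw [smul_mul_smul_comm, smul_mul_smul_comm, mul_fY (eigen_xinv i), mul_fY (eigen_rinv i),
    Y_mul_Y, Y_mul_Y, hY, hY]
  have x1 : ex i.succ i.castSucc.castSucc = 0 := by
    simp only [ex, Fin.val_castSucc, Fin.val_succ]; split_ifs <;> omega
  have x2 : ex i.succ i.castSucc.succ = 0 := by
    simp only [ex, Fin.val_castSucc, Fin.val_succ]; split_ifs <;> omega
  have x3 : ex i.castSucc i.castSucc.succ = 1 := by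
    simp only [ex, Fin.val_castSucc, Fin.val_succ]; split_ifs <;> omega
  have x4 : ex i.castSucc i.succ.succ = 1 := by
    simp only [ex, Fin.val_castSucc, Fin.val_succ]; split_ifs <;> omega
  have x5 : ex i.succ i.succ.succ = 1 := by
    simp only [ex, Fin.val_castSucc, Fin.val_succ]; split_ifs <;> omega
  have x6 : ex i.castSucc i.castSucc.castSucc = 0 := by
    simp only [ex, Fin.val_castSucc, Fin.val_succ]; split_ifs <;> omega
  have x7 : ex i.castSucc i.succ.castSucc = 1 := by
    simp only [ex, Fin.val_castSucc, Fin.val_succ]; split_ifs <;> omega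
  rw [x1, x2, x3, x4, x5, x6, x7, smul_sub]
  simp only [mul_smul_comm, ← fn_mul, smul_smul, ← fn_smul]
  rw [← fn_sub, ← fn_sub]
  congr 1
  funext x
  have c1 := coord_ne i.castSucc.succ x
  have c2 := rt_ne q i x
  have c3 : (i.succ.castSucc : Fin (n + 2)) = i.castSucc.succ := rfl
  have c4 := congrFun (rt_mul_self q i) x
  have hq' := q.c_ne
  have hq2 := q.c_sq_ne
  have hq3 : q.c - q.c⁻¹ ≠ 0 := by
    intro h; apply hq2; field_simp at h; simpa using h
  have hq4 : q.c⁻¹ - q.c ≠ 0 := by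
    intro h; apply hq3; linear_combination -h
  have hq5 : 1 - q.c ^ 2 ≠ 0 := fun h => hq2 (by linear_combination -h)
  simp only [Pi.mul_apply, Pi.sub_apply, Pi.smul_apply, Pi.inv_apply, smul_eq_mul, c3] at c4 ⊢
  norm_num
  have hz : (q.c : ℂ) ^ (-2 : ℤ) = (q.c ^ 2)⁻¹ := by rw [zpow_neg]; norm_cast
  try rw [hz]
  field_simp
  linear_combination (q.c ^ 2 - 1) ^ 2 * c4

theorem satJ : U.Sat q (JE q (n := n)) (JF q) (JK q) (JKinv q) where
  k_l i := by
    unfold JK JKinv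
    rw [← fn_mul, ← fn_one]
    congr 1
    funext x
    have c1 := coord_ne i.castSucc.succ x
    have c2 := rt_ne q i x
    simp only [Pi.mul_apply, Pi.inv_apply, Pi.one_apply]
    field_simp
  l_k i := by
    unfold JK JKinv
    rw [← fn_mul, ← fn_one]
    congr 1
    funext x
    have c1 := coord_ne i.castSucc.succ x
    have c2 := rt_ne q i x
    simp only [Pi.mul_apply, Pi.inv_apply, Pi.one_apply]
    field_simp
  k_k i j := by
    unfold JK
    rw [← fn_mul, ← fn_mul, mul_comm]
  k_e i j := by
    refine (QC.smul_right ((qc_fn _ _).mul_right (qc_fn_Y (eigen_JK i) _ _)) _).cast ?_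
    rw [one_mul]
    congr 1
    simp only [ex_succ, cartan, Fin.ext_iff, Fin.val_castSucc, Fin.val_succ]
    split_ifs <;> omega
  k_f i j := by
    refine (QC.smul_right ((qc_fn _ _).mul_right (qc_fn_Y (eigen_JK i) _ _)) _).cast ?_
    rw [one_mul]
    congr 1
    simp only [ex_succ, cartan, Fin.ext_iff, Fin.val_castSucc, Fin.val_succ]
    split_ifs <;> omega
  e_f i := JE_JF i
  e_f_ne i j hij := by
    have hij' : i.1 ≠ j.1 := fun h => hij (Fin.ext h)
    have := (QC.smul_left (QC.smul_right (qc_fY (eigen_xinv (q := q) i) (eigen_rinv j)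
      (a := i.castSucc) (b := i.succ) (c := j.succ) (d := j.castSucc)
      (by simpa [Fin.ext_iff] using hij') (by simpa [Fin.ext_iff] using hij'))
      (q.c - q.c⁻¹)⁻¹) (q.c ^ 2 - 1)⁻¹).cast (s := 1) (by
        rw [← zpow_zero q.c]
        congr 1
        simp only [ex_succ, sg, Fin.val_castSucc, Fin.val_succ]
        split_ifs <;> omega)
    unfold QC at this
    rw [one_smul] at this
    exact this
  e_e i j hij := by
    by_cases hij' : i = j
    · rw [hij']
    have h2 : ¬ (i.1 + 1 = j.1 ∨ j.1 + 1 = i.1) := fun h => by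
      simp [cartan, hij', h] at hij
    rw [Fin.ext_iff] at hij'
    have := (QC.smul_left (QC.smul_right (qc_fY (eigen_xinv (q := q) i) (eigen_xinv j)
      (a := i.castSucc) (b := i.succ) (c := j.castSucc) (d := j.succ)
      (by simp [Fin.ext_iff]; omega) (by simp [Fin.ext_iff]; omega))
      (q.c ^ 2 - 1)⁻¹) (q.c ^ 2 - 1)⁻¹).cast (s := 1) (by
        rw [← zpow_zero q.c]
        congr 1
        simp only [ex_succ, sg, Fin.val_castSucc, Fin.val_succ]
        split_ifs <;> omega)
    unfold QC at this
    rw [one_smul] at this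
    exact this
  f_f i j hij := by
    by_cases hij' : i = j
    · rw [hij']
    have h2 : ¬ (i.1 + 1 = j.1 ∨ j.1 + 1 = i.1) := fun h => by
      simp [cartan, hij', h] at hij
    rw [Fin.ext_iff] at hij'
    have := (QC.smul_left (QC.smul_right (qc_fY (eigen_rinv (q := q) i) (eigen_rinv j)
      (a := i.succ) (b := i.castSucc) (c := j.succ) (d := j.castSucc)
      (by simp [Fin.ext_iff]; omega) (by simp [Fin.ext_iff]; omega))
      (q.c - q.c⁻¹)⁻¹) (q.c - q.c⁻¹)⁻¹).cast (s := 1) (by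
        rw [← zpow_zero q.c]
        congr 1
        simp only [ex_succ, sg, Fin.val_castSucc, Fin.val_succ]
        split_ifs <;> omega)
    unfold QC at this
    rw [one_smul] at this
    exact this
  serre_e i j hij := by
    have h2 : i.1 + 1 = j.1 ∨ j.1 + 1 = i.1 := by
      by_contra h
      unfold cartan at hij
      rw [if_neg h] at hij
      split_ifs at hij <;> omega
    rcases h2 with h | h
    · exact (JE_serre h).1
    · exact (JE_serre h).2
  serre_f i j hij := by
    have h2 : i.1 + 1 = j.1 ∨ j.1 + 1 = i.1 := by
      by_contra h
      unfold cartan at hij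
      rw [if_neg h] at hij
      split_ifs at hij <;> omega
    rcases h2 with h | h
    · exact (JF_serre h).1
    · exact (JF_serre h).2

theorem J_mem (a : U q n) : U.lift (satJ (q := q) (n := n)) a ∈ FuncX q n := by
  obtain ⟨a, rfl⟩ := RingQuot.mkAlgHom_surjective ℂ (URel q n) a
  induction a using FreeAlgebra.induction with
  | grade0 t => rw [AlgHom.commutes, AlgHom.commutes]; exact Subalgebra.algebraMap_mem _ t
  | grade1 g =>
    have h := U.lift_gen (satJ (q := q) (n := n)) g
    unfold U.gen at h
    rw [h]
    cases g with
    | E i => exact Subalgebra.smul_mem _ (mul_mem (fn_mem _) (z_zh_mem _ _)) _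
    | F i => exact Subalgebra.smul_mem _ (mul_mem (fn_mem _) (z_zh_mem _ _)) _
    | K i => exact fn_mem _
    | Kinv i => exact fn_mem _
  | mul a b ha hb => rw [map_mul, map_mul]; exact mul_mem ha hb
  | add a b ha hb => rw [map_add, map_add]; exact add_mem ha hb

end O

/-- The type of elements of `Func(X)_q`, with its structure of an algebra. -/
def FX (q : Par) (n : ℕ) : Type := FuncX q n

noncomputable instance (q : Par) (n : ℕ) : Ring (FX q n) := inferInstanceAs (Ring (FuncX q n))
noncomputable instance (q : Par) (n : ℕ) : Algebra ℂ (FX q n) :=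
  inferInstanceAs (Algebra ℂ (FuncX q n))

/-- The quantum moment map `J : U_q sl(n+1) → Func(X)_q`. -/
noncomputable def J (q : Par) (n : ℕ) : U q n →ₐ[ℂ] FX q n :=
  (U.lift (O.satJ (q := q) (n := n))).codRestrict (FuncX q n) O.J_mem

/-! ### The modules -/

/-- The function `f(x)` as an element of `Func(X)_q`. -/
noncomputable def fnX (q : Par) {n : ℕ} (f : Dom n → ℂ) : FX q n := (⟨O.fn f, fn_mem f⟩ : FuncX q n)

/-- The left ideal `A · ker χ` of `A = Func(X)_q`, where `χ : f ↦ f(p)` is the character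
of the commutative subalgebra `Func(X)_q^inv` of the functions `f(x)` given by the point `p`. -/
noncomputable def indIdeal (q : Par) {n : ℕ} (p : Dom n) : Submodule (FX q n) (FX q n) :=
  Submodule.span (FX q n)
    (Set.range fun f : Dom n → ℂ => fnX q f - algebraMap ℂ (FX q n) (f p))

/-- The induced module `W = A ⊗_{A^inv} ℂ_χ = A / A · ker χ`. -/
abbrev W (q : Par) {n : ℕ} (p : Dom n) : Type := FX q n ⧸ indIdeal q p

/-- The generator `1_χ` of `W`. -/
noncomputable def cyc (q : Par) {n : ℕ} (p : Dom n) : W q p := Submodule.Quotient.mk (1 : FX q n)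

/-- The sum of all submodules of `W` that do not contain `1_χ`. -/
noncomputable def radW (q : Par) {n : ℕ} (p : Dom n) : Submodule (FX q n) (W q p) :=
  sSup {N | cyc q p ∉ N}

/-- The truncated module: the quotient of `W` by all its submodules that do not contain `1_χ`. -/
abbrev Wtr (q : Par) {n : ℕ} (p : Dom n) : Type := W q p ⧸ radW q p

section Modules
variable (q : Par) {n : ℕ} (M : Type) [AddCommGroup M] [Module ℂ M] [Module (FX q n) M]
  [IsScalarTower ℂ (FX q n) M]

/-- The set of the joint eigenvalues of `x_0, …, x_{n+1}` in a module. -/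
def spec : Set (Fin (n + 2) → ℝ) :=
  {l | ∃ v : M, v ≠ 0 ∧ ∀ j, fnX q (coord j) • v = (l j : ℂ) • v}

/-- The representation `π ∘ J ∘ I` of `U_q sl(n+1)` in a module with action `π`. -/
noncomputable def rep (I : U q n ≃ₐ[ℂ] U q n) : U q n →ₐ[ℂ] Module.End ℂ M :=
  (Algebra.lsmul ℂ ℂ M).comp ((J q n).comp (I : U q n →ₐ[ℂ] U q n))

end Modules

/-! ### Irreducible `*`-representations -/

/-- The closure in `H × H` of the graph of an operator `T` given on a subspace `M` of `H`. -/
def closedGraph {M H : Type} [AddCommGroup M] [Module ℂ M] [NormedAddCommGroup H]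
    [InnerProductSpace ℂ H] (j : M →ₗ[ℂ] H) (T : Module.End ℂ M) : Submodule ℂ (H × H) :=
  (LinearMap.range (j.prod (j ∘ₗ T))).topologicalClosure

/-- The action `ρ` of an algebra with involution `st` in `M` defines an irreducible
`*`-representation: there is a Hilbert space `H`, the completion of `M` for some positive definite
scalar product with `(a v, w) = (v, a* w)`, such that every `ρ a` extends to a closed operator in
`H` (its closure), and no closed subspace of `H` other than `0` and `H` reduces all
these closed operators. -/
def IsIrredStarRep {B M : Type} [Ring B] [Algebra ℂ B] [AddCommGroup M] [Module ℂ M]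
    (st : B → B) (ρ : B →ₐ[ℂ] Module.End ℂ M) : Prop :=
  ∃ (H : Type) (_ : NormedAddCommGroup H) (_ : InnerProductSpace ℂ H) (_ : CompleteSpace H)
    (j : M →ₗ[ℂ] H), Nontrivial H ∧ Function.Injective j ∧ DenseRange j ∧
    (∀ a v w, inner ℂ (j (ρ a v)) (j w) = inner ℂ (j v) (j (ρ (st a) w))) ∧
    (∀ a y, (0, y) ∈ closedGraph j (ρ a) → y = 0) ∧
    ∀ (K : Submodule ℂ H) [K.HasOrthogonalProjection],
      (∀ a, ∀ y ∈ closedGraph j (ρ a),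
        (K.starProjection y.1, K.starProjection y.2) ∈ closedGraph j (ρ a)) → K = ⊥ ∨ K = ⊤

/-! ### The positivity conditions -/

section Conditions
variable (q : Par) {n : ℕ} (ι : Fin (n + 1) → ℤˣ) (l : Fin (n + 2) → ℝ) (i : Fin n)

/-- `ι_{i-1} ι_i (λ_{i-1} - λ_i) / (λ_i - q⁻² λ_{i+1}) > 0`. -/
def Cond1 : Prop :=
  0 < (U.sgn ι i : ℝ) * ((l i.castSucc.castSucc - l i.castSucc.succ) /
    (l i.castSucc.succ - (q.1 ^ 2)⁻¹ * l i.succ.succ))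

/-- `ι_{i-1} ι_i (q² λ_{i-1} - λ_i) / (λ_i - λ_{i+1}) > 0`. -/
def Cond2 : Prop :=
  0 < (U.sgn ι i : ℝ) * ((q.1 ^ 2 * l i.castSucc.castSucc - l i.castSucc.succ) /
    (l i.castSucc.succ - l i.succ.succ))

/-- The point obtained from `λ` by replacing `λ_i` by `t λ_i`. -/
def scaleAt (t : ℝ) : Fin (n + 2) → ℝ :=
  Function.update l i.castSucc.succ (t * l i.castSucc.succ)

end Conditions

end QOrbit

/-! The weights of W form a lattice, and unitarity is decided by one real number for each edge of
this lattice. The extended algebra acts on the finitely supported functions on ℤ^(n+1) by weighted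
shifts (`latticeRep`): z_i raises and ẑ_i lowers the i-th exponent, and a function acts by its value
at `orbitPt`. Ordered monomials f(x) z^k span the algebra, and invariance under all κ_α means that
the total exponent is 0 (`O.mem_degreeSpan_zero`). So W embeds in the lattice representation, with
one basis vector for every k of sum 0 (`exists_latticeBasis`, `toLattice_injective`). On this basis
E_i leads from k to k + `root i` and q K_i⁻¹ F_i leads back. The product of the two coefficients is
a positive square times a product of two gaps (`raiseCoef_mul_lowerCoef`). Up to the sign ι_{i-1}
ι_i, the element E_i^♮ is q K_i⁻¹ F_i, so the condition to expect is `IsPositive`: on every edge the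
sign times the product of gaps is positive. For the edge from k to k + `root i` this is (b) at k and
also (a) at k + `root i` (`cond2_iff`, `cond1_iff`).

Sufficiency (`IsWeightBasis.isIrredStarRep`): declare the weight vectors orthogonal with squared
norms that are products of one-variable factors (`exists_normSq`). These match the moduli of the
coefficients of E_i and of its adjoint; positivity matches the signs. For irreducibility, the
eigenvalues of the K_i separate the weights (`exists_cartanWeight_ne`), so a reducing projection
multiplies the vector of weight 0 by a scalar. This vector generates the module over U_q sl(n+1),
and so the projection is 0 or 1 (`eq_bot_or_eq_top_of_reduces`).

Necessity: the norm of E_i v_k gives positivity on every edge where E_i v_k does not vanish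
(`IsWeightBasis.pos_of_raiseCoef_ne_zero`). In the truncated module no coefficient vanishes at a
surviving weight, since a vanishing coefficient bounds a half-space that spans a submodule without
1_χ (`down_ne_zero_of_mem`, `up_ne_zero_of_mem`). For W itself, a submodule without 1_χ would be
orthogonal to everything, so W equals its truncation as soon as it is a `*`-representation
(`radW_eq_bot`).

Generation over U_q sl(n+1), rather than over all of Func(X)_q, needs an argument: only neighbouring
products z_{i-1} ẑ_i and z_i ẑ_{i-1} are available, and some of their coefficients may vanish. A gap
vanishes for at most one exponent, so a longer move can always be composed in one of two orders
(`StableMove.trans`). -/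

namespace QOrbit

/-! ### The lattice of weights -/

/-- The exponents of the monomials in `z_k`, `ẑ_k`. -/
abbrev Idx (n : ℕ) : Type := Fin (n + 1) → ℤ

/-- The partial sum `∑_{i < j} k_i`. -/
def partialSum {n : ℕ} (j : ℕ) (k : Idx n) : ℤ := ∑ i : Fin (n + 1), if i.1 < j then k i else 0

section partialSum
variable {n : ℕ}

theorem partialSum_add (j : ℕ) (k l : Idx n) :
    partialSum j (k + l) = partialSum j k + partialSum j l := by
  simp only [partialSum, ← Finset.sum_add_distrib, Pi.add_apply]
  exact Finset.sum_congr rfl fun i _ => by split_ifs <;> simp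

theorem partialSum_single (j : ℕ) (i : Fin (n + 1)) (r : ℤ) :
    partialSum j (Pi.single i r : Idx n) = if i.1 < j then r else 0 := by
  unfold partialSum
  rw [Finset.sum_eq_single i]
  · simp
  · intro b _ hb
    simp [Pi.single_eq_of_ne hb]
  · simp

theorem partialSum_sub (j : ℕ) (k l : Idx n) :
    partialSum j (k - l) = partialSum j k - partialSum j l := by
  have := partialSum_add j (k - l) l
  rw [sub_add_cancel] at this
  omega

theorem partialSum_zero (j : ℕ) : partialSum j (0 : Idx n) = 0 := by simp [partialSum]

theorem partialSum_last (k : Idx n) : partialSum (n + 1) k = ∑ i, k i := by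
  simp only [partialSum]
  exact Finset.sum_congr rfl fun i _ => if_pos i.2

theorem partialSum_succ (i : Fin (n + 1)) (k : Idx n) :
    partialSum (i.1 + 1) k = partialSum i.1 k + k i := by
  have h : k i = ∑ j : Fin (n + 1), if j = i then k j else 0 := by simp
  rw [h]
  simp only [partialSum, ← Finset.sum_add_distrib]
  refine Finset.sum_congr rfl fun j _ => ?_
  by_cases hj : j = i
  · simp [hj]
  · have : j.1 ≠ i.1 := fun e => hj (Fin.ext e)
    rcases lt_or_gt_of_ne this with h | h
    · simp [hj, h, Nat.lt_succ_of_lt h]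
    · simp [hj, not_lt.mpr h.le, Nat.not_lt.mpr h]

end partialSum

/-- The point of the lattice through `p` with exponents `k`. -/
noncomputable def orbitPt (q : Par) {n : ℕ} (p : Dom n) (k : Idx n) : Dom n :=
  ⟨fun j => (q.1 ^ 2) ^ (-partialSum j.1 k) * p.1 j, by
    have hq := q.sq_pos
    refine ⟨fun j => mul_ne_zero (zpow_pos hq _).ne' (p.2.1 j), fun i => ?_⟩
    rw [mul_mul_mul_comm]
    exact mul_pos (mul_pos (zpow_pos hq _) (zpow_pos hq _)) (p.2.2 i)⟩

section lattice
variable {q : Par} {n : ℕ} (p : Dom n)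

theorem orbitPt_zero : orbitPt q p 0 = p := by
  apply Subtype.ext
  funext j
  simp [orbitPt, partialSum_zero]

theorem Par.zpow_sq_injective (q : Par) : Function.Injective fun m : ℤ => (q.1 ^ 2) ^ m :=
  zpow_right_injective₀ q.sq_pos q.sq_lt_one.ne

/-- The coordinates of p are nonzero and q² is not a root of unity, so the point determines all
partial sums. This is what lets the indicator function of a point isolate a single weight later on.
-/
theorem orbitPt_injective : Function.Injective (orbitPt q p) := by
  intro k l h
  have key : ∀ j : Fin (n + 2), partialSum j.1 k = partialSum j.1 l := fun j => by
    have h1 : (orbitPt q p k).1 j = (orbitPt q p l).1 j := by rw [h]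
    have h2 := q.zpow_sq_injective (mul_right_cancel₀ (p.2.1 j) h1)
    omega
  funext i
  have h1 := partialSum_succ i k
  have h2 := partialSum_succ i l
  have h3 := key i.castSucc
  have h4 := key i.succ
  simp only [Fin.val_castSucc, Fin.val_succ] at h3 h4
  omega

/-- Moving a function to the left past z_i shifts its argument by q², so z_i must lead to the point
whose shift is the old one. This dictates the minus sign in the exponents of `orbitPt`. -/
theorem shift_orbitPt_add (i : Fin (n + 1)) (k : Idx n) :
    shift (q.1 ^ 2) q.sq_pos i (orbitPt q p (k + Pi.single i 1)) = orbitPt q p k := by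
  apply Subtype.ext
  funext j
  have hq := q.sq_pos.ne'
  simp only [shift, orbitPt, partialSum_add, partialSum_single]
  split_ifs
  · rw [neg_add, zpow_add₀ hq, zpow_neg_one, mul_comm _ (_ ^ 2)⁻¹, mul_assoc,
      mul_inv_cancel_left₀ hq]
  · simp

theorem shift_orbitPt_sub (i : Fin (n + 1)) (k : Idx n) :
    shift (q.1 ^ 2)⁻¹ (inv_pos.mpr q.sq_pos) i (orbitPt q p (k - Pi.single i 1)) =
      orbitPt q p k := by
  apply Subtype.ext
  funext j
  have hq := q.sq_pos.ne'
  simp only [shift, orbitPt, partialSum_sub, partialSum_single]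
  split_ifs
  · rw [neg_sub, sub_eq_add_neg, zpow_add₀ hq, zpow_one, mul_assoc, inv_mul_cancel_left₀ hq]
  · simp

end lattice

/-! ### The lattice representation of the extended algebra -/

/-- The quantity `p_i - q^{-2r} p_{i+1}`, which is up to a power of `q` the value of `z_i ẑ_i` at
exponent `r`. -/
noncomputable def gap (q : Par) {n : ℕ} (p : Dom n) (i : Fin (n + 1)) (r : ℤ) : ℝ :=
  p.1 i.castSucc - (q.1 ^ 2) ^ (-r) * p.1 i.succ

/-- The coefficient of `z_i`. -/
noncomputable def up (q : Par) {n : ℕ} (p : Dom n) (i : Fin (n + 1)) (r : ℤ) : ℝ :=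
  if 0 ≤ r then 1 else gap q p i (r + 1)

/-- The coefficient of `ẑ_i`. -/
noncomputable def down (q : Par) {n : ℕ} (p : Dom n) (i : Fin (n + 1)) (r : ℤ) : ℝ :=
  if r ≤ 0 then 1 else gap q p i r

section coefficients
variable {q : Par} {n : ℕ} (p : Dom n) (i : Fin (n + 1))

/-- The gap is carried entirely by the operator that moves the exponent towards 0; the one that
moves it away from 0 has factor 1. Hence monomials lead from the basis vector at 0 to every other
one, even where a gap vanishes. -/
theorem up_mul_down (r : ℤ) : up q p i (r - 1) * down q p i r = gap q p i r := by
  unfold up down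
  by_cases h : r ≤ 0
  · rw [if_neg (by omega), if_pos h, sub_add_cancel, mul_one]
  · rw [if_pos (by omega), if_neg h, one_mul]

theorem up_mul_down' (r : ℤ) : up q p i r * down q p i (r + 1) = gap q p i (r + 1) := by
  have := up_mul_down (q := q) p i (r + 1)
  rwa [add_sub_cancel_right] at this

theorem up_ne_zero {r : ℤ} (h : 0 ≤ r) : up q p i r ≠ 0 := by simp [up, h]

theorem down_ne_zero {r : ℤ} (h : r ≤ 0) : down q p i r ≠ 0 := by simp [down, h]

/-- The gap is an injective function of r because p_{i+1} ≠ 0, so it has at most one zero. -/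
theorem gap_ne_zero_or (r : ℤ) : gap q p i r ≠ 0 ∨ gap q p i (r + 1) ≠ 0 := by
  by_contra! h
  unfold gap at h
  have h1 : (q.1 ^ 2) ^ (-r) * p.1 i.succ = (q.1 ^ 2) ^ (-(r + 1)) * p.1 i.succ := by
    linarith [h.1, h.2]
  have h2 := q.zpow_sq_injective (mul_right_cancel₀ (p.2.1 i.succ) h1)
  omega

/-- The prefactor is a power of q², so the sign depends on the single exponent k_i. -/
theorem orbitPt_sub_succ (k : Idx n) :
    (orbitPt q p k).1 i.castSucc - (orbitPt q p k).1 i.succ =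
      (q.1 ^ 2) ^ (-partialSum i.1 k) * gap q p i (k i) := by
  simp only [orbitPt, gap, Fin.val_castSucc, Fin.val_succ, partialSum_succ, neg_add,
    zpow_add₀ q.sq_pos.ne']
  ring

theorem orbitPt_sub_inv_succ (k : Idx n) :
    (orbitPt q p k).1 i.castSucc - (q.1 ^ 2)⁻¹ * (orbitPt q p k).1 i.succ =
      (q.1 ^ 2) ^ (-partialSum i.1 k) * gap q p i (k i + 1) := by
  simp only [orbitPt, gap, Fin.val_castSucc, Fin.val_succ, partialSum_succ, neg_add,
    zpow_add₀ q.sq_pos.ne', zpow_neg_one]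
  ring

end coefficients

/-- The operator on finitely supported functions on the lattice that moves `k` to `k + v` with
coefficient `c k`. -/
noncomputable def moveOp {n : ℕ} (v : Idx n) (c : Idx n → ℂ) : Module.End ℂ (Idx n →₀ ℂ) :=
  Finsupp.linearCombination ℂ fun k => Finsupp.single (k + v) (c k)

theorem moveOp_single {n : ℕ} (v : Idx n) (c : Idx n → ℂ) (k : Idx n) (t : ℂ) :
    moveOp v c (Finsupp.single k t) = Finsupp.single (k + v) (t * c k) := by
  simp [moveOp]

/-- Weighted shifts compose to weighted shifts, which reduces each defining relation of the algebra
to a scalar identity between coefficients. -/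
theorem moveOp_mul {n : ℕ} (v w : Idx n) (c d : Idx n → ℂ) :
    moveOp v c * moveOp w d = moveOp (v + w) (fun k => c (k + w) * d k) := by
  refine Finsupp.lhom_ext fun k t => ?_
  rw [Module.End.mul_apply, moveOp_single, moveOp_single, moveOp_single, mul_assoc,
    mul_comm (d k), add_comm v w, add_assoc]

theorem smul_moveOp {n : ℕ} (v : Idx n) (c : Idx n → ℂ) (t : ℂ) :
    t • moveOp v c = moveOp v (fun k => t * c k) := by
  refine Finsupp.lhom_ext fun k s => ?_
  rw [LinearMap.smul_apply, moveOp_single, moveOp_single, Finsupp.smul_single, smul_eq_mul]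
  congr 1
  ring

theorem moveOp_add {n : ℕ} (v : Idx n) (c d : Idx n → ℂ) :
    moveOp v c + moveOp v d = moveOp v (fun k => c k + d k) := by
  refine Finsupp.lhom_ext fun k s => ?_
  rw [LinearMap.add_apply, moveOp_single, moveOp_single, moveOp_single, ← Finsupp.single_add,
    mul_add]

theorem moveOp_sub {n : ℕ} (v : Idx n) (c d : Idx n → ℂ) :
    moveOp v c - moveOp v d = moveOp v (fun k => c k - d k) := by
  refine Finsupp.lhom_ext fun k s => ?_
  rw [LinearMap.sub_apply, moveOp_single, moveOp_single, moveOp_single, ← Finsupp.single_sub,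
    mul_sub]

section rep
variable (q : Par) {n : ℕ} (p : Dom n)

/-- The coefficient of `z_i` at `k`. -/
noncomputable def upCoef (i : Fin (n + 1)) (k : Idx n) : ℝ :=
  q.1 ^ (-partialSum i.1 k) * up q p i (k i)

/-- The coefficient of `ẑ_i` at `k`. -/
noncomputable def downCoef (i : Fin (n + 1)) (k : Idx n) : ℝ :=
  q.1 ^ (-partialSum i.1 k) * down q p i (k i)

/-- The operators by which the generators act. -/
noncomputable def latticeVal : OGen n → Module.End ℂ (Idx n →₀ ℂ)
  | .z i => moveOp (Pi.single i 1) fun k => (upCoef q p i k : ℂ)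
  | .zh i => moveOp (-Pi.single i 1) fun k => (downCoef q p i k : ℂ)
  | .fn f => moveOp 0 fun k => f (orbitPt q p k)

/-- The powers of q in the coefficients exist for this purpose: raising the exponent i changes the
partial sum at j only if i < j, which leaves exactly one factor q. -/
theorem upCoef_comm {i j : Fin (n + 1)} (h : i < j) (k : Idx n) :
    upCoef q p i (k + Pi.single j 1) * upCoef q p j k =
      q.1 * (upCoef q p j (k + Pi.single i 1) * upCoef q p i k) := by
  have hq := q.ne_zero
  have h' : i.1 < j.1 := h
  simp only [upCoef, partialSum_add, partialSum_single, Pi.add_apply, Pi.single_eq_of_ne h.ne,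
    Pi.single_eq_of_ne h.ne', if_pos h', if_neg (not_lt.mpr h'.le), add_zero, neg_add,
    zpow_add₀ hq, zpow_neg_one]
  field_simp

theorem downCoef_comm {i j : Fin (n + 1)} (h : i < j) (k : Idx n) :
    downCoef q p i (k + -Pi.single j 1) * downCoef q p j k =
      q.1⁻¹ * (downCoef q p j (k + -Pi.single i 1) * downCoef q p i k) := by
  have hq := q.ne_zero
  have h' : i.1 < j.1 := h
  simp only [downCoef, ← sub_eq_add_neg, partialSum_sub, partialSum_single, Pi.sub_apply,
    Pi.single_eq_of_ne h.ne,
    Pi.single_eq_of_ne h.ne', if_pos h', if_neg (not_lt.mpr h'.le), sub_zero, neg_sub]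
  rw [sub_eq_add_neg 1, zpow_add₀ hq, zpow_one]
  field_simp

theorem upCoef_downCoef_comm {i j : Fin (n + 1)} (h : i ≠ j) (k : Idx n) :
    upCoef q p i (k + -Pi.single j 1) * downCoef q p j k =
      q.1 * (downCoef q p j (k + Pi.single i 1) * upCoef q p i k) := by
  have hq := q.ne_zero
  rw [← sub_eq_add_neg]
  simp only [downCoef, upCoef, partialSum_sub, partialSum_add,
    partialSum_single, Pi.sub_apply, Pi.add_apply, Pi.single_eq_of_ne h, Pi.single_eq_of_ne h.symm,
    sub_zero, add_zero]
  have h' : i.1 ≠ j.1 := fun e => h (Fin.ext e)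
  rcases lt_or_gt_of_ne h' with h1 | h1
  · rw [if_pos h1, if_neg (not_lt.mpr h1.le), sub_zero, neg_add, zpow_add₀ hq _ (-1), zpow_neg_one]
    field_simp
  · rw [if_pos h1, if_neg (not_lt.mpr h1.le), add_zero, neg_sub, sub_eq_add_neg, zpow_add₀ hq,
      zpow_one]
    ring

theorem zpow_mul_self (q : Par) (m : ℤ) : q.1 ^ m * q.1 ^ m = (q.1 ^ 2) ^ m := by
  rw [← mul_zpow, sq]

theorem upCoef_mul_downCoef (i : Fin (n + 1)) (k : Idx n) :
    upCoef q p i (k + -Pi.single i 1) * downCoef q p i k =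
      (orbitPt q p k).1 i.castSucc - (orbitPt q p k).1 i.succ := by
  rw [orbitPt_sub_succ, ← up_mul_down, ← zpow_mul_self]
  simp [downCoef, upCoef, ← sub_eq_add_neg, partialSum_sub, partialSum_single]
  ring

theorem downCoef_mul_upCoef (i : Fin (n + 1)) (k : Idx n) :
    downCoef q p i (k + Pi.single i 1) * upCoef q p i k =
      (orbitPt q p k).1 i.castSucc - (q.1 ^ 2)⁻¹ * (orbitPt q p k).1 i.succ := by
  rw [orbitPt_sub_inv_succ, ← up_mul_down', ← zpow_mul_self]
  simp [downCoef, upCoef, partialSum_add, partialSum_single]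
  ring

/-- The representation of `Func(O_V)_q` on the lattice through `p`. -/
noncomputable def latticeRep : O q n →ₐ[ℂ] Module.End ℂ (Idx n →₀ ℂ) :=
  RingQuot.liftAlgHom ℂ ⟨FreeAlgebra.lift ℂ (latticeVal q p), by
    intro x y r
    cases r with
    | z_z i j h =>
      simp only [map_mul, map_smul, FreeAlgebra.lift_ι_apply, latticeVal, moveOp_mul, smul_moveOp]
      rw [add_comm (Pi.single i 1 : Idx n)]
      congr 1; funext k
      have := upCoef_comm q p h k
      unfold Par.c
      exact_mod_cast this
    | zh_zh i j h =>
      simp only [map_mul, map_smul, FreeAlgebra.lift_ι_apply, latticeVal, moveOp_mul, smul_moveOp]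
      rw [add_comm (-Pi.single i 1 : Idx n)]
      congr 1; funext k
      have := downCoef_comm q p h k
      unfold Par.c
      exact_mod_cast this
    | z_zh i j h =>
      simp only [map_mul, map_smul, FreeAlgebra.lift_ι_apply, latticeVal, moveOp_mul, smul_moveOp]
      rw [add_comm (Pi.single i 1 : Idx n)]
      congr 1; funext k
      have := upCoef_downCoef_comm q p h k
      unfold Par.c
      exact_mod_cast this
    | z_zh_self i =>
      simp only [map_mul, map_sub, FreeAlgebra.lift_ι_apply, latticeVal, moveOp_mul, moveOp_sub]
      rw [add_neg_cancel]
      congr 1; funext k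
      have := upCoef_mul_downCoef q p i k
      unfold coord
      exact_mod_cast this
    | zh_z_self i =>
      simp only [map_mul, map_sub, map_smul, FreeAlgebra.lift_ι_apply, latticeVal, moveOp_mul,
        smul_moveOp]
      rw [add_neg_cancel, neg_add_cancel, moveOp_sub]
      congr 1; funext k
      have h1 := upCoef_mul_downCoef q p i k
      have h2 := downCoef_mul_upCoef q p i k
      have h3 : upCoef q p i (k + -Pi.single i 1) * downCoef q p i k -
          downCoef q p i (k + Pi.single i 1) * upCoef q p i k =
          (q.1⁻¹ ^ 2 - 1) * (orbitPt q p k).1 i.succ := by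
        rw [h1, h2, inv_pow]; ring
      unfold coord Par.c
      exact_mod_cast h3
    | z_fn i f =>
      simp only [map_mul, FreeAlgebra.lift_ι_apply, latticeVal, moveOp_mul, add_zero, zero_add]
      congr 1; funext k
      rw [shift_orbitPt_add, mul_comm]
    | zh_fn i f =>
      simp only [map_mul, FreeAlgebra.lift_ι_apply, latticeVal, moveOp_mul, add_zero, zero_add]
      congr 1; funext k
      rw [← sub_eq_add_neg, shift_orbitPt_sub, mul_comm]
    | fn_add f g =>
      simp only [map_add, FreeAlgebra.lift_ι_apply, latticeVal, moveOp_add, Pi.add_apply]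
    | fn_mul f g =>
      simp only [map_mul, FreeAlgebra.lift_ι_apply, latticeVal, moveOp_mul, Pi.mul_apply, add_zero]
    | fn_const t =>
      simp only [AlgHom.commutes, FreeAlgebra.lift_ι_apply, latticeVal]
      refine Finsupp.lhom_ext fun k s => ?_
      rw [moveOp_single, Module.algebraMap_end_apply, add_zero, Finsupp.smul_single]
      congr 1
      exact mul_comm _ _⟩

theorem latticeRep_gen (g : OGen n) : latticeRep q p (O.gen g) = latticeVal q p g := by
  simp [latticeRep, O.gen]

theorem latticeRep_z (i : Fin (n + 1)) (k : Idx n) (t : ℂ) :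
    latticeRep q p (O.z i) (Finsupp.single k t) =
      Finsupp.single (k + Pi.single i 1) (t * upCoef q p i k) := by
  rw [O.z, latticeRep_gen, latticeVal, moveOp_single]

theorem latticeRep_zh (i : Fin (n + 1)) (k : Idx n) (t : ℂ) :
    latticeRep q p (O.zh i) (Finsupp.single k t) =
      Finsupp.single (k - Pi.single i 1) (t * downCoef q p i k) := by
  rw [O.zh, latticeRep_gen, latticeVal, moveOp_single, sub_eq_add_neg]

theorem latticeRep_fn (f : Dom n → ℂ) (k : Idx n) (t : ℂ) :
    latticeRep q p (O.fn f) (Finsupp.single k t) = Finsupp.single k (t * f (orbitPt q p k)) := by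
  rw [O.fn, latticeRep_gen, latticeVal, moveOp_single, add_zero]

end rep

/-! ### Ordered monomials -/

theorem QC.pow_right {B : Type*} [Ring B] [Algebra ℂ B] {t : ℂ} {a b : B} (h : QC t a b) (m : ℕ) :
    QC (t ^ m) a (b ^ m) := by
  induction m with
  | zero => simp [QC]
  | succ m ih => rw [pow_succ, pow_succ]; exact ih.mul_right h

namespace O
variable {q : Par} {n : ℕ}

theorem z_fn (i : Fin (n + 1)) (f : Dom n → ℂ) :
    (z i * fn f : O q n) = fn (fun x => f (shift (q.1 ^ 2) q.sq_pos i x)) * z i := by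
  have := RingQuot.mkAlgHom_rel ℂ (ORel.z_fn (q := q) i f)
  rwa [map_mul, map_mul] at this

theorem zh_fn (i : Fin (n + 1)) (f : Dom n → ℂ) :
    (zh i * fn f : O q n) =
      fn (fun x => f (shift (q.1 ^ 2)⁻¹ (inv_pos.mpr q.sq_pos) i x)) * zh i := by
  have := RingQuot.mkAlgHom_rel ℂ (ORel.zh_fn (q := q) i f)
  rwa [map_mul, map_mul] at this

/-- `z_i^r` for `r ≥ 0` and `ẑ_i^{-r}` for `r ≤ 0`. -/
noncomputable def genPow (q : Par) {n : ℕ} (i : Fin (n + 1)) : ℤ → O q n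
  | .ofNat m => z i ^ m
  | .negSucc m => zh i ^ (m + 1)

theorem genPow_natCast (i : Fin (n + 1)) (m : ℕ) : genPow q i (m : ℤ) = z i ^ m := rfl

theorem genPow_neg_natCast (i : Fin (n + 1)) (m : ℕ) : genPow q i (-(m : ℤ)) = zh i ^ m := by
  cases m with
  | zero => simp [genPow]
  | succ m => rfl

theorem genPow_zero (i : Fin (n + 1)) : genPow q i 0 = 1 := by
  have := genPow_natCast (q := q) i 0
  simpa using this

/-- Either the power of z_i grows, or z_i meets ẑ_i and their product is a function. -/
theorem z_mul_genPow (i : Fin (n + 1)) (r : ℤ) :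
    ∃ f : Dom n → ℂ, z i * genPow q i r = fn f * genPow q i (r + 1) := by
  obtain ⟨m, rfl | rfl⟩ := r.eq_nat_or_neg
  · refine ⟨1, ?_⟩
    have : ((m : ℤ) + 1) = ((m + 1 : ℕ) : ℤ) := by push_cast; ring
    rw [fn_one, one_mul, this, genPow_natCast, genPow_natCast, pow_succ']
  · cases m with
    | zero =>
      refine ⟨1, ?_⟩
      have := genPow_natCast (q := q) i 1
      simp only [Nat.cast_one] at this
      simp [fn_one, genPow_zero, this]
    | succ m =>
      refine ⟨coord i.castSucc - coord i.succ, ?_⟩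
      have : (-((m + 1 : ℕ) : ℤ) + 1) = -(m : ℤ) := by push_cast; ring
      rw [this, genPow_neg_natCast, genPow_neg_natCast, pow_succ', ← mul_assoc, z_zh_self, fn_sub]

theorem zh_mul_genPow (i : Fin (n + 1)) (r : ℤ) :
    ∃ f : Dom n → ℂ, zh i * genPow q i r = fn f * genPow q i (r + -1) := by
  obtain ⟨m, rfl | rfl⟩ := r.eq_nat_or_neg
  · cases m with
    | zero =>
      refine ⟨1, ?_⟩
      have := genPow_neg_natCast (q := q) i 1
      simp only [Nat.cast_one] at this
      simp [fn_one, genPow_zero, this]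
    | succ m =>
      refine ⟨coord i.castSucc - q.c⁻¹ ^ 2 • coord i.succ, ?_⟩
      have : (((m + 1 : ℕ) : ℤ) + -1) = (m : ℤ) := by push_cast; ring
      rw [this, genPow_natCast, genPow_natCast, pow_succ', ← mul_assoc, zh_z_self, fn_sub, fn_smul]
  · refine ⟨1, ?_⟩
    have : (-(m : ℤ) + -1) = -((m + 1 : ℕ) : ℤ) := by push_cast; ring
    rw [fn_one, one_mul, this, genPow_neg_natCast, genPow_neg_natCast, pow_succ']

theorem qc_z_genPow {i j : Fin (n + 1)} (h : j ≠ i) (r : ℤ) : ∃ c, QC c (z i : O q n) (genPow q j r) := by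
  cases r with
  | ofNat m => exact ⟨_, (qc_z_z i j).pow_right m⟩
  | negSucc m => exact ⟨_, (qc_z_zh h.symm).pow_right (m + 1)⟩

theorem qc_zh_genPow {i j : Fin (n + 1)} (h : j ≠ i) (r : ℤ) :
    ∃ c, QC c (zh i : O q n) (genPow q j r) := by
  cases r with
  | ofNat m => exact ⟨_, (qc_zh_z h.symm).pow_right m⟩
  | negSucc m => exact ⟨_, (qc_zh_zh i j).pow_right (m + 1)⟩

theorem pow_mul_fn {a : O q n} (ha : ∀ f : Dom n → ℂ, ∃ g, a * fn f = fn g * a) (m : ℕ)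
    (f : Dom n → ℂ) : ∃ g, a ^ m * fn f = fn g * a ^ m := by
  induction m with
  | zero => exact ⟨f, by simp⟩
  | succ m ih =>
    obtain ⟨g, hg⟩ := ih
    obtain ⟨g', hg'⟩ := ha g
    exact ⟨g', by rw [pow_succ', mul_assoc, hg, ← mul_assoc, hg', mul_assoc]⟩

theorem pow_fn_mul {a : O q n} (ha : ∀ f : Dom n → ℂ, ∃ g, a * fn g = fn f * a) (m : ℕ)
    (f : Dom n → ℂ) : ∃ g, a ^ m * fn g = fn f * a ^ m := by
  induction m with
  | zero => exact ⟨f, by simp⟩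
  | succ m ih =>
    obtain ⟨g, hg⟩ := ih
    obtain ⟨g', hg'⟩ := ha g
    exact ⟨g', by rw [pow_succ, mul_assoc, hg', ← mul_assoc, hg, mul_assoc]⟩

theorem genPow_mul_fn (i : Fin (n + 1)) (r : ℤ) (f : Dom n → ℂ) :
    ∃ g, genPow q i r * fn f = fn g * genPow q i r := by
  cases r with
  | ofNat m => exact pow_mul_fn (fun f => ⟨_, z_fn i f⟩) m f
  | negSucc m => exact pow_mul_fn (fun f => ⟨_, zh_fn i f⟩) (m + 1) f

theorem shift_inv_shift (i : Fin (n + 1)) (x : Dom n) :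
    shift (q.1 ^ 2)⁻¹ (inv_pos.mpr q.sq_pos) i (shift (q.1 ^ 2) q.sq_pos i x) = x := by
  apply Subtype.ext
  funext j
  simp only [shift]
  split_ifs
  · rw [inv_mul_cancel_left₀ q.sq_pos.ne']
  · simp

/-- Shifts of the argument are invertible, so every function on the left comes from one on the
right. This direction is the one needed to move functions onto 1_χ. -/
theorem genPow_fn_mul (i : Fin (n + 1)) (r : ℤ) (f : Dom n → ℂ) :
    ∃ g, genPow q i r * fn g = fn f * genPow q i r := by
  cases r with
  | ofNat m =>
    exact pow_fn_mul (fun f => ⟨fun x => f (shift (q.1 ^ 2)⁻¹ (inv_pos.mpr q.sq_pos) i x), by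
      rw [z_fn]; simp only [shift_inv_shift]⟩) m f
  | negSucc m =>
    exact pow_fn_mul (fun f => ⟨fun x => f (shift (q.1 ^ 2) q.sq_pos i x), by
      rw [zh_fn]; simp only [Eigen.shift_shift_inv]⟩) (m + 1) f

/-- The ordered product of the powers `z_i^{k_i}` over a list of indices. -/
noncomputable def monomialOn (q : Par) {n : ℕ} (L : List (Fin (n + 1))) (k : Idx n) : O q n :=
  (L.map fun i => genPow q i (k i)).prod

theorem monomialOn_cons (i : Fin (n + 1)) (L : List (Fin (n + 1))) (k : Idx n) :
    monomialOn q (i :: L) k = genPow q i (k i) * monomialOn q L k := by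
  simp [monomialOn]

theorem monomialOn_congr {L : List (Fin (n + 1))} {k l : Idx n} (h : ∀ i ∈ L, k i = l i) :
    monomialOn q L k = monomialOn q L l := by
  unfold monomialOn
  rw [List.map_congr_left fun i hi => by rw [h i hi]]

/-- The factor g passes the powers with other indices up to a scalar and is absorbed by the power
with index i. The function that this creates is then moved back to the far left. -/
theorem mul_monomialOn {g : O q n} {i : Fin (n + 1)} {s : ℤ}
    (hg : ∀ j, j ≠ i → ∀ r, ∃ c, QC c g (genPow q j r))
    (hi : ∀ r, ∃ f, g * genPow q i r = fn f * genPow q i (r + s)) (k : Idx n)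
    (L : List (Fin (n + 1))) (hL : L.Nodup) (hiL : i ∈ L) :
    ∃ f, g * monomialOn q L k = fn f * monomialOn q L (k + Pi.single i s) := by
  induction L with
  | nil => simp at hiL
  | cons j L ih =>
    rw [monomialOn_cons, monomialOn_cons]
    rw [List.nodup_cons] at hL
    by_cases hj : j = i
    · subst hj
      obtain ⟨f, hf⟩ := hi (k j)
      refine ⟨f, ?_⟩
      have : monomialOn q L (k + Pi.single j s) = monomialOn q L k :=
        monomialOn_congr fun l hl => by
          rw [Pi.add_apply, Pi.single_eq_of_ne (by rintro rfl; exact hL.1 hl), add_zero]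
      rw [this, ← mul_assoc, hf, Pi.add_apply, Pi.single_eq_same, mul_assoc]
    · obtain ⟨f, hf⟩ := ih hL.2 (by simpa [Ne.symm hj] using hiL)
      obtain ⟨c, hc⟩ := hg j hj (k j)
      obtain ⟨f', hf'⟩ := genPow_mul_fn (q := q) j (k j) f
      refine ⟨c • f', ?_⟩
      unfold QC at hc
      rw [← mul_assoc, hc, Pi.add_apply, Pi.single_eq_of_ne hj, add_zero, fn_smul, smul_mul_assoc,
        smul_mul_assoc, mul_assoc, hf, ← mul_assoc, hf', mul_assoc]

theorem monomialOn_fn_mul (L : List (Fin (n + 1))) (k : Idx n) (f : Dom n → ℂ) :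
    ∃ g, monomialOn q L k * fn g = fn f * monomialOn q L k := by
  induction L generalizing f with
  | nil => exact ⟨f, by simp [monomialOn]⟩
  | cons i L ih =>
    obtain ⟨g, hg⟩ := genPow_fn_mul (q := q) i (k i) f
    obtain ⟨g', hg'⟩ := ih g
    exact ⟨g', by rw [monomialOn_cons, mul_assoc, hg', ← mul_assoc, hg, mul_assoc]⟩

/-- The monomial with exponents `k`. -/
noncomputable def monomial (q : Par) {n : ℕ} (k : Idx n) : O q n :=
  monomialOn q (List.finRange (n + 1)) k

theorem monomial_zero : monomial q (0 : Idx n) = 1 := by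
  refine List.prod_eq_one fun x hx => ?_
  obtain ⟨i, -, rfl⟩ := List.mem_map.mp hx
  exact genPow_zero i

theorem z_mul_monomial (i : Fin (n + 1)) (k : Idx n) :
    ∃ f, z i * monomial q k = fn f * monomial q (k + Pi.single i 1) :=
  mul_monomialOn (fun _ h => qc_z_genPow h) (z_mul_genPow i) k _ (List.nodup_finRange _)
    (List.mem_finRange _)

theorem zh_mul_monomial (i : Fin (n + 1)) (k : Idx n) :
    ∃ f, zh i * monomial q k = fn f * monomial q (k + Pi.single i (-1)) :=
  mul_monomialOn (fun _ h => qc_zh_genPow h) (zh_mul_genPow i) k _ (List.nodup_finRange _)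
    (List.mem_finRange _)

/-- The span of the elements `f(x) z^k` with `∑ k_i = d`. -/
noncomputable def degreeSpan (q : Par) (n : ℕ) (d : ℤ) : Submodule ℂ (O q n) :=
  Submodule.span ℂ {a | ∃ (f : Dom n → ℂ) (k : Idx n), ∑ i, k i = d ∧ a = fn f * monomial q k}

theorem mul_mem_iSup_degreeSpan (g : OGen n) (b : O q n) (hb : b ∈ ⨆ d, degreeSpan q n d) :
    gen g * b ∈ ⨆ d, degreeSpan q n d := by
  refine Submodule.iSup_induction (degreeSpan q n) (motive := fun b => gen g * b ∈ _) hb ?_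
    (by simp) (fun x y hx hy => by rw [mul_add]; exact add_mem hx hy)
  intro d x hx
  refine Submodule.span_induction (p := fun x _ => gen g * x ∈ _) ?_ (by simp)
    (fun x y _ _ hx hy => by rw [mul_add]; exact add_mem hx hy)
    (fun t x _ hx => by rw [mul_smul_comm]; exact Submodule.smul_mem _ t hx) hx
  rintro _ ⟨f, k, -, rfl⟩
  have key : ∀ (f : Dom n → ℂ) (k : Idx n), fn f * monomial q k ∈ ⨆ d, degreeSpan q n d :=
    fun f k => Submodule.mem_iSup_of_mem (∑ i, k i) (Submodule.subset_span ⟨f, k, rfl, rfl⟩)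
  cases g with
  | z i =>
    obtain ⟨f', hf'⟩ := z_mul_monomial (q := q) i k
    change z i * _ ∈ _
    rw [← mul_assoc, z_fn, mul_assoc, hf', ← mul_assoc, ← fn_mul]
    exact key _ _
  | zh i =>
    obtain ⟨f', hf'⟩ := zh_mul_monomial (q := q) i k
    change zh i * _ ∈ _
    rw [← mul_assoc, zh_fn, mul_assoc, hf', ← mul_assoc, ← fn_mul]
    exact key _ _
  | fn f' =>
    change fn f' * _ ∈ _
    rw [← mul_assoc, ← fn_mul]
    exact key _ _

/-- The sum of the spans contains 1 and is stable under left multiplication by generators, hence by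
everything. -/
theorem iSup_degreeSpan : ⨆ d, degreeSpan q n d = ⊤ := by
  have key : ∀ a : O q n, ∀ b ∈ ⨆ d, degreeSpan q n d, a * b ∈ ⨆ d, degreeSpan q n d := by
    intro a
    obtain ⟨a, rfl⟩ := RingQuot.mkAlgHom_surjective ℂ (ORel q n) a
    induction a using FreeAlgebra.induction with
    | grade0 t =>
      intro b hb
      rw [AlgHom.commutes, ← Algebra.smul_def]
      exact Submodule.smul_mem _ t hb
    | grade1 g => exact mul_mem_iSup_degreeSpan g
    | mul a b ha hb => intro c hc; rw [map_mul, mul_assoc]; exact ha _ (hb _ hc)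
    | add a b ha hb => intro c hc; rw [map_add, add_mul]; exact add_mem (ha _ hc) (hb _ hc)
  refine eq_top_iff.mpr fun a _ => ?_
  have h1 : (1 : O q n) ∈ ⨆ d, degreeSpan q n d :=
    Submodule.mem_iSup_of_mem 0 (Submodule.subset_span ⟨1, 0, by simp, by
      rw [fn_one, monomial_zero, one_mul]⟩)
  simpa using key a 1 h1

theorem kappa_genPow (α : Circle) (i : Fin (n + 1)) (r : ℤ) :
    kappa α (genPow q i r) = (α : ℂ) ^ r • genPow q i r := by
  cases r with
  | ofNat m =>
    change kappa α (z i ^ m) = (α : ℂ) ^ (m : ℤ) • z i ^ m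
    rw [map_pow, kappa_z, smul_pow]
    congr 1
  | negSucc m =>
    change kappa α (zh i ^ (m + 1)) = (α : ℂ) ^ (Int.negSucc m) • zh i ^ (m + 1)
    rw [map_pow, kappa_zh, smul_pow, zpow_negSucc, ← Circle.coe_inv_eq_conj, Circle.coe_inv,
      inv_pow]

theorem kappa_monomialOn (α : Circle) (L : List (Fin (n + 1))) (k : Idx n) :
    kappa α (monomialOn q L k) = (α : ℂ) ^ (L.map k).sum • monomialOn q L k := by
  induction L with
  | nil => simp [monomialOn]
  | cons i L ih =>
    rw [monomialOn_cons, map_mul, kappa_genPow, ih, smul_mul_smul_comm, List.map_cons, List.sum_cons,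
      zpow_add₀ (Circle.coe_ne_zero α)]

theorem degreeSpan_le_eigenspace (α : Circle) (d : ℤ) :
    degreeSpan q n d ≤ Module.End.eigenspace (kappa (q := q) (n := n) α).toLinearMap
      ((α : ℂ) ^ d) := by
  refine Submodule.span_le.mpr ?_
  rintro _ ⟨f, k, hk, rfl⟩
  rw [SetLike.mem_coe, Module.End.mem_eigenspace_iff, AlgHom.toLinearMap_apply, map_mul, kappa_fn,
    monomial, kappa_monomialOn, mul_smul_comm, ← List.sum_ofFn, List.ofFn_eq_map] at *
  rw [hk]

/-- One element of infinite order on the circle already separates all degrees, so a single κ_α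
detects invariance. -/
theorem exists_circle_zpow_injective :
    ∃ α : Circle, Function.Injective fun d : ℤ => (α : ℂ) ^ d := by
  refine ⟨Circle.exp 1, fun a b h => ?_⟩
  have h1 : (Circle.exp 1) ^ a = (Circle.exp 1) ^ b := Circle.ext (by simpa using h)
  rw [← Circle.exp_zsmul, ← Circle.exp_zsmul, Circle.exp_eq_exp] at h1
  obtain ⟨m, hm⟩ := h1
  simp only [zsmul_eq_mul, mul_one] at hm
  by_cases h0 : m = 0
  · rw [h0] at hm
    simpa using hm
  · exfalso
    -- A nonzero number m of full turns would make π the rational number (a - b) / (2m).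
    have hp : Real.pi = ((a - b : ℤ) : ℚ) / (2 * m : ℤ) := by
      have : (m : ℝ) ≠ 0 := by exact_mod_cast h0
      push_cast
      field_simp
      linarith
    exact irrational_pi ⟨((a - b : ℤ) : ℚ) / (2 * m : ℤ), by rw [hp]; push_cast; ring⟩

/-- Split a into its part in D d and a part in the other summands. The second part lies both in the
eigenspace for μ d and in the sum of the other eigenspaces, so it is 0 by independence. -/
theorem mem_of_le_eigenspace {E : Type*} [AddCommGroup E] [Module ℂ E] {T : Module.End ℂ E}
    {D : ℤ → Submodule ℂ E} {μ : ℤ → ℂ} (hμ : Function.Injective μ)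
    (hD : ∀ d, D d ≤ T.eigenspace (μ d)) (htop : ⨆ d, D d = ⊤) (d : ℤ) {a : E}
    (ha : a ∈ T.eigenspace (μ d)) : a ∈ D d := by
  have hind := T.eigenspaces_iSupIndep.comp hμ
  have h : a ∈ D d ⊔ ⨆ e, ⨆ (_ : e ≠ d), D e := by
    rw [← iSup_split_single, htop]; trivial
  obtain ⟨b, hb, c, hc, rfl⟩ := Submodule.mem_sup.mp h
  have hc1 : c ∈ T.eigenspace (μ d) := by simpa using sub_mem ha (hD d hb)
  have hc2 : c ∈ ⨆ e, ⨆ (_ : e ≠ d), T.eigenspace (μ e) := (iSup₂_mono fun e _ => hD e) hc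
  have hc0 : c = 0 := Submodule.disjoint_def.mp (hind d) c hc1 hc2
  rwa [hc0, add_zero]

/-- The invariant elements are the sums of the elements `f(x) z^k` with `∑ k_i = 0`. -/
theorem mem_degreeSpan_zero {a : O q n} (ha : a ∈ FuncX q n) : a ∈ degreeSpan q n 0 := by
  obtain ⟨α, hα⟩ := exists_circle_zpow_injective
  refine mem_of_le_eigenspace hα (degreeSpan_le_eigenspace α) iSup_degreeSpan 0 ?_
  rw [Module.End.mem_eigenspace_iff, AlgHom.toLinearMap_apply, mem_FuncX.mp ha α]
  simp

end O

/-! ### The action of the monomials on the lattice -/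

section
variable (q : Par) {n : ℕ} (p : Dom n)

theorem upCoef_ne_zero {i : Fin (n + 1)} {k : Idx n} (h : up q p i (k i) ≠ 0) :
    upCoef q p i k ≠ 0 := mul_ne_zero (zpow_ne_zero _ q.ne_zero) h

theorem downCoef_ne_zero {i : Fin (n + 1)} {k : Idx n} (h : down q p i (k i) ≠ 0) :
    downCoef q p i k ≠ 0 := mul_ne_zero (zpow_ne_zero _ q.ne_zero) h

/-- Starting from exponent 0, every step moves away from 0, where the coefficient cannot vanish. -/
theorem latticeRep_genPow (i : Fin (n + 1)) (r : ℤ) {l : Idx n} (hl : l i = 0) {t : ℂ}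
    (ht : t ≠ 0) : ∃ s : ℂ, s ≠ 0 ∧ latticeRep q p (O.genPow q i r) (Finsupp.single l t) =
      Finsupp.single (l + Pi.single i r) s := by
  obtain ⟨m, rfl | rfl⟩ := r.eq_nat_or_neg
  · rw [O.genPow_natCast]
    induction m with
    | zero => exact ⟨t, ht, by simp⟩
    | succ m ih =>
      obtain ⟨s, hs, e⟩ := ih
      refine ⟨s * upCoef q p i (l + Pi.single i (m : ℤ)), mul_ne_zero hs ?_, ?_⟩
      · have : upCoef q p i (l + Pi.single i (m : ℤ)) ≠ 0 :=
          upCoef_ne_zero q p (up_ne_zero p i (by simp [hl]))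
        exact_mod_cast this
      · rw [pow_succ', map_mul, Module.End.mul_apply, e, latticeRep_z, add_assoc,
          ← Pi.single_add, Nat.cast_succ]
  · rw [O.genPow_neg_natCast]
    induction m with
    | zero => exact ⟨t, ht, by simp⟩
    | succ m ih =>
      obtain ⟨s, hs, e⟩ := ih
      refine ⟨s * downCoef q p i (l + Pi.single i (-(m : ℤ))), mul_ne_zero hs ?_, ?_⟩
      · have : downCoef q p i (l + Pi.single i (-(m : ℤ))) ≠ 0 :=
          downCoef_ne_zero q p (down_ne_zero p i (by simp [hl]))
        exact_mod_cast this
      · rw [pow_succ', map_mul, Module.End.mul_apply, e, latticeRep_zh, add_sub_assoc,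
          ← Pi.single_sub, Nat.cast_succ, neg_add']

theorem latticeRep_monomialOn (L : List (Fin (n + 1))) (hL : L.Nodup) (k : Idx n) :
    ∃ s : ℂ, s ≠ 0 ∧ latticeRep q p (O.monomialOn q L k) (Finsupp.single 0 1) =
      Finsupp.single (fun i => if i ∈ L then k i else 0) s := by
  induction L with
  | nil => exact ⟨1, one_ne_zero, by simp [O.monomialOn]; rfl⟩
  | cons i L ih =>
    rw [List.nodup_cons] at hL
    obtain ⟨s, hs, e⟩ := ih hL.2
    -- The factors act from the right, and the indices are distinct, so the i-th exponent is still 0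
    -- when the i-th power acts.
    obtain ⟨s', hs', e'⟩ := latticeRep_genPow q p i (k i)
      (l := fun i => if i ∈ L then k i else 0) (if_neg hL.1) hs
    refine ⟨s', hs', ?_⟩
    rw [O.monomialOn_cons, map_mul, Module.End.mul_apply, e, e']
    congr 1
    funext j
    by_cases hj : j = i
    · subst hj
      simp [hL.1]
    · simp [hj]

theorem latticeRep_monomial (k : Idx n) :
    ∃ s : ℂ, s ≠ 0 ∧ latticeRep q p (O.monomial q k) (Finsupp.single 0 1) =
      Finsupp.single k s := by
  obtain ⟨s, hs, e⟩ := latticeRep_monomialOn q p _ (List.nodup_finRange (n + 1)) k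
  refine ⟨s, hs, e.trans ?_⟩
  simp only [List.mem_finRange, if_true]

end

/-! ### The root vectors on the lattice -/

/-- The lattice vector of the `i`-th simple root. -/
def root {n : ℕ} (i : Fin n) : Idx n := Pi.single i.castSucc 1 - Pi.single i.succ 1

section rootVectors
variable (q : Par) {n : ℕ} (p : Dom n) (i : Fin n) (k : Idx n)

theorem root_castSucc : root i i.castSucc = 1 := by
  simp [root, Pi.single_eq_of_ne (Fin.castSucc_lt_succ (i := i)).ne]

theorem root_succ : root i i.succ = -1 := by
  simp [root, Pi.single_eq_of_ne (Fin.castSucc_lt_succ (i := i)).ne']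

/-- The two unit steps cancel in every later partial sum, so a root moves the coordinate x_i alone.
-/
theorem partialSum_root (j : ℕ) : partialSum j (root i) = if j = i.1 + 1 then 1 else 0 := by
  rw [root, partialSum_sub, partialSum_single, partialSum_single]
  simp only [Fin.val_castSucc, Fin.val_succ]
  split_ifs <;> omega

theorem sum_add_root : ∑ j, (k + root i) j = ∑ j, k j := by
  rw [← partialSum_last, ← partialSum_last, partialSum_add, partialSum_root,
    if_neg (by have := i.2; omega), add_zero]

/-- The common factor of the coefficients of the root vectors. -/
noncomputable def rootFactor : ℝ :=
  (q.1 ^ 2 - 1)⁻¹ * ((orbitPt q p (k + root i)).1 i.castSucc.succ)⁻¹ *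
    (q.1 ^ (-partialSum i.1 k) * q.1 ^ (-partialSum (i.1 + 1) k))

/-- The coefficient of `E_i`. -/
noncomputable def raiseCoef : ℝ :=
  rootFactor q p i k * (up q p i.castSucc (k i.castSucc) * down q p i.succ (k i.succ))

/-- The coefficient of `q K_i⁻¹ F_i`. -/
noncomputable def lowerCoef : ℝ :=
  rootFactor q p i k *
    (down q p i.castSucc (k i.castSucc + 1) * up q p i.succ (k i.succ - 1))

theorem rootFactor_ne_zero : rootFactor q p i k ≠ 0 := by
  have h1 : q.1 ^ 2 - 1 ≠ 0 := by linarith [q.sq_lt_one]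
  have h2 := (orbitPt q p (k + root i)).2.1 i.castSucc.succ
  have h3 := q.ne_zero
  exact mul_ne_zero (mul_ne_zero (inv_ne_zero h1) (inv_ne_zero h2))
    (mul_ne_zero (zpow_ne_zero _ h3) (zpow_ne_zero _ h3))

/-- The factor `rootFactor` is real, nonzero and common to both coefficients, so it enters as a
square. The sign of the product is that of the two gaps, independently of how each gap is split
between z and ẑ. -/
theorem raiseCoef_mul_lowerCoef : raiseCoef q p i k * lowerCoef q p i k =
    rootFactor q p i k ^ 2 * (gap q p i.castSucc (k i.castSucc + 1) *
      gap q p i.succ (k i.succ)) := by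
  rw [← up_mul_down', ← up_mul_down p i.succ, raiseCoef, lowerCoef]
  ring

theorem orbitPt_add_root (j : Fin (n + 2)) : (orbitPt q p (k + root i)).1 j =
    if j = i.castSucc.succ then (q.1 ^ 2)⁻¹ * (orbitPt q p k).1 j else (orbitPt q p k).1 j := by
  have hj : j = i.castSucc.succ ↔ j.1 = i.1 + 1 := by simp [Fin.ext_iff]
  simp only [orbitPt, partialSum_add, partialSum_root, hj]
  split_ifs
  · rw [neg_add, zpow_add₀ q.sq_pos.ne', zpow_neg_one]
    ring
  · simp

theorem latticeRep_JE (t : ℂ) : latticeRep q p (O.JE q i) (Finsupp.single k t) =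
    Finsupp.single (k + root i) (t * raiseCoef q p i k) := by
  have h1 : upCoef q p i.castSucc (k - Pi.single i.succ 1) =
      q.1 ^ (-partialSum i.1 k) * up q p i.castSucc (k i.castSucc) := by
    simp [upCoef, partialSum_sub, partialSum_single,
      Pi.single_eq_of_ne (Fin.castSucc_lt_succ (i := i)).ne]
  have h2 : k - Pi.single i.succ 1 + Pi.single i.castSucc 1 = k + root i := by
    rw [root]; abel
  rw [O.JE, map_smul, map_mul, map_mul, LinearMap.smul_apply, Module.End.mul_apply,
    Module.End.mul_apply, latticeRep_zh, latticeRep_z, latticeRep_fn, h1, h2, Finsupp.smul_single]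
  congr 1
  simp only [raiseCoef, rootFactor, downCoef, Pi.inv_apply, coord, smul_eq_mul, Par.c,
    Fin.val_succ]
  push_cast
  ring

/-- The root (x_{i-1} x_{i+1})^{1/2} cancels between K_i⁻¹ and F_i. The value of x_i at k differs
from that at k + `root i` by q², which turns the scalar q / (q - q⁻¹) into the one of E_i. -/
theorem latticeRep_JF (t : ℂ) :
    latticeRep q p (q.c • (O.JKinv q i * O.JF q i)) (Finsupp.single (k + root i) t) =
      Finsupp.single k (t * lowerCoef q p i k) := by
  have hne := (Fin.castSucc_lt_succ (i := i)).ne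
  have h0 : k + root i - Pi.single i.castSucc 1 = k - Pi.single i.succ 1 := by
    rw [root]; abel
  have h1 : downCoef q p i.castSucc (k + root i) =
      q.1 ^ (-partialSum i.1 k) * down q p i.castSucc (k i.castSucc + 1) := by
    simp [downCoef, partialSum_add, partialSum_root, root_castSucc]
  have h2 : upCoef q p i.succ (k - Pi.single i.succ 1) =
      q.1 ^ (-partialSum (i.1 + 1) k) * up q p i.succ (k i.succ - 1) := by
    simp [upCoef, partialSum_sub, partialSum_single]
  have hx := orbitPt_add_root q p i k i.castSucc.succ
  rw [if_pos rfl] at hx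
  rw [O.JF, O.JKinv, mul_smul_comm, map_smul, map_smul, map_mul, map_mul, map_mul,
    LinearMap.smul_apply,
    LinearMap.smul_apply, Module.End.mul_apply, Module.End.mul_apply, Module.End.mul_apply,
    latticeRep_zh, latticeRep_z, h0, h1, h2, sub_add_cancel, latticeRep_fn, latticeRep_fn,
    Finsupp.smul_single, Finsupp.smul_single]
  congr 1
  have hr := rt_ne q i (orbitPt q p k)
  have hc := coord_ne i.castSucc.succ (orbitPt q p k)
  have hq := q.c_ne
  have hq2 := q.c_sq_ne
  have hq3 : q.c - q.c⁻¹ ≠ 0 := by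
    intro h; apply hq2; field_simp at h; simpa using h
  simp only [lowerCoef, rootFactor, hx, Pi.inv_apply, Pi.mul_apply, smul_eq_mul]
  push_cast
  simp only [coord, Par.c] at *
  have e1 : (q.1 : ℂ) * ((q.1 : ℂ) - (q.1 : ℂ)⁻¹)⁻¹ =
      ((q.1 : ℂ) ^ 2 - 1)⁻¹ * (q.1 : ℂ) ^ 2 := by
    field_simp
  have e2 : rt q i (orbitPt q p k) * (rt q i (orbitPt q p k))⁻¹ = 1 := mul_inv_cancel₀ hr
  rw [mul_inv, inv_inv]
  linear_combination (t * (q.1 : ℂ) ^ (-partialSum i.1 k) *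
    (down q p i.castSucc (k i.castSucc + 1)) * ((q.1 : ℂ) ^ (-partialSum (i.1 + 1) k) *
    (up q p i.succ (k i.succ - 1))) * (((orbitPt q p k).1 i.castSucc.succ : ℝ) : ℂ)⁻¹) *
    ((rt q i (orbitPt q p k) * (rt q i (orbitPt q p k))⁻¹) * e1 +
      ((q.1 : ℂ) ^ 2 - 1)⁻¹ * (q.1 : ℂ) ^ 2 * e2)

end rootVectors

/-! ### The induced module -/

/-- The inclusion of `Func(X)_q`. -/
noncomputable def FX.incl (q : Par) (n : ℕ) : FX q n →ₐ[ℂ] O q n := (FuncX q n).val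

theorem incl_fnX (q : Par) {n : ℕ} (f : Dom n → ℂ) : FX.incl q n (fnX q f) = O.fn f := rfl

theorem incl_J (q : Par) {n : ℕ} (a : U q n) :
    FX.incl q n (J q n a) = U.lift (O.satJ (q := q) (n := n)) a := rfl

theorem FX.incl_injective (q : Par) (n : ℕ) : Function.Injective (FX.incl q n) :=
  Subtype.val_injective

theorem J_K (q : Par) {n : ℕ} (i : Fin n) :
    J q n (U.K i) = fnX q (coord i.castSucc.succ * (rt q i)⁻¹) :=
  FX.incl_injective q n (U.lift_gen (O.satJ (q := q) (n := n)) (.K i))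

theorem J_Kinv (q : Par) {n : ℕ} (i : Fin n) :
    J q n (U.Kinv i) = fnX q (rt q i * (coord i.castSucc.succ)⁻¹) :=
  FX.incl_injective q n (U.lift_gen (O.satJ (q := q) (n := n)) (.Kinv i))

theorem incl_J_E (q : Par) {n : ℕ} (i : Fin n) : FX.incl q n (J q n (U.E i)) = O.JE q i :=
  U.lift_gen (O.satJ (q := q) (n := n)) (.E i)

theorem incl_J_F (q : Par) {n : ℕ} (i : Fin n) :
    FX.incl q n (J q n (q.c • (U.Kinv i * U.F i))) = q.c • (O.JKinv q i * O.JF q i) := by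
  rw [incl_J, map_smul, map_mul]
  congr 2
  · exact U.lift_gen (O.satJ (q := q) (n := n)) (.Kinv i)
  · exact U.lift_gen (O.satJ (q := q) (n := n)) (.F i)

section induced
variable (q : Par) {n : ℕ} (p : Dom n)

/-- The map `a ↦ a e_0`. -/
noncomputable def latticeOrbit : FX q n →ₗ[ℂ] (Idx n →₀ ℂ) :=
  (LinearMap.applyₗ (Finsupp.single (0 : Idx n) (1 : ℂ))).comp
    ((latticeRep q p).comp (FX.incl q n)).toLinearMap

theorem latticeOrbit_apply (a : FX q n) :
    latticeOrbit q p a = latticeRep q p (FX.incl q n a) (Finsupp.single 0 1) := rfl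

/-- The basis vector at 0 has weight p, so the elements f - f(p) annihilate it. -/
theorem indIdeal_le_ker :
    (indIdeal q p).restrictScalars ℂ ≤ LinearMap.ker (latticeOrbit q p) := by
  intro a ha
  rw [LinearMap.mem_ker, latticeOrbit_apply]
  refine Submodule.span_induction (p := fun a _ => latticeRep q p (FX.incl q n a)
    (Finsupp.single 0 1) = 0) ?_ (by simp) (fun x y _ _ hx hy => by simp [hx, hy])
    (fun b x _ hx => by simp [hx]) (Submodule.restrictScalars_mem ℂ _ _ |>.mp ha)
  rintro _ ⟨f, rfl⟩
  simp only [map_sub, incl_fnX, LinearMap.sub_apply, latticeRep_fn, AlgHom.commutes,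
    Module.algebraMap_end_apply, orbitPt_zero, Finsupp.smul_single]
  simp

/-- The map of the induced module to the lattice representation. -/
noncomputable def toLattice : W q p →ₗ[ℂ] (Idx n →₀ ℂ) :=
  (((indIdeal q p).restrictScalars ℂ).liftQ (latticeOrbit q p) (indIdeal_le_ker q p)).comp
    (Submodule.Quotient.restrictScalarsEquiv ℂ (indIdeal q p)).symm.toLinearMap

theorem toLattice_mk (a : FX q n) : toLattice q p (Submodule.Quotient.mk a) =
    latticeRep q p (FX.incl q n a) (Finsupp.single 0 1) := rfl

theorem toLattice_smul (a : FX q n) (w : W q p) :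
    toLattice q p (a • w) = latticeRep q p (FX.incl q n a) (toLattice q p w) := by
  obtain ⟨b, rfl⟩ := Submodule.Quotient.mk_surjective _ w
  rw [← Submodule.Quotient.mk_smul, toLattice_mk, toLattice_mk, smul_eq_mul, map_mul, map_mul,
    Module.End.mul_apply]

theorem toLattice_cyc : toLattice q p (cyc q p) = Finsupp.single 0 1 := by
  rw [cyc, toLattice_mk]
  simp

theorem fnX_smul_cyc (f : Dom n → ℂ) : fnX q f • cyc q p = f p • cyc q p := by
  rw [cyc, ← Submodule.Quotient.mk_smul, ← Submodule.Quotient.mk_smul, Submodule.Quotient.eq]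
  refine Submodule.subset_span ⟨f, ?_⟩
  simp only [smul_eq_mul, mul_one, Algebra.algebraMap_eq_smul_one]

theorem monomial_mem {k : Idx n} (hk : ∑ i, k i = 0) : O.monomial q k ∈ FuncX q n := by
  refine mem_FuncX.mpr fun α => ?_
  rw [O.monomial, O.kappa_monomialOn, ← List.ofFn_eq_map, List.sum_ofFn, hk, zpow_zero, one_smul]

/-- The lattice of the exponents of the invariant monomials. -/
def rootLattice (n : ℕ) : Set (Idx n) := {k | ∑ i, k i = 0}

/-- The vector `z^k 1_χ`. -/
noncomputable def monomialVec (k : rootLattice n) : W q p :=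
  Submodule.Quotient.mk (⟨O.monomial q k.1, monomial_mem q k.2⟩ : FuncX q n)

/-- An invariant element is a sum of terms f(x) z^k of total exponent 0. Each f can be carried
through the monomial to 1_χ, where it becomes a number. -/
theorem span_monomialVec : ⊤ ≤ Submodule.span ℂ (Set.range (monomialVec q p)) := by
  have key : ∀ a : O q n, a ∈ O.degreeSpan q n 0 → ∃ b : FX q n, FX.incl q n b = a ∧
      (Submodule.Quotient.mk b : W q p) ∈ Submodule.span ℂ (Set.range (monomialVec q p)) := by
    intro a ha
    refine Submodule.span_induction (p := fun a _ => ∃ b : FX q n, FX.incl q n b = a ∧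
      (Submodule.Quotient.mk b : W q p) ∈ Submodule.span ℂ (Set.range (monomialVec q p)))
      ?_ ?_ ?_ ?_ ha
    · rintro _ ⟨f, k, hk, rfl⟩
      obtain ⟨g, hg⟩ : ∃ g, O.monomial q k * O.fn g = O.fn f * O.monomial q k :=
        O.monomialOn_fn_mul _ k f
      let m : FX q n := (⟨O.monomial q k, monomial_mem q hk⟩ : FuncX q n)
      refine ⟨m * fnX q g, hg, ?_⟩
      have : (Submodule.Quotient.mk (m * fnX q g) : W q p) = g p • monomialVec q p ⟨k, hk⟩ := by
        have h1 : (Submodule.Quotient.mk (m * fnX q g) : W q p) = m • (fnX q g • cyc q p) := by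
          rw [cyc, ← Submodule.Quotient.mk_smul, ← Submodule.Quotient.mk_smul]
          simp
        rw [h1, fnX_smul_cyc, smul_comm, cyc, ← Submodule.Quotient.mk_smul, smul_eq_mul,
          mul_one]
        rfl
      rw [this]
      exact Submodule.smul_mem _ _ (Submodule.subset_span ⟨_, rfl⟩)
    · exact ⟨0, map_zero _, zero_mem _⟩
    · rintro x y - - ⟨a, rfl, ha⟩ ⟨b, rfl, hb⟩
      exact ⟨a + b, map_add _ _ _, add_mem ha hb⟩
    · rintro t x - ⟨a, rfl, ha⟩
      exact ⟨t • a, map_smul _ _ _, Submodule.smul_mem _ t ha⟩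
  intro w _
  obtain ⟨a, rfl⟩ := Submodule.Quotient.mk_surjective _ w
  obtain ⟨b, hb, h⟩ := key _ (O.mem_degreeSpan_zero (a := FX.incl q n a) a.2)
  rwa [FX.incl_injective q n hb] at h

/-- The vectors z^k 1_χ span, and their images are nonzero multiples of distinct lattice vectors, so
they are independent; rescaling normalizes the images. -/
theorem exists_latticeBasis : ∃ b : Module.Basis (rootLattice n) ℂ (W q p),
    ∀ k, toLattice q p (b k) = Finsupp.single k.1 1 := by
  have h : ∀ k : rootLattice n, ∃ s : ℂ, s ≠ 0 ∧
      toLattice q p (monomialVec q p k) = Finsupp.single k.1 s :=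
    fun k => latticeRep_monomial q p k.1
  choose s hs e using h
  have hv : ∀ k, toLattice q p ((s k)⁻¹ • monomialVec q p k) = Finsupp.single k.1 1 := fun k => by
    rw [map_smul, e, Finsupp.smul_single, smul_eq_mul, inv_mul_cancel₀ (hs k)]
  have hli : LinearIndependent ℂ fun k => (s k)⁻¹ • monomialVec q p k := by
    refine LinearIndependent.of_comp (toLattice q p) ?_
    have : (toLattice q p ∘ fun k => (s k)⁻¹ • monomialVec q p k) =
        (fun k : Idx n => Finsupp.single k (1 : ℂ)) ∘ Subtype.val := funext hv
    rw [this]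
    exact (Finsupp.linearIndependent_single_one ℂ (Idx n)).comp _ Subtype.val_injective
  refine ⟨Module.Basis.mk hli ?_, fun k => by rw [Module.Basis.mk_apply, hv]⟩
  refine (span_monomialVec q p).trans (Submodule.span_le.mpr ?_)
  rintro _ ⟨k, rfl⟩
  have : monomialVec q p k = s k • ((s k)⁻¹ • monomialVec q p k) := by
    rw [smul_smul, mul_inv_cancel₀ (hs k), one_smul]
  rw [this]
  exact Submodule.smul_mem _ _ (Submodule.subset_span ⟨k, rfl⟩)

/-- A basis goes to distinct basis vectors. From here on, identities in W are checked by computing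
in the lattice representation. -/
theorem toLattice_injective : Function.Injective (toLattice q p) := by
  obtain ⟨b, hb⟩ := exists_latticeBasis q p
  have h : toLattice q p ∘ₗ b.repr.symm.toLinearMap = Finsupp.lmapDomain ℂ ℂ Subtype.val := by
    refine Finsupp.lhom_ext' fun k => LinearMap.ext_ring ?_
    simp [hb, Finsupp.mapDomain_single]
  have h1 : ∀ x, toLattice q p (b.repr.symm x) = Finsupp.mapDomain Subtype.val x := fun x =>
    congrArg (fun f => f x) h
  intro x y hxy
  rw [← b.repr.symm_apply_apply x, ← b.repr.symm_apply_apply y, h1, h1] at hxy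
  exact b.repr.injective (Finsupp.mapDomain_injective Subtype.val_injective hxy)

end induced

/-! ### Modules with a basis of weight vectors -/

/-- A module of `Func(X)_q` with a basis of weight vectors `v k`, `k ∈ S`, on which the root vectors
act as in the induced module, and which is generated by `v 0` over `U_q sl(n+1)`. -/
structure IsWeightBasis (q : Par) {n : ℕ} (p : Dom n) {M : Type} [AddCommGroup M] [Module ℂ M]
    [Module (FX q n) M] (S : Set (Idx n)) (v : Idx n → M) : Prop where
  linearIndependent : LinearIndependent ℂ fun k : S => v k
  span : ⊤ ≤ Submodule.span ℂ (Set.range fun k : S => v k)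
  vanish : ∀ k, k ∉ S → v k = 0
  zero_mem : (0 : Idx n) ∈ S
  fn_smul : ∀ (f : Dom n → ℂ) (k : Idx n), fnX q f • v k = f (orbitPt q p k) • v k
  raise_smul : ∀ (i : Fin n) (k : Idx n),
    J q n (U.E i) • v k = (raiseCoef q p i k : ℂ) • v (k + root i)
  lower_smul : ∀ (i : Fin n) (k : Idx n),
    J q n (q.c • (U.Kinv i * U.F i)) • v (k + root i) = (lowerCoef q p i k : ℂ) • v k
  cyclic : ∀ N : Submodule ℂ M, v 0 ∈ N → (∀ a, ∀ w ∈ N, J q n a • w ∈ N) → N = ⊤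

/-! ### Reaching the whole root lattice by neighbouring moves -/

section moves
variable (q : Par) {n : ℕ} (p : Dom n) {T : Set (Idx n)}

/-- The set `T` is stable under the move `k ↦ k + δ_a - δ_b` whenever `z_a ẑ_b` does not vanish. -/
def StableMove (T : Set (Idx n)) (a b : Fin (n + 1)) : Prop :=
  ∀ k ∈ T, up q p a (k a) ≠ 0 → down q p b (k b) ≠ 0 → k + (Pi.single a 1 - Pi.single b 1) ∈ T

/-- The move through b can be made in two orders. Apart from the factors at a and d, one order needs
the gap of b at k_b to be nonzero, the other the gap at k_b + 1. They do not both vanish. -/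
theorem StableMove.trans {a b d : Fin (n + 1)} (hab : a ≠ b) (hbd : b ≠ d) (had : a ≠ d)
    (h1 : StableMove q p T a b) (h2 : StableMove q p T b d) : StableMove q p T a d := by
  intro k hk ha hd
  rcases gap_ne_zero_or (q := q) p b (k b) with h | h
  · rw [← up_mul_down] at h
    have h3 := h1 k hk ha (right_ne_zero_of_mul h)
    have h4 := h2 _ h3 (by
      simpa [Pi.single_eq_of_ne hab.symm, ← sub_eq_add_neg] using left_ne_zero_of_mul h) (by
      simpa [Pi.single_eq_of_ne had.symm, Pi.single_eq_of_ne hbd.symm] using hd)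
    convert h4 using 1
    abel
  · rw [← up_mul_down'] at h
    have h3 := h2 k hk (left_ne_zero_of_mul h) hd
    have h4 := h1 _ h3 (by
      simpa [Pi.single_eq_of_ne had, Pi.single_eq_of_ne hab] using ha) (by
      simpa [Pi.single_eq_of_ne hbd] using right_ne_zero_of_mul h)
    convert h4 using 1
    abel

/-- Induction on the distance between a and b, inserting the neighbour of the larger index as
intermediate index. -/
theorem stableMove_of_adjacent (h : ∀ i : Fin n, StableMove q p T i.castSucc i.succ ∧
    StableMove q p T i.succ i.castSucc) {a b : Fin (n + 1)} (hab : a ≠ b) :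
    StableMove q p T a b := by
  have key : ∀ (m : ℕ) (a b : Fin (n + 1)), a.1 + m + 1 = b.1 →
      StableMove q p T a b ∧ StableMove q p T b a := by
    intro m
    induction m with
    | zero =>
      intro a b hab
      have := h ⟨a.1, by omega⟩
      have e1 : (⟨a.1, by omega⟩ : Fin n).castSucc = a := rfl
      have e2 : (⟨a.1, by omega⟩ : Fin n).succ = b := Fin.ext hab
      rwa [e1, e2] at this
    | succ m ih =>
      intro a b hab
      let c : Fin (n + 1) := ⟨a.1 + m + 1, by omega⟩
      have hac := ih a c rfl
      have hcb := h ⟨c.1, by simp only [c]; omega⟩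
      have e1 : (⟨c.1, by simp only [c]; omega⟩ : Fin n).castSucc = c := rfl
      have e2 : (⟨c.1, by simp only [c]; omega⟩ : Fin n).succ = b := Fin.ext (by simp [c]; omega)
      rw [e1, e2] at hcb
      have n1 : a ≠ c := by simp only [ne_eq, Fin.ext_iff, c]; omega
      have n2 : c ≠ b := by simp only [ne_eq, Fin.ext_iff, c]; omega
      have n3 : a ≠ b := by simp only [ne_eq, Fin.ext_iff]; omega
      exact ⟨hac.1.trans q p n1 n2 n3 hcb.1, hcb.2.trans q p n2.symm n1.symm n3.symm hac.2⟩
  have hab' : a.1 ≠ b.1 := fun e => hab (Fin.ext e)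
  rcases lt_or_gt_of_ne hab' with h1 | h1
  · exact (key (b.1 - a.1 - 1) a b (by omega)).1
  · exact (key (a.1 - b.1 - 1) b a (by omega)).2

/-- Induction on the sum of |k_i|: a nonzero k of sum 0 has a positive entry a and a negative entry
b, and it is reached from a shorter vector by the move at a and b. -/
theorem rootLattice_subset (h0 : (0 : Idx n) ∈ T)
    (h : ∀ a b : Fin (n + 1), a ≠ b → StableMove q p T a b) : rootLattice n ⊆ T := by
  have key : ∀ (m : ℕ) (k : Idx n), ∑ i, k i = 0 → ∑ i, (k i).natAbs = m → k ∈ T := by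
    intro m
    induction m using Nat.strong_induction_on with
    | _ m ih =>
      intro k hk hm
      by_cases hz : ∃ i ∈ Finset.univ, k i ≠ 0
      · obtain ⟨a, -, ha⟩ := Finset.exists_pos_of_sum_zero_of_exists_nonzero k hk hz
        obtain ⟨b, -, hb⟩ := Finset.exists_pos_of_sum_zero_of_exists_nonzero (fun i => -k i)
          (by rw [Finset.sum_neg_distrib, hk, neg_zero])
          (by obtain ⟨i, h1, h2⟩ := hz; exact ⟨i, h1, neg_ne_zero.mpr h2⟩)
        have hab : a ≠ b := by rintro rfl; simp at hb; omega
        have e1 : (k - (Pi.single a 1 - Pi.single b 1) : Idx n) a = k a - 1 := by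
          simp [Pi.single_eq_of_ne hab]
        have e2 : (k - (Pi.single a 1 - Pi.single b 1) : Idx n) b = k b + 1 := by
          simp [Pi.single_eq_of_ne hab.symm]
        have e3 : ∀ i, i ≠ a → i ≠ b → (k - (Pi.single a 1 - Pi.single b 1) : Idx n) i = k i :=
          fun i h1 h2 => by simp [Pi.single_eq_of_ne h1, Pi.single_eq_of_ne h2]
        have hl := ih (∑ i, ((k - (Pi.single a 1 - Pi.single b 1) : Idx n) i).natAbs) (by
            rw [← hm]
            refine Finset.sum_lt_sum (fun i _ => ?_) ⟨a, Finset.mem_univ a, by rw [e1]; omega⟩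
            by_cases h1 : i = a
            · rw [h1, e1]; omega
            by_cases h2 : i = b
            · rw [h2, e2]; omega
            rw [e3 i h1 h2]) (k - (Pi.single a 1 - Pi.single b 1) : Idx n) (by
              simp [Finset.sum_sub_distrib, hk]) rfl
        -- In the shorter vector the entry at a is still nonnegative and the one at b still
        -- nonpositive, so this move goes outwards and its coefficients do not vanish.
        have := h a b hab _ hl (up_ne_zero p a (by rw [e1]; omega))
          (down_ne_zero p b (by rw [e2]; omega))
        rwa [sub_add_cancel] at this
      · push Not at hz
        have : k = 0 := funext fun i => hz i (Finset.mem_univ i)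
        rw [this]
        exact h0
  exact fun k hk => key _ k hk rfl

end moves

/-! ### The weight basis of the induced module -/

section induced
variable (q : Par) {n : ℕ} (p : Dom n)

/-- The weight vectors of the induced module; zero outside of the lattice of its weights. -/
noncomputable def weightVec (k : Idx n) : W q p :=
  open Classical in
  if h : k ∈ rootLattice n then (exists_latticeBasis q p).choose ⟨k, h⟩ else 0

variable {k : Idx n}

theorem weightVec_eq (k : rootLattice n) :
    weightVec q p k = (exists_latticeBasis q p).choose k := by
  rw [weightVec, dif_pos k.2]

theorem weightVec_of_notMem (h : k ∉ rootLattice n) : weightVec q p k = 0 := by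
  rw [weightVec, dif_neg h]

theorem toLattice_weightVec (h : k ∈ rootLattice n) :
    toLattice q p (weightVec q p k) = Finsupp.single k 1 := by
  rw [weightVec, dif_pos h]
  exact (exists_latticeBasis q p).choose_spec _

theorem zero_mem_rootLattice : (0 : Idx n) ∈ rootLattice n := by simp [rootLattice]

theorem add_root_mem_iff (i : Fin n) : k + root i ∈ rootLattice n ↔ k ∈ rootLattice n := by
  simp only [rootLattice, Set.mem_ofPred_eq, sum_add_root]

theorem weightVec_zero : weightVec q p 0 = cyc q p := by
  apply toLattice_injective q p
  rw [toLattice_cyc, toLattice_weightVec q p zero_mem_rootLattice]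

theorem linearIndependent_weightVec :
    LinearIndependent ℂ fun k : rootLattice n => weightVec q p k := by
  simp only [weightVec_eq]
  exact (exists_latticeBasis q p).choose.linearIndependent

theorem span_weightVec :
    ⊤ ≤ Submodule.span ℂ (Set.range fun k : rootLattice n => weightVec q p k) := by
  simp only [weightVec_eq]
  exact (exists_latticeBasis q p).choose.span_eq.ge

theorem fnX_smul_weightVec (f : Dom n → ℂ) (k : Idx n) :
    fnX q f • weightVec q p k = f (orbitPt q p k) • weightVec q p k := by
  by_cases h : k ∈ rootLattice n
  · apply toLattice_injective q p
    rw [toLattice_smul, map_smul, toLattice_weightVec q p h, incl_fnX, latticeRep_fn,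
      Finsupp.smul_single, smul_eq_mul, mul_comm]
  · rw [weightVec_of_notMem q p h, smul_zero, smul_zero]

theorem E_smul_weightVec (i : Fin n) (k : Idx n) :
    J q n (U.E i) • weightVec q p k = (raiseCoef q p i k : ℂ) • weightVec q p (k + root i) := by
  by_cases h : k ∈ rootLattice n
  · apply toLattice_injective q p
    rw [toLattice_smul, map_smul, toLattice_weightVec q p h,
      toLattice_weightVec q p ((add_root_mem_iff i).mpr h), incl_J_E, latticeRep_JE,
      Finsupp.smul_single, smul_eq_mul, mul_comm]
  · rw [weightVec_of_notMem q p h, weightVec_of_notMem q p (mt (add_root_mem_iff i).mp h),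
      smul_zero, smul_zero]

theorem F_smul_weightVec (i : Fin n) (k : Idx n) :
    J q n (q.c • (U.Kinv i * U.F i)) • weightVec q p (k + root i) =
      (lowerCoef q p i k : ℂ) • weightVec q p k := by
  by_cases h : k ∈ rootLattice n
  · apply toLattice_injective q p
    rw [toLattice_smul, incl_J_F, toLattice_weightVec q p ((add_root_mem_iff i).mpr h),
      latticeRep_JF, map_smul, toLattice_weightVec q p h, Finsupp.smul_single, smul_eq_mul,
      mul_comm]
  · rw [weightVec_of_notMem q p h, weightVec_of_notMem q p (mt (add_root_mem_iff i).mp h),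
      smul_zero, smul_zero]

/-- The weights of the vectors in N are stable under neighbouring moves with nonzero coefficients,
because E_i and q K_i⁻¹ F_i perform them. By the preceding combinatorics these weights exhaust the
root lattice. -/
theorem eq_top_of_cyc_mem (N : Submodule ℂ (W q p)) (h0 : weightVec q p 0 ∈ N)
    (hN : ∀ a, ∀ w ∈ N, J q n a • w ∈ N) : N = ⊤ := by
  have hsub : rootLattice n ⊆ {k | weightVec q p k ∈ N} := by
    refine rootLattice_subset q p h0 fun a b hab => stableMove_of_adjacent q p (fun i => ?_) hab
    refine ⟨fun k hk h1 h2 => ?_, fun k hk h1 h2 => ?_⟩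
    · have h3 := hN (U.E i) _ hk
      rw [E_smul_weightVec] at h3
      refine (Submodule.smul_mem_iff _ ?_).mp h3
      exact_mod_cast mul_ne_zero (rootFactor_ne_zero q p i k) (mul_ne_zero h1 h2)
    · have e : k + (Pi.single i.succ 1 - Pi.single i.castSucc 1) = k - root i := by
        rw [root]; abel
      have h3 := hN (q.c • (U.Kinv i * U.F i)) _ hk
      have h4 := F_smul_weightVec q p i (k - root i)
      rw [sub_add_cancel] at h4
      rw [h4] at h3
      rw [e]
      refine (Submodule.smul_mem_iff _ ?_).mp h3
      have h5 : lowerCoef q p i (k - root i) ≠ 0 := by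
        refine mul_ne_zero (rootFactor_ne_zero q p i _) (mul_ne_zero ?_ ?_)
        · simpa [root_castSucc] using h2
        · simpa [root_succ] using h1
      exact_mod_cast h5
  refine top_le_iff.mp ((span_weightVec q p).trans (Submodule.span_le.mpr ?_))
  rintro _ ⟨k, rfl⟩
  exact hsub k.2

/-- The weight vectors of the induced module. -/
theorem isWeightBasis_W : IsWeightBasis q p (rootLattice n) (weightVec q p) where
  linearIndependent := linearIndependent_weightVec q p
  span := span_weightVec q p
  vanish _ := weightVec_of_notMem q p
  zero_mem := zero_mem_rootLattice
  fn_smul := fnX_smul_weightVec q p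
  raise_smul := E_smul_weightVec q p
  lower_smul := F_smul_weightVec q p
  cyclic := eq_top_of_cyc_mem q p

/-! ### The truncated module -/

/-- The function that is `1` at the point with exponents `k` and `0` elsewhere. -/
noncomputable def pointFn (k : Idx n) : Dom n → ℂ :=
  open Classical in fun x => if x = orbitPt q p k then 1 else 0

theorem latticeRep_pointFn (k : Idx n) (x : Idx n →₀ ℂ) :
    latticeRep q p (O.fn (pointFn q p k)) x = Finsupp.single k (x k) := by
  have : latticeRep q p (O.fn (pointFn q p k)) = (Finsupp.lsingle k).comp (Finsupp.lapply k) := by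
    refine Finsupp.lhom_ext fun l t => ?_
    rw [latticeRep_fn]
    by_cases h : l = k
    · subst h; simp [pointFn]
    · have : orbitPt q p l ≠ orbitPt q p k := fun e => h (orbitPt_injective p e)
      simp [pointFn, this, h]
  rw [this]
  rfl

theorem toLattice_apply_of_notMem (h : k ∉ rootLattice n) (w : W q p) : toLattice q p w k = 0 := by
  have hw : w ∈ Submodule.span ℂ (Set.range fun k : rootLattice n => weightVec q p k) :=
    span_weightVec q p trivial
  refine Submodule.span_induction (p := fun w _ => toLattice q p w k = 0) ?_ (by simp)
    (fun x y _ _ hx hy => by simp [hx, hy]) (fun t x _ hx => by simp [hx]) hw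
  rintro _ ⟨l, rfl⟩
  change toLattice q p (weightVec q p l) k = 0
  rw [toLattice_weightVec q p l.2, Finsupp.single_eq_of_ne]
  rintro rfl
  exact h l.2

/-- Arbitrary functions of x are available, so the projection to a single weight space lies in
Func(X)_q. -/
theorem pointFn_smul (k : Idx n) (w : W q p) :
    fnX q (pointFn q p k) • w = toLattice q p w k • weightVec q p k := by
  apply toLattice_injective q p
  rw [toLattice_smul, incl_fnX, latticeRep_pointFn, map_smul]
  by_cases h : k ∈ rootLattice n
  · rw [toLattice_weightVec q p h, Finsupp.smul_single, smul_eq_mul, mul_one]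
  · rw [toLattice_apply_of_notMem q p h, zero_smul, Finsupp.single_zero]

/-- A submodule contains the weight components of each of its elements. -/
theorem toLattice_apply_eq_zero {N : Submodule (FX q n) (W q p)} (hk : weightVec q p k ∉ N)
    {w : W q p} (hw : w ∈ N) : toLattice q p w k = 0 := by
  by_contra h
  have h1 := N.smul_mem (fnX q (pointFn q p k)) hw
  rw [pointFn_smul] at h1
  exact hk (((N.restrictScalars ℂ).smul_mem_iff h).mp h1)

theorem cyc_notMem_radW : cyc q p ∉ radW q p := by
  -- This one submodule, of the vectors whose whole orbit has zero component at weight 0, contains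
  -- every submodule without 1_χ and does not contain 1_χ itself.
  let B : Submodule (FX q n) (W q p) :=
    { carrier := {w | ∀ a : FX q n, toLattice q p (a • w) 0 = 0}
      add_mem' := fun {x y} hx hy a => by
        rw [smul_add, map_add, Finsupp.add_apply, hx a, hy a, add_zero]
      zero_mem' := fun a => by simp
      smul_mem' := fun b x hx a => by rw [smul_smul]; exact hx (a * b) }
  have hB : radW q p ≤ B := sSup_le fun N hN w hw a =>
    toLattice_apply_eq_zero q p (by rw [weightVec_zero]; exact hN) (N.smul_mem a hw)
  intro h
  have := hB h 1
  rw [one_smul, toLattice_cyc] at this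
  simp at this

/-- The exponents of the weights of the truncated module. -/
def truncatedLattice : Set (Idx n) := {k | weightVec q p k ∉ radW q p}

/-- The weight vectors of the truncated module. -/
noncomputable def truncatedVec (k : Idx n) : Wtr q p := Submodule.Quotient.mk (weightVec q p k)

theorem truncatedLattice_subset : truncatedLattice q p ⊆ rootLattice n := by
  intro k hk
  by_contra h
  exact hk (by rw [weightVec_of_notMem q p h]; exact zero_mem _)

theorem truncatedVec_of_notMem (h : k ∉ truncatedLattice q p) : truncatedVec q p k = 0 :=
  (Submodule.Quotient.mk_eq_zero _).mpr (not_not.mp h)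

theorem smul_truncatedVec {a : FX q n} {k l : Idx n} {t : ℂ}
    (h : a • weightVec q p k = t • weightVec q p l) :
    a • truncatedVec q p k = t • truncatedVec q p l := by
  rw [truncatedVec, truncatedVec, ← Submodule.Quotient.mk_smul, ← Submodule.Quotient.mk_smul, h]

/-- A linear relation lifts to an element of the radical, and such an element has zero components at
all surviving weights. -/
theorem linearIndependent_truncatedVec :
    LinearIndependent ℂ fun k : truncatedLattice q p => truncatedVec q p k := by
  rw [linearIndependent_iff']
  intro s g hg k hk
  have h1 : ∑ l ∈ s, g l • weightVec q p l ∈ radW q p := by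
    rw [← Submodule.Quotient.mk_eq_zero]
    refine Eq.trans ?_ hg
    have := map_sum ((radW q p).mkQ.restrictScalars ℂ) (fun l => g l • weightVec q p l) s
    refine Eq.trans this ?_
    exact Finset.sum_congr rfl fun l _ => rfl
  have h2 := toLattice_apply_eq_zero q p k.2 h1
  rw [map_sum, Finsupp.finsetSum_apply, Finset.sum_eq_single k] at h2
  · rwa [map_smul, toLattice_weightVec q p (truncatedLattice_subset q p k.2), Finsupp.smul_apply,
      Finsupp.single_eq_same, smul_eq_mul, mul_one] at h2
  · intro l _ hl
    rw [map_smul, toLattice_weightVec q p (truncatedLattice_subset q p l.2), Finsupp.smul_apply,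
      Finsupp.single_eq_of_ne (fun e => hl (Subtype.ext e.symm)), smul_zero]
  · exact fun h => absurd hk h

theorem span_truncatedVec :
    ⊤ ≤ Submodule.span ℂ (Set.range fun k : truncatedLattice q p => truncatedVec q p k) := by
  intro x _
  obtain ⟨w, rfl⟩ := Submodule.Quotient.mk_surjective _ x
  have hw : w ∈ Submodule.span ℂ (Set.range fun k : rootLattice n => weightVec q p k) :=
    span_weightVec q p trivial
  have : Submodule.span ℂ (Set.range fun k : rootLattice n => weightVec q p k) ≤
      (Submodule.span ℂ (Set.range fun k : truncatedLattice q p => truncatedVec q p k)).comap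
        ((radW q p).mkQ.restrictScalars ℂ) := by
    refine Submodule.span_le.mpr ?_
    rintro _ ⟨k, rfl⟩
    change truncatedVec q p k ∈ Submodule.span ℂ _
    by_cases h : k.1 ∈ truncatedLattice q p
    · exact Submodule.subset_span ⟨⟨k, h⟩, rfl⟩
    · rw [truncatedVec_of_notMem q p h]; exact zero_mem _
  exact this hw

/-- The weight vectors of the truncated module. -/
theorem isWeightBasis_Wtr : IsWeightBasis q p (truncatedLattice q p) (truncatedVec q p) where
  linearIndependent := linearIndependent_truncatedVec q p
  span := span_truncatedVec q p
  vanish _ := truncatedVec_of_notMem q p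
  zero_mem := by
    rw [truncatedLattice, Set.mem_ofPred_eq, weightVec_zero]
    exact cyc_notMem_radW q p
  fn_smul f k := smul_truncatedVec q p (fnX_smul_weightVec q p f k)
  raise_smul i k := smul_truncatedVec q p (E_smul_weightVec q p i k)
  lower_smul i k := smul_truncatedVec q p (F_smul_weightVec q p i k)
  cyclic N h0 hN := by
    have h := eq_top_of_cyc_mem q p (N.comap ((radW q p).mkQ.restrictScalars ℂ)) h0
      fun a w hw => hN a _ hw
    refine eq_top_iff.mpr fun x _ => ?_
    obtain ⟨w, rfl⟩ := Submodule.Quotient.mk_surjective _ x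
    have : w ∈ N.comap ((radW q p).mkQ.restrictScalars ℂ) := by rw [h]; trivial
    exact this

/-! ### The walls of the truncated module -/

/-- The generators move basis vectors to multiples of basis vectors, so only nonvanishing moves have
to be checked. -/
theorem latticeRep_mem_supported {P : Set (Idx n)}
    (hup : ∀ i, ∀ l ∈ P, up q p i (l i) ≠ 0 → l + Pi.single i 1 ∈ P)
    (hdown : ∀ i, ∀ l ∈ P, down q p i (l i) ≠ 0 → l - Pi.single i 1 ∈ P) (a : O q n) :
    ∀ x ∈ Finsupp.supported ℂ ℂ P, latticeRep q p a x ∈ Finsupp.supported ℂ ℂ P := by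
  obtain ⟨a, rfl⟩ := RingQuot.mkAlgHom_surjective ℂ (ORel q n) a
  induction a using FreeAlgebra.induction with
  | grade0 t =>
    intro x hx
    rw [AlgHom.commutes, AlgHom.commutes, Module.algebraMap_end_apply]
    exact Submodule.smul_mem _ t hx
  | grade1 g =>
    intro x hx
    have hx' := hx
    rw [Finsupp.supported_eq_span_single] at hx'
    refine Submodule.span_induction (p := fun x _ => latticeRep q p (O.gen g) x ∈
      Finsupp.supported ℂ ℂ P) ?_ (by simp) (fun x y _ _ hx hy => by
        rw [map_add]; exact add_mem hx hy) (fun t x _ hx => by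
        rw [map_smul]; exact Submodule.smul_mem _ t hx) hx'
    rintro _ ⟨l, hl, rfl⟩
    cases g with
    | z i =>
      change latticeRep q p (O.z i) (Finsupp.single l 1) ∈ _
      rw [latticeRep_z]
      by_cases h : up q p i (l i) = 0
      · simp [upCoef, h]
      · exact Finsupp.single_mem_supported ℂ _ (hup i l hl h)
    | zh i =>
      change latticeRep q p (O.zh i) (Finsupp.single l 1) ∈ _
      rw [latticeRep_zh]
      by_cases h : down q p i (l i) = 0
      · simp [downCoef, h]
      · exact Finsupp.single_mem_supported ℂ _ (hdown i l hl h)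
    | fn f =>
      change latticeRep q p (O.fn f) (Finsupp.single l 1) ∈ _
      rw [latticeRep_fn]
      exact Finsupp.single_mem_supported ℂ _ hl
  | mul a b ha hb =>
    intro x hx
    rw [map_mul, map_mul, Module.End.mul_apply]
    exact ha _ (hb _ hx)
  | add a b ha hb =>
    intro x hx
    rw [map_add, map_add, LinearMap.add_apply]
    exact add_mem (ha _ hx) (hb _ hx)

/-- The vectors of W supported on P form a submodule, and it misses 1_χ because 0 is not in P. -/
theorem weightVec_mem_radW {P : Set (Idx n)} (hk : k ∈ P) (h0 : (0 : Idx n) ∉ P)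
    (hup : ∀ i, ∀ l ∈ P, up q p i (l i) ≠ 0 → l + Pi.single i 1 ∈ P)
    (hdown : ∀ i, ∀ l ∈ P, down q p i (l i) ≠ 0 → l - Pi.single i 1 ∈ P) :
    weightVec q p k ∈ radW q p := by
  let N : Submodule (FX q n) (W q p) :=
    { carrier := {w | toLattice q p w ∈ Finsupp.supported ℂ ℂ P}
      add_mem' := fun {x y} hx hy => by
        rw [Set.mem_ofPred_eq, map_add]; exact add_mem hx hy
      zero_mem' := by rw [Set.mem_ofPred_eq, map_zero]; exact zero_mem _
      smul_mem' := fun b x hx => by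
        rw [Set.mem_ofPred_eq, toLattice_smul]
        exact latticeRep_mem_supported q p hup hdown _ _ hx }
  have hN : cyc q p ∉ N := by
    intro h
    have h1 : Finsupp.single (0 : Idx n) (1 : ℂ) ∈ Finsupp.supported ℂ ℂ P := by
      rw [← toLattice_cyc q p]; exact h
    rw [Finsupp.mem_supported] at h1
    exact h0 (h1 (by simp))
  refine (le_sSup (show N ∈ {N | cyc q p ∉ N} from hN) : N ≤ radW q p) ?_
  change toLattice q p _ ∈ Finsupp.supported ℂ ℂ P
  by_cases h : k ∈ rootLattice n
  · rw [toLattice_weightVec q p h]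
    exact Finsupp.single_mem_supported ℂ _ hk
  · rw [weightVec_of_notMem q p h, map_zero]
    exact zero_mem _

/-- A zero of the coefficient of ẑ_i is a wall: the half-space of exponents l_i ≥ k_i cannot be
left. It does not contain 0, since k_i > 0, so its weight vectors die in the truncation. -/
theorem down_ne_zero_of_mem (hk : k ∈ truncatedLattice q p) (i : Fin (n + 1)) :
    down q p i (k i) ≠ 0 := by
  intro h
  have hpos : 0 < k i := by
    by_contra h'
    exact down_ne_zero p i (not_lt.mp h') h
  refine hk (weightVec_mem_radW q p (P := {l | k i ≤ l i}) (by simp)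
    (by simp only [Set.mem_ofPred_eq, Pi.zero_apply]; omega) ?_ ?_)
  · intro j l hl _
    by_cases hj : i = j
    · subst hj
      simp only [Set.mem_ofPred_eq, Pi.add_apply, Pi.single_eq_same] at hl ⊢
      omega
    · simpa [Pi.single_eq_of_ne hj] using hl
  · intro j l hl hd
    by_cases hj : i = j
    · subst hj
      simp only [Set.mem_ofPred_eq, Pi.sub_apply, Pi.single_eq_same] at hl ⊢
      -- On the wall itself the step down has coefficient 0; strictly above it, the step stays in
      -- the half-space.
      have : l i ≠ k i := fun e => hd (e ▸ h)
      omega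
    · simpa [Pi.single_eq_of_ne hj] using hl

theorem up_ne_zero_of_mem (hk : k ∈ truncatedLattice q p) (i : Fin (n + 1)) :
    up q p i (k i) ≠ 0 := by
  intro h
  have hneg : k i < 0 := by
    by_contra h'
    exact up_ne_zero p i (not_lt.mp h') h
  refine hk (weightVec_mem_radW q p (P := {l | l i ≤ k i}) (by simp)
    (by simp only [Set.mem_ofPred_eq, Pi.zero_apply]; omega) ?_ ?_)
  · intro j l hl hd
    by_cases hj : i = j
    · subst hj
      simp only [Set.mem_ofPred_eq, Pi.add_apply, Pi.single_eq_same] at hl ⊢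
      have : l i ≠ k i := fun e => hd (e ▸ h)
      omega
    · simpa [Pi.single_eq_of_ne hj] using hl
  · intro j l hl _
    by_cases hj : i = j
    · subst hj
      simp only [Set.mem_ofPred_eq, Pi.sub_apply, Pi.single_eq_same] at hl ⊢
      omega
    · simpa [Pi.single_eq_of_ne hj] using hl

/-- Within the surviving weights E_i never vanishes by its coefficient, only because its target has
been cut off. This is what makes positivity necessary on every remaining edge. -/
theorem raiseCoef_ne_zero_of_mem (hk : k ∈ truncatedLattice q p) (i : Fin n) :
    raiseCoef q p i k ≠ 0 :=
  mul_ne_zero (rootFactor_ne_zero q p i k)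
    (mul_ne_zero (up_ne_zero_of_mem q p hk _) (down_ne_zero_of_mem q p hk _))

end induced

/-! ### Adjoint operators and reducing subspaces -/

section adjoint
variable {B M H : Type} [Ring B] [Algebra ℂ B] [AddCommGroup M] [Module ℂ M]
  [NormedAddCommGroup H] [InnerProductSpace ℂ H] (j : M →ₗ[ℂ] H) (ρ : B →ₐ[ℂ] Module.End ℂ M)

/-- The elements `a` and `b` act by formally adjoint operators. -/
def IsAdj (a b : B) : Prop := ∀ v w, inner ℂ (j (ρ a v)) (j w) = inner ℂ (j v) (j (ρ b w))

variable {j ρ} {a b a' b' : B}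

theorem IsAdj.symm (h : IsAdj j ρ a b) : IsAdj j ρ b a := fun v w => by
  rw [← inner_conj_symm, ← h, inner_conj_symm]

theorem IsAdj.add (h : IsAdj j ρ a b) (h' : IsAdj j ρ a' b') : IsAdj j ρ (a + a') (b + b') :=
  fun v w => by
    simp only [map_add, LinearMap.add_apply, inner_add_left, inner_add_right, h v w, h' v w]

theorem IsAdj.mul (h : IsAdj j ρ a b) (h' : IsAdj j ρ a' b') : IsAdj j ρ (a * a') (b' * b) :=
  fun v w => by
    simp only [map_mul, Module.End.mul_apply]
    rw [h, h']

theorem IsAdj.smul (h : IsAdj j ρ a b) (t : ℂ) : IsAdj j ρ (t • a) (starRingEnd ℂ t • b) :=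
  fun v w => by
    simp only [map_smul, LinearMap.smul_apply, inner_smul_left, inner_smul_right, h v w]

theorem isAdj_one : IsAdj j ρ 1 1 := fun v w => by simp

theorem isAdj_of_span {s : Set M} (hs : ⊤ ≤ Submodule.span ℂ s)
    (h : ∀ v ∈ s, ∀ w ∈ s, inner ℂ (j (ρ a v)) (j w) = inner ℂ (j v) (j (ρ b w))) :
    IsAdj j ρ a b := by
  intro v w
  have hv : v ∈ Submodule.span ℂ s := hs trivial
  have hw : w ∈ Submodule.span ℂ s := hs trivial
  refine Submodule.span_induction₂ (p := fun v w _ _ => inner ℂ (j (ρ a v)) (j w) =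
    inner ℂ (j v) (j (ρ b w))) (fun v w hv hw => h v hv w hw) (fun _ _ => by simp)
    (fun _ _ => by simp) (fun x y z _ _ _ hx hy => ?_) (fun x y z _ _ _ hx hy => ?_)
    (fun t x y _ _ hx => ?_) (fun t x y _ _ hx => ?_) hv hw
  · simp only [map_add, inner_add_left, hx, hy]
  · simp only [map_add, inner_add_right, hx, hy]
  · simp only [map_smul, inner_smul_left, hx]
  · simp only [map_smul, inner_smul_right, hx]

theorem eq_zero_of_inner_span {s : Set M} (hs : ⊤ ≤ Submodule.span ℂ s) (hd : DenseRange j)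
    {x : H} (h : ∀ w ∈ s, inner ℂ x (j w) = 0) : x = 0 := by
  refine hd.eq_zero_of_inner_left ℂ fun w => ?_
  refine Submodule.span_induction (p := fun w _ => inner ℂ x (j w) = 0) h (by simp)
    (fun x y _ _ hx hy => by rw [map_add, inner_add_right, hx, hy, add_zero])
    (fun t x _ hx => by rw [map_smul, inner_smul_right, hx, mul_zero]) (hs trivial : w ∈ _)

/-- The adjointness identity is a closed condition on pairs, so it passes from the graph to its
closure. -/
theorem inner_of_mem_closedGraph (h : IsAdj j ρ a b) {z : H × H} (hz : z ∈ closedGraph j (ρ a))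
    (w : M) : inner ℂ z.2 (j w) = inner ℂ z.1 (j (ρ b w)) := by
  have hc : IsClosed {z : H × H | inner ℂ z.2 (j w) = inner ℂ z.1 (j (ρ b w))} :=
    isClosed_eq (by fun_prop) (by fun_prop)
  refine closure_minimal ?_ hc hz
  rintro _ ⟨v, rfl⟩
  exact h v w

theorem mem_closedGraph (T : Module.End ℂ M) (v : M) : (j v, j (T v)) ∈ closedGraph j T :=
  Submodule.le_topologicalClosure _ ⟨v, rfl⟩

/-- An operator with a densely defined formal adjoint is closable. -/
theorem eq_zero_of_mem_closedGraph (hd : DenseRange j) (h : IsAdj j ρ a b) {y : H}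
    (hy : (0, y) ∈ closedGraph j (ρ a)) : y = 0 := by
  refine hd.eq_zero_of_inner_left ℂ fun w => ?_
  simpa using inner_of_mem_closedGraph h hy w

variable (j ρ) in
/-- A subspace is trivial if it reduces the closures and its projection multiplies the image of a
cyclic vector by a scalar. -/
theorem eq_bot_or_eq_top_of_reduces {st : B → B} (hd : DenseRange j)
    (hadj : ∀ a, IsAdj j ρ a (st a)) {v₀ : M}
    (hcyc : ∀ N : Submodule ℂ M, v₀ ∈ N → (∀ a, ∀ w ∈ N, ρ a w ∈ N) → N = ⊤)
    (K : Submodule ℂ H) [K.HasOrthogonalProjection]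
    (hK : ∀ a, ∀ y ∈ closedGraph j (ρ a),
      (K.starProjection y.1, K.starProjection y.2) ∈ closedGraph j (ρ a))
    {c : ℂ} (hc : K.starProjection (j v₀) = c • j v₀) : K = ⊥ ∨ K = ⊤ := by
  have hidem : ∀ x, K.starProjection (K.starProjection x) = K.starProjection x := fun x =>
    Submodule.starProjection_eq_self_iff.mpr (K.starProjection_apply_mem x)
  have key : ∀ t : ℂ, K.starProjection (j v₀) = t • j v₀ →
      ∀ x, K.starProjection x = t • x := by
    intro t ht
    -- The vectors that the projection multiplies by t form a stable subspace: for such v, the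
    -- difference of the projected graph point and t times the graph point is (0, y), and
    -- closability gives y = 0.
    let N : Submodule ℂ M := LinearMap.ker ((K.starProjection : H →ₗ[ℂ] H).comp j - t • j)
    have hmem : ∀ v, v ∈ N ↔ K.starProjection (j v) = t • j v := fun v => by
      simp [N, sub_eq_zero]
    have hN : N = ⊤ := by
      refine hcyc N ((hmem _).mpr ht) fun a v hv => ?_
      have h1 := hK a _ (mem_closedGraph (ρ a) v)
      have h2 := (closedGraph j (ρ a)).smul_mem t (mem_closedGraph (ρ a) v)
      have h3 := sub_mem h1 h2
      simp only [Prod.smul_mk, Prod.mk_sub_mk] at h3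
      rw [(hmem v).mp hv, sub_self] at h3
      exact (hmem _).mpr (sub_eq_zero.mp (eq_zero_of_mem_closedGraph hd (hadj a) h3))
    have h4 : (K.starProjection : H → H) = fun x => t • x := by
      refine hd.equalizer (by fun_prop) (by fun_prop) (funext fun v => ?_)
      exact (hmem v).mp (hN ▸ Submodule.mem_top)
    exact fun x => congrFun h4 x
  -- Idempotence of the projection forces c to be 0 or 1, unless the image of the cyclic vector is
  -- 0.
  have hcc : (c * c - c) • j v₀ = 0 := by
    have := hidem (j v₀)
    rw [hc, map_smul, hc, smul_smul] at this
    rw [sub_smul, this, sub_self]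
  have hfin : (∀ x, K.starProjection x = (0 : ℂ) • x) ∨
      (∀ x, K.starProjection x = (1 : ℂ) • x) := by
    rcases smul_eq_zero.mp hcc with h | h
    · have : c * (c - 1) = 0 := by linear_combination h
      rcases mul_eq_zero.mp this with h | h
      · exact Or.inl (key 0 (by rw [hc, h]))
      · exact Or.inr (key 1 (by rw [hc, sub_eq_zero.mp h]))
    · exact Or.inl (key 0 (by rw [h, map_zero, smul_zero]))
  rcases hfin with h | h
  · left
    refine (Submodule.eq_bot_iff K).mpr fun x hx => ?_
    rw [← Submodule.starProjection_eq_self_iff.mpr hx, h, zero_smul]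
  · right
    refine eq_top_iff.mpr fun x _ => ?_
    rw [← Submodule.starProjection_eq_self_iff, h, one_smul]

end adjoint

/-! ### Eigenvalues of the Cartan elements -/

section cartanWeights
variable (q : Par) {n : ℕ} (p : Dom n)

/-- The eigenvalue of `K_i`. -/
noncomputable def cartanWeight (i : Fin n) (k : Idx n) : ℝ :=
  (orbitPt q p k).1 i.castSucc.succ *
    (q.root ((orbitPt q p k).1 i.castSucc.castSucc * (orbitPt q p k).1 i.succ.succ))⁻¹

theorem cartanWeight_eq (i : Fin n) (k : Idx n) :
    (coord i.castSucc.succ * (rt q i)⁻¹) (orbitPt q p k) = (cartanWeight q p i k : ℂ) := by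
  simp only [Pi.mul_apply, Pi.inv_apply, coord, rt, cartanWeight]
  push_cast
  rfl

/-- Squaring removes the choice of the branch of the root and leaves a power of q² that exposes the
difference of neighbouring exponents. -/
theorem cartanWeight_sq (i : Fin n) (k : Idx n) : cartanWeight q p i k ^ 2 =
    (q.1 ^ 2) ^ (k i.succ - k i.castSucc) * cartanWeight q p i 0 ^ 2 := by
  have hq := q.sq_pos.ne'
  have key : ∀ k : Idx n, cartanWeight q p i k ^ 2 =
      (q.1 ^ 2) ^ (k i.succ - k i.castSucc) * (p.1 i.castSucc.succ ^ 2 *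
        (p.1 i.castSucc.castSucc * p.1 i.succ.succ)⁻¹) := by
    intro k
    have h1 := partialSum_succ i.castSucc k
    have h2 := partialSum_succ i.succ k
    have h3 : k i.succ - k i.castSucc = -partialSum (i.1 + 1) k + -partialSum (i.1 + 1) k +
        (partialSum i.1 k + partialSum (i.1 + 1 + 1) k) := by
      simp only [Fin.val_castSucc, Fin.val_succ] at h1 h2
      omega
    rw [cartanWeight, mul_pow, inv_pow, sq (q.root _), q.root_mul_self ((orbitPt q p k).2.2 i), h3]
    simp only [orbitPt, Fin.val_castSucc, Fin.val_succ, zpow_add₀ hq, mul_inv, zpow_neg, inv_inv]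
    ring
  rw [key k, key 0]
  simp

theorem cartanWeight_ne_zero (i : Fin n) (k : Idx n) : cartanWeight q p i k ≠ 0 :=
  mul_ne_zero ((orbitPt q p k).2.1 _) (inv_ne_zero (q.root_ne ((orbitPt q p k).2.2 i)))

/-- The eigenvalues of the Cartan elements separate the weights. -/
theorem exists_cartanWeight_ne {k l : Idx n} (hk : k ∈ rootLattice n) (hl : l ∈ rootLattice n)
    (hkl : k ≠ l) : ∃ i, cartanWeight q p i k ≠ cartanWeight q p i l := by
  by_contra! h
  have h1 : ∀ i : Fin n, k i.succ - l i.succ = k i.castSucc - l i.castSucc := fun i => by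
    have h2 := congrArg (· ^ 2) (h i)
    simp only [cartanWeight_sq q p i k, cartanWeight_sq q p i l] at h2
    have h3 := q.zpow_sq_injective
      (mul_right_cancel₀ (pow_ne_zero 2 (cartanWeight_ne_zero q p i 0)) h2)
    omega
  -- All entries of k - l agree with the first one; as their sum is 0, they vanish.
  have h2 : ∀ i : Fin (n + 1), k i - l i = k 0 - l 0 := fun i => by
    induction i using Fin.induction with
    | zero => rfl
    | succ i ih => rw [h1, ih]
  have h3 : ∑ i, (k i - l i) = 0 := by
    rw [Finset.sum_sub_distrib, hk, hl, sub_zero]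
  simp only [h2, Finset.sum_const, Finset.card_univ, Fintype.card_fin, nsmul_eq_mul,
    mul_eq_zero] at h3
  have h4 : k 0 - l 0 = 0 := by
    rcases h3 with h3 | h3
    · exact absurd h3 (by positivity)
    · exact h3
  exact hkl (funext fun i => by have := h2 i; omega)

end cartanWeights

/-! ### The action of the generators -/

section action
variable (q : Par) {n : ℕ} (M : Type) [AddCommGroup M] [Module ℂ M] [Module (FX q n) M]
  [IsScalarTower ℂ (FX q n) M]

/-- The representation `π ∘ J`. -/
noncomputable abbrev momentRep : U q n →ₐ[ℂ] Module.End ℂ M := rep q M AlgEquiv.refl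

theorem momentRep_apply (a : U q n) (v : M) : momentRep q M a v = J q n a • v := rfl

variable {M}

/-- An automorphism that commutes with the involution only permutes the operators, and all
conditions are quantified over every element of the algebra. -/
theorem isIrredStarRep_rep_iff {st : U q n → U q n} {I : U q n ≃ₐ[ℂ] U q n}
    (hI : ∀ a, I (st a) = st (I a)) :
    IsIrredStarRep st (rep q M I) ↔ IsIrredStarRep st (momentRep q M) := by
  constructor
  · rintro ⟨H, i1, i2, i3, j, h1, h2, h3, h4, h5, h6⟩
    refine ⟨H, i1, i2, i3, j, h1, h2, h3, fun a => ?_, fun a => ?_, fun K _ hK => ?_⟩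
    · obtain ⟨a, rfl⟩ := I.surjective a
      rw [← hI]
      exact h4 a
    · obtain ⟨a, rfl⟩ := I.surjective a
      exact h5 a
    · exact h6 K fun a => hK (I a)
  · rintro ⟨H, i1, i2, i3, j, h1, h2, h3, h4, h5, h6⟩
    refine ⟨H, i1, i2, i3, j, h1, h2, h3, fun a => ?_, fun a => h5 (I a), fun K _ hK => ?_⟩
    · have := h4 (I a)
      rw [← hI] at this
      exact this
    · refine h6 K fun a => ?_
      obtain ⟨a, rfl⟩ := I.surjective a
      exact hK a

variable {H : Type} [NormedAddCommGroup H] [InnerProductSpace ℂ H] {j : M →ₗ[ℂ] H}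
  (ι : Fin (n + 1) → ℤˣ)

/-- The element `q K_i⁻¹ F_i`. -/
noncomputable def lowerElt (i : Fin n) : U q n := q.c • (U.Kinv i * U.F i)

theorem natStar_E (i : Fin n) :
    U.natStar ι (U.E i : U q n) = (U.sgn ι i : ℂ) • lowerElt q i := by
  rw [U.star_E, lowerElt, smul_smul]

/-- The action is a `*`-representation if the generators `E_i`, `K_i`, `K_i⁻¹` act correctly. -/
theorem isAdj_natStar
    (hE : ∀ i : Fin n, IsAdj j (momentRep q M) (U.E i) ((U.sgn ι i : ℂ) • lowerElt q i))
    (hK : ∀ i : Fin n, IsAdj j (momentRep q M) (U.K i) (U.K i))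
    (hKinv : ∀ i : Fin n, IsAdj j (momentRep q M) (U.Kinv i) (U.Kinv i)) (a : U q n) :
    IsAdj j (momentRep q M) a (U.natStar ι a) := by
  have h1 : U.natStar ι (1 : U q n) = 1 := congrArg ConjOp.out (map_one (U.lift (U.sat_real ι)))
  obtain ⟨a, rfl⟩ := RingQuot.mkAlgHom_surjective ℂ (URel q n) a
  induction a using FreeAlgebra.induction with
  | grade0 t =>
    rw [AlgHom.commutes, Algebra.algebraMap_eq_smul_one, U.star_smul, h1]
    exact isAdj_one.smul t
  | grade1 g =>
    cases g with
    | E i =>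
      change IsAdj j _ (U.E i) (U.natStar ι (U.E i))
      rw [natStar_E]
      exact hE i
    | F i =>
      change IsAdj j _ (U.F i) (U.natStar ι (U.F i))
      have hs : (U.sgn ι i : ℂ) * (U.sgn ι i : ℂ) = 1 := by exact_mod_cast U.sgn_mul_self ι i
      -- F_i is q⁻¹ K_i · (q K_i⁻¹ F_i), so its adjoint follows from those of K_i and E_i; the two
      -- copies of the sign cancel.
      have h2 := (((hK i).mul ((hE i).symm.smul (U.sgn ι i : ℂ))).smul q.c⁻¹)
      have e1 : q.c⁻¹ • (U.K i * ((U.sgn ι i : ℂ) • (U.sgn ι i : ℂ) • lowerElt q i)) =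
          (U.F i : U q n) := by
        have h3 := (U.sat (q := q) (n := n)).k_l i
        rw [smul_smul, hs, one_smul, lowerElt, mul_smul_comm, smul_smul, inv_mul_cancel₀ q.c_ne,
          one_smul, ← mul_assoc, h3, one_mul]
      have e2 : starRingEnd ℂ q.c⁻¹ • (starRingEnd ℂ (U.sgn ι i : ℂ) • U.E i * U.K i) =
          U.natStar ι (U.F i : U q n) := by
        rw [U.star_F, map_inv₀, q.conj_c, smul_mul_assoc, smul_smul, mul_comm]
        congr 2
        exact map_intCast _ _
      rw [e1, e2] at h2
      exact h2
    | K i =>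
      change IsAdj j _ (U.K i) (U.natStar ι (U.K i))
      rw [U.star_K]
      exact hK i
    | Kinv i =>
      change IsAdj j _ (U.Kinv i) (U.natStar ι (U.Kinv i))
      rw [U.star_Kinv]
      exact hKinv i
  | mul a b ha hb =>
    rw [map_mul, U.star_mul]
    exact ha.mul hb
  | add a b ha hb =>
    rw [map_add, U.star_add]
    exact ha.add hb

end action

/-! ### Norms of the weight vectors -/

/-- Positive ratios allow the recurrence to run in both directions from the value 1 at 0: products
to the right, inverse products to the left. -/
theorem exists_int_recurrence (ρ : ℤ → ℝ) (hρ : ∀ r, 0 < ρ r) :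
    ∃ C : ℤ → ℝ, (∀ r, 0 < C r) ∧ ∀ r, C (r + 1) = ρ r * C r := by
  refine ⟨fun r => match r with
    | .ofNat m => ∏ i ∈ Finset.range m, ρ i
    | .negSucc m => (∏ i ∈ Finset.range (m + 1), ρ (-(i + 1)))⁻¹, ?_, ?_⟩
  · intro r
    cases r with
    | ofNat m => exact Finset.prod_pos fun i _ => hρ _
    | negSucc m => exact inv_pos.mpr (Finset.prod_pos fun i _ => hρ _)
  · intro r
    cases r with
    | ofNat m =>
      change ∏ i ∈ Finset.range (m + 1), ρ i = ρ m * ∏ i ∈ Finset.range m, ρ i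
      rw [Finset.prod_range_succ, mul_comm]
    | negSucc m =>
      cases m with
      | zero =>
        change ∏ i ∈ Finset.range 0, ρ i = ρ (-1) * (∏ i ∈ Finset.range 1, ρ (-(i + 1)))⁻¹
        simp [(hρ (-1)).ne']
      | succ m =>
        have e : Int.negSucc (m + 1) = -((m + 1 : ℕ) + 1 : ℤ) := by
          rw [Int.negSucc_eq]
        change (∏ i ∈ Finset.range (m + 1), ρ (-(i + 1)))⁻¹ =
          ρ (Int.negSucc (m + 1)) * (∏ i ∈ Finset.range (m + 1 + 1), ρ (-(i + 1)))⁻¹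
        rw [e, Finset.prod_range_succ _ (m + 1), mul_inv,
          mul_comm (∏ i ∈ Finset.range (m + 1), ρ (-(i + 1)))⁻¹, mul_inv_cancel_left₀ (hρ _).ne']

section norms
variable (q : Par) {n : ℕ} (p : Dom n)

/-- The norm of a weight vector factors over the coordinates, and each factor obeys a one-variable
recurrence. -/
theorem exists_factor (i : Fin (n + 1)) : ∃ C : ℤ → ℝ, (∀ r, 0 < C r) ∧
    ∀ r, gap q p i (r + 1) ≠ 0 → C (r + 1) * |up q p i r| = C r * |down q p i (r + 1)| := by
  obtain ⟨C, h1, h2⟩ := exists_int_recurrence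
    -- Across a vanishing gap nothing is required, so the ratio is set to 1 there.
    (fun r => if gap q p i (r + 1) = 0 then 1 else |down q p i (r + 1)| / |up q p i r|) (by
      intro r
      split_ifs with h
      · exact one_pos
      · rw [← up_mul_down'] at h
        exact div_pos (abs_pos.mpr (right_ne_zero_of_mul h)) (abs_pos.mpr (left_ne_zero_of_mul h)))
  refine ⟨C, h1, fun r h => ?_⟩
  have h3 := h2 r
  rw [if_neg h] at h3
  rw [← up_mul_down'] at h
  have h4 := abs_pos.mpr (left_ne_zero_of_mul h)
  rw [h3]
  field_simp

/-- Squared norms of the weight vectors for which the matrix coefficients of `E_i` and of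
`q K_i⁻¹ F_i` correspond up to sign. -/
theorem exists_normSq : ∃ c : Idx n → ℝ, (∀ k, 0 < c k) ∧ ∀ (i : Fin n) (k : Idx n),
    gap q p i.castSucc (k i.castSucc + 1) * gap q p i.succ (k i.succ) ≠ 0 →
      c (k + root i) * |raiseCoef q p i k| = c k * |lowerCoef q p i k| := by
  choose C hC h using exists_factor q p
  refine ⟨fun k => ∏ i, C i (k i), fun k => Finset.prod_pos fun i _ => hC i _, fun i k hg => ?_⟩
  have hne := (Fin.castSucc_lt_succ (i := i)).ne
  have h1 := h i.castSucc (k i.castSucc) (left_ne_zero_of_mul hg)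
  have h2 := h i.succ (k i.succ - 1)
  rw [sub_add_cancel] at h2
  replace h2 := h2 (right_ne_zero_of_mul hg)
  -- Only the two factors at the ends of the root change, so they are split off from the product.
  have key : ∀ l : Idx n, ∏ m, C m (l m) = C i.castSucc (l i.castSucc) * (C i.succ (l i.succ) *
      ∏ m ∈ (Finset.univ.erase i.castSucc).erase i.succ, C m (l m)) := fun l => by
    rw [Finset.mul_prod_erase _ (fun m => C m (l m)) (by simp [hne.symm]),
      Finset.mul_prod_erase _ (fun m => C m (l m)) (Finset.mem_univ _)]
  have hrest : ∏ m ∈ (Finset.univ.erase i.castSucc).erase i.succ, C m ((k + root i) m) =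
      ∏ m ∈ (Finset.univ.erase i.castSucc).erase i.succ, C m (k m) := by
    refine Finset.prod_congr rfl fun m hm => ?_
    rw [Finset.mem_erase, Finset.mem_erase] at hm
    simp [root, Pi.single_eq_of_ne hm.1, Pi.single_eq_of_ne hm.2.1]
  simp only
  rw [key, key k, hrest, Pi.add_apply, Pi.add_apply, root_castSucc, root_succ, raiseCoef,
    lowerCoef, abs_mul, abs_mul, abs_mul, abs_mul, ← sub_eq_add_neg]
  linear_combination (∏ m ∈ (Finset.univ.erase i.castSucc).erase i.succ, C m (k m)) *
    |rootFactor q p i k| * (C i.succ (k i.succ - 1) * |down q p i.succ (k i.succ)| * h1 -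
      C i.castSucc (k i.castSucc) * |down q p i.castSucc (k i.castSucc + 1)| * h2)

/-- The positivity condition on a set of exponents. -/
def IsPositive (ι : Fin (n + 1) → ℤˣ) (S : Set (Idx n)) : Prop :=
  ∀ k ∈ S, ∀ i : Fin n, k + root i ∈ S →
    0 < (U.sgn ι i : ℝ) * (gap q p i.castSucc (k i.castSucc + 1) * gap q p i.succ (k i.succ))

end norms

/-! ### Joint eigenvalues, orthogonality and the necessity of positivity -/

namespace IsWeightBasis
variable {q : Par} {n : ℕ} {p : Dom n} {M : Type} [AddCommGroup M] [Module ℂ M]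
  [Module (FX q n) M] {S : Set (Idx n)} {v : Idx n → M}

theorem ne_zero (h : IsWeightBasis q p S v) {k : Idx n} (hk : k ∈ S) : v k ≠ 0 :=
  h.linearIndependent.ne_zero ⟨k, hk⟩

theorem K_smul (h : IsWeightBasis q p S v) (i : Fin n) (k : Idx n) :
    J q n (U.K i) • v k = (cartanWeight q p i k : ℂ) • v k := by
  rw [J_K, h.fn_smul, cartanWeight_eq]

theorem Kinv_smul (h : IsWeightBasis q p S v) (i : Fin n) (k : Idx n) :
    J q n (U.Kinv i) • v k = ((cartanWeight q p i k)⁻¹ : ℝ) • v k := by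
  rw [J_Kinv, h.fn_smul, ← Complex.coe_smul, Complex.ofReal_inv, ← cartanWeight_eq]
  simp only [Pi.mul_apply, Pi.inv_apply, mul_inv, inv_inv, mul_comm]

variable [IsScalarTower ℂ (FX q n) M]

/-- The set of the joint eigenvalues. -/
theorem mem_spec_iff (h : IsWeightBasis q p S v) (l : Fin (n + 2) → ℝ) :
    l ∈ spec q M ↔ ∃ k ∈ S, l = (orbitPt q p k).1 := by
  constructor
  · rintro ⟨w, hw, e⟩
    let b := Module.Basis.mk h.linearIndependent h.span
    have hb : ∀ k, b k = v k := fun k => Module.Basis.mk_apply _ _ k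
    have hr : b.repr w ≠ 0 := fun h0 => hw (b.repr.map_eq_zero_iff.mp h0)
    obtain ⟨k, hk⟩ := Finsupp.ne_iff.mp hr
    refine ⟨k, k.2, funext fun j => ?_⟩
    -- Each coordinate functional is an eigenvector of the transpose of x_j. So a nonzero k-th
    -- coordinate of a joint eigenvector forces its eigenvalue to be that of the weight k.
    have key : (b.coord k).comp (Algebra.lsmul ℂ ℂ M (fnX q (coord j))) =
        coord j (orbitPt q p k) • b.coord k := by
      refine b.ext fun m => ?_
      change b.coord k (fnX q (coord j) • b m) = _
      rw [hb, h.fn_smul, map_smul, ← hb, LinearMap.smul_apply]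
      by_cases hm : m = k
      · rw [hm]
      · rw [b.coord_apply, b.repr_self, Finsupp.single_eq_of_ne (Ne.symm hm), smul_zero, smul_zero]
    have h1 := congrArg (fun f => f w) key
    change b.coord k (fnX q (coord j) • w) = coord j (orbitPt q p k) * b.coord k w at h1
    rw [e, map_smul] at h1
    have h2 : (l j : ℂ) = coord j (orbitPt q p k) := mul_right_cancel₀ hk h1
    unfold coord at h2
    exact_mod_cast h2
  · rintro ⟨k, hk, rfl⟩
    exact ⟨v k, h.ne_zero hk, fun j => h.fn_smul _ k⟩

/-- Distinct weight vectors are orthogonal in a `*`-representation. -/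
theorem inner_eq_zero (h : IsWeightBasis q p S v) (hS : S ⊆ rootLattice n) {H : Type}
    [NormedAddCommGroup H] [InnerProductSpace ℂ H] {j : M →ₗ[ℂ] H} {ι : Fin (n + 1) → ℤˣ}
    (hadj : ∀ a, IsAdj j (momentRep q M) a (U.natStar ι a)) {k l : Idx n} (hk : k ∈ S)
    (hl : l ∈ S) (hkl : k ≠ l) : inner ℂ (j (v k)) (j (v l)) = 0 := by
  obtain ⟨i, hi⟩ := exists_cartanWeight_ne q p (hS hk) (hS hl) hkl
  have h1 := hadj (U.K i) (v k) (v l)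
  rw [U.star_K, momentRep_apply, momentRep_apply, h.K_smul, h.K_smul, map_smul, map_smul,
    inner_smul_left, inner_smul_right, Complex.conj_ofReal] at h1
  have h2 : ((cartanWeight q p i k - cartanWeight q p i l : ℝ) : ℂ) *
      inner ℂ (j (v k)) (j (v l)) = 0 := by
    push_cast
    rw [sub_mul, h1, sub_self]
  rcases mul_eq_zero.mp h2 with h3 | h3
  · exact absurd (sub_eq_zero.mp (Complex.ofReal_eq_zero.mp h3)) hi
  · exact h3

/-- The squared norm of E_i v_k equals the inner product of v_k with E_i^♮ E_i v_k. This is the sign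
times the product of both coefficients times the squared norm of v_k, and it is positive because E_i
v_k ≠ 0. -/
theorem pos_of_raiseCoef_ne_zero (h : IsWeightBasis q p S v) {H : Type}
    [NormedAddCommGroup H] [InnerProductSpace ℂ H] {j : M →ₗ[ℂ] H} (hj : Function.Injective j)
    {ι : Fin (n + 1) → ℤˣ}
    (hadj : ∀ a, IsAdj j (momentRep q M) a (U.natStar ι a)) {k : Idx n} {i : Fin n}
    (hk' : k + root i ∈ S) (hr : raiseCoef q p i k ≠ 0) :
    0 < (U.sgn ι i : ℝ) * (gap q p i.castSucc (k i.castSucc + 1) * gap q p i.succ (k i.succ)) := by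
  have h1 := hadj (U.E i) (v k) (J q n (U.E i) • v k)
  have h2 : J q n (U.natStar ι (U.E i)) • J q n (U.E i) • v k =
      ((((U.sgn ι i : ℝ) * (raiseCoef q p i k * lowerCoef q p i k) : ℝ)) : ℂ) • v k := by
    rw [natStar_E, h.raise_smul, map_smul, smul_assoc, smul_comm (J q n (lowerElt q i)), lowerElt,
      h.lower_smul, smul_smul, smul_smul]
    push_cast
    rw [mul_assoc]
  rw [momentRep_apply, momentRep_apply, h2, j.map_smul, inner_smul_right, inner_self_eq_norm_sq_to_K,
    inner_self_eq_norm_sq_to_K] at h1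
  have h3 : ‖j (J q n (U.E i) • v k)‖ ^ 2 =
      (U.sgn ι i : ℝ) * (raiseCoef q p i k * lowerCoef q p i k) * ‖j (v k)‖ ^ 2 := by
    apply Complex.ofReal_injective
    rw [Complex.ofReal_mul, Complex.ofReal_pow, Complex.ofReal_pow]
    exact h1
  have h4 : 0 < ‖j (J q n (U.E i) • v k)‖ ^ 2 := by
    refine pow_pos (norm_pos_iff.mpr fun h0 => ?_) 2
    rw [h.raise_smul] at h0
    have h5 := hj (h0.trans (map_zero j).symm)
    rcases smul_eq_zero.mp h5 with h6 | h6
    · exact hr (by exact_mod_cast h6)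
    · exact h.ne_zero hk' h6
  rw [h3, raiseCoef_mul_lowerCoef] at h4
  have h5 : 0 < (U.sgn ι i : ℝ) * (rootFactor q p i k ^ 2 *
      (gap q p i.castSucc (k i.castSucc + 1) * gap q p i.succ (k i.succ))) :=
    pos_of_mul_pos_left h4 (sq_nonneg _)
  have h6 : 0 < rootFactor q p i k ^ 2 * ((U.sgn ι i : ℝ) *
      (gap q p i.castSucc (k i.castSucc + 1) * gap q p i.succ (k i.succ))) := by
    linarith
  exact pos_of_mul_pos_right h6 (sq_nonneg _)

end IsWeightBasis

/-! ### Irreducibility and the sufficiency of positivity -/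

namespace IsWeightBasis
variable {q : Par} {n : ℕ} {p : Dom n} {M : Type} [AddCommGroup M] [Module ℂ M]
  [Module (FX q n) M] [IsScalarTower ℂ (FX q n) M] {S : Set (Idx n)} {v : Idx n → M}

/-- The projection preserves the closed graphs of the symmetric operators K_i, so the image of the
weight-0 vector is still a (weak) joint eigenvector with the same eigenvalues, and these occur at no
other weight. -/
theorem exists_starProjection_eq_smul (h : IsWeightBasis q p S v) (hS : S ⊆ rootLattice n)
    {H : Type} [NormedAddCommGroup H] [InnerProductSpace ℂ H] {j : M →ₗ[ℂ] H}
    (hj : Function.Injective j) (hd : DenseRange j) {ι : Fin (n + 1) → ℤˣ}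
    (hadj : ∀ a : U q n, IsAdj j (momentRep q M) a (U.natStar ι a))
    (K : Submodule ℂ H) [K.HasOrthogonalProjection]
    (hK : ∀ a : U q n, ∀ y ∈ closedGraph j (momentRep q M a),
      (K.starProjection y.1, K.starProjection y.2) ∈ closedGraph j (momentRep q M a)) :
    ∃ c : ℂ, K.starProjection (j (v 0)) = c • j (v 0) := by
  set y := K.starProjection (j (v 0)) with hy
  have horth : ∀ l ∈ S, l ≠ 0 → inner ℂ y (j (v l)) = 0 := by
    intro l hl h0
    obtain ⟨i, hi⟩ := exists_cartanWeight_ne q p (hS hl) (hS h.zero_mem) h0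
    -- Pairing the projected graph point of K_i with v_l evaluates the same expression with the
    -- eigenvalue at 0 and with the eigenvalue at l.
    have h1 := hK _ _ (mem_closedGraph (momentRep q M (U.K i)) (v 0))
    have h2 := inner_of_mem_closedGraph (hadj (U.K i)) h1 (v l)
    rw [U.star_K, momentRep_apply, momentRep_apply, h.K_smul, h.K_smul, map_smul, map_smul,
      map_smul, inner_smul_left, inner_smul_right, Complex.conj_ofReal, ← hy] at h2
    have h3 : ((cartanWeight q p i l - cartanWeight q p i 0 : ℝ) : ℂ) *
        inner ℂ y (j (v l)) = 0 := by
      push_cast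
      rw [sub_mul, h2, sub_self]
    rcases mul_eq_zero.mp h3 with h4 | h4
    · exact absurd (sub_eq_zero.mp (Complex.ofReal_eq_zero.mp h4)) hi
    · exact h4
  have hne : inner ℂ (j (v 0)) (j (v 0)) ≠ 0 := by
    rw [inner_self_ne_zero]
    exact fun h0 => h.ne_zero h.zero_mem (hj (h0.trans (map_zero j).symm))
  -- The scalar is the Fourier coefficient along v_0; the difference is then orthogonal to every
  -- weight vector, hence 0 by density.
  refine ⟨inner ℂ (j (v 0)) y / inner ℂ (j (v 0)) (j (v 0)), sub_eq_zero.mp ?_⟩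
  refine eq_zero_of_inner_span h.span hd ?_
  rintro _ ⟨l, rfl⟩
  change inner ℂ _ (j (v l)) = 0
  by_cases hl : l.1 = 0
  · rw [hl, inner_sub_left, inner_smul_left, map_div₀, inner_conj_symm, inner_conj_symm,
      div_mul_cancel₀ _ hne, sub_self]
  · rw [inner_sub_left, inner_smul_left, horth l l.2 hl,
      h.inner_eq_zero hS hadj h.zero_mem l.2 (Ne.symm hl), mul_zero, sub_self]

/-- Positivity gives an irreducible `*`-representation. -/
theorem isIrredStarRep (h : IsWeightBasis q p S v) (hS : S ⊆ rootLattice n)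
    {ι : Fin (n + 1) → ℤˣ} (hpos : IsPositive q p ι S) :
    IsIrredStarRep (U.natStar ι) (momentRep q M) := by
  classical
  obtain ⟨c, hc, hcE⟩ := exists_normSq q p
  let b : Module.Basis S ℂ M := Module.Basis.mk h.linearIndependent h.span
  have hb : ∀ k : S, b k = v k := fun k => Module.Basis.mk_apply _ _ k
  let H := lp (fun _ : S => ℂ) 2
  -- In ℓ²(S) the vector v_k becomes √(c k) times the k-th unit vector, so its squared norm is c k.
  let j : M →ₗ[ℂ] H := b.constr ℂ fun k => lp.single 2 k ((Real.sqrt (c k) : ℝ) : ℂ)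
  have hjv : ∀ k : S, j (v k) = lp.single 2 k ((Real.sqrt (c k) : ℝ) : ℂ) := fun k => by
    rw [← hb]
    exact b.constr_basis ℂ _ k
  have hsqrt : ∀ k, ((Real.sqrt (c k) : ℝ) : ℂ) ≠ 0 := fun k => by
    exact_mod_cast (Real.sqrt_pos.mpr (hc k)).ne'
  have hgram : ∀ k l : Idx n,
      inner ℂ (j (v k)) (j (v l)) = if k = l ∧ k ∈ S then (c k : ℂ) else 0 := by
    intro k l
    by_cases hk : k ∈ S
    · by_cases hl : l ∈ S
      · rw [hjv ⟨k, hk⟩, hjv ⟨l, hl⟩, lp.inner_single_left]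
        by_cases hkl : k = l
        · subst hkl
          rw [lp.single_apply_self, if_pos ⟨rfl, hk⟩, RCLike.inner_apply, Complex.conj_ofReal,
            ← Complex.ofReal_mul, Real.mul_self_sqrt (hc k).le]
        · rw [lp.single_apply_ne _ _ _ (fun e => hkl (congrArg Subtype.val e)), inner_zero_right,
            if_neg (fun e => hkl e.1)]
      · rw [h.vanish l hl, map_zero, inner_zero_right, if_neg]
        rintro ⟨rfl, h2⟩
        exact hl h2
    · rw [h.vanish k hk, map_zero, inner_zero_left, if_neg (fun e => hk e.2)]
  have hinj : Function.Injective j := by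
    have hli : LinearIndependent ℂ fun k => j (b k) := by
      refine linearIndependent_of_ne_zero_of_inner_eq_zero (𝕜 := ℂ) (fun k h0 => ?_) ?_
      · have h1 := hgram k k
        rw [if_pos ⟨rfl, k.2⟩, ← hb, h0, inner_zero_left] at h1
        exact (hc k).ne (by exact_mod_cast h1)
      · intro k l hkl
        simp only [hb]
        rw [hgram, if_neg (fun e => hkl (Subtype.ext e.1))]
    refine (injective_iff_map_eq_zero j).mpr fun m hm => ?_
    rw [← b.linearCombination_repr m, Finsupp.apply_linearCombination] at hm
    exact b.repr.map_eq_zero_iff.mp (linearIndependent_iff.mp hli _ hm)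
  have hdense : DenseRange j := by
    intro y
    have hy := lp.hasSum_single (p := 2) ENNReal.ofNat_ne_top y
    refine mem_closure_of_tendsto hy (Filter.Eventually.of_forall fun s => ?_)
    refine (LinearMap.range j).sum_mem fun k _ => ⟨(y k / Real.sqrt (c k)) • v k, ?_⟩
    rw [map_smul, hjv, ← lp.single_smul, smul_eq_mul, div_mul_cancel₀ _ (hsqrt k)]
  have hadj : ∀ a, IsAdj j (momentRep q M) a (U.natStar ι a) := by
    refine isAdj_natStar q ι (fun i => ?_) (fun i => ?_) (fun i => ?_)
    · refine isAdj_of_span h.span ?_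
      rintro _ ⟨k, rfl⟩ _ ⟨l, rfl⟩
      have h1 := h.lower_smul i (l - root i)
      rw [sub_add_cancel] at h1
      simp only [momentRep_apply]
      rw [h.raise_smul, map_smul (J q n), smul_assoc, lowerElt, h1, map_smul, map_smul, map_smul,
        inner_smul_left, inner_smul_right, inner_smul_right, hgram, hgram, Complex.conj_ofReal]
      by_cases hl : k.1 + root i = l
      · have hkl : k.1 = l - root i := by rw [← hl, add_sub_cancel_right]
        rw [if_pos ⟨hl, hl ▸ l.2⟩, if_pos ⟨hkl, k.2⟩, ← hkl, hl]
        have hp := hpos k k.2 i (hl ▸ l.2)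
        have hg := hcE i k fun h0 => by rw [h0, mul_zero] at hp; exact hp.false
        rw [hl] at hg
        have hs : (U.sgn ι i : ℝ) * (U.sgn ι i : ℝ) = 1 := by exact_mod_cast U.sgn_mul_self ι i
        -- The two sides of the required identity have the same sign by positivity and the same
        -- modulus by the choice of norms, so they are equal.
        have hp2 : 0 < (raiseCoef q p i k * c l) *
            ((U.sgn ι i : ℝ) * (lowerCoef q p i k * c k)) := by
          have e : (raiseCoef q p i k * c l) * ((U.sgn ι i : ℝ) * (lowerCoef q p i k * c k)) =
              (c l * c k * rootFactor q p i k ^ 2) * ((U.sgn ι i : ℝ) *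
                (gap q p i.castSucc (k.1 i.castSucc + 1) * gap q p i.succ (k.1 i.succ))) := by
            linear_combination (c l * c k * (U.sgn ι i : ℝ)) * raiseCoef_mul_lowerCoef q p i k
          rw [e]
          have := rootFactor_ne_zero q p i k.1
          have h1 := hc l
          have h2 := hc k
          positivity
        have habs : |raiseCoef q p i k * c l| =
            |(U.sgn ι i : ℝ) * (lowerCoef q p i k * c k)| := by
          have hs1 : |(U.sgn ι i : ℝ)| = 1 := by
            have := abs_mul_abs_self (U.sgn ι i : ℝ)
            rw [hs] at this
            nlinarith [abs_nonneg (U.sgn ι i : ℝ)]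
          rw [abs_mul, abs_mul, abs_mul, hs1, abs_of_pos (hc l), abs_of_pos (hc k), one_mul,
            mul_comm, hg, mul_comm]
        have hreal : raiseCoef q p i k * c l = (U.sgn ι i : ℝ) * (lowerCoef q p i k * c k) := by
          rcases abs_eq_abs.mp habs with h1 | h1
          · exact h1
          · rw [h1] at hp2
            nlinarith [sq_nonneg ((U.sgn ι i : ℝ) * (lowerCoef q p i k * c k))]
        exact_mod_cast hreal
      · rw [if_neg (fun e => hl e.1), if_neg (fun e => hl (by rw [e.1, sub_add_cancel]))]
        simp
    -- K_i and K_i⁻¹ are diagonal with real eigenvalues in an orthogonal basis.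
    all_goals
      refine isAdj_of_span h.span ?_
      rintro _ ⟨k, rfl⟩ _ ⟨l, rfl⟩
      simp only [momentRep_apply]
      first
        | rw [h.K_smul, h.K_smul]
        | rw [h.Kinv_smul, h.Kinv_smul, ← Complex.coe_smul, ← Complex.coe_smul]
      rw [map_smul, map_smul, inner_smul_left, inner_smul_right, Complex.conj_ofReal, hgram]
      by_cases hkl : k.1 = l
      · rw [hkl]
      · rw [if_neg (fun e => hkl e.1), mul_zero, mul_zero]
  refine ⟨H, inferInstance, inferInstance, inferInstance, j, ?_, hinj, hdense, hadj,
    fun a y hy => eq_zero_of_mem_closedGraph hdense (hadj a) hy, fun K _ hK => ?_⟩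
  · exact ⟨j (v 0), 0, fun h0 => h.ne_zero h.zero_mem (hinj (h0.trans (map_zero j).symm))⟩
  · obtain ⟨t, ht⟩ := h.exists_starProjection_eq_smul hS hinj hdense hadj K hK
    exact eq_bot_or_eq_top_of_reduces j _ hdense hadj h.cyclic K hK ht

end IsWeightBasis

/-! ### The positivity conditions on the weights -/

section conditions
variable (q : Par) {n : ℕ} (p : Dom n) (ι : Fin (n + 1) → ℤˣ)

theorem scaleAt_orbitPt_inv (i : Fin n) (k : Idx n) :
    scaleAt (orbitPt q p k).1 i (q.1 ^ 2)⁻¹ = (orbitPt q p (k + root i)).1 := by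
  funext m
  rw [orbitPt_add_root, scaleAt, Function.update_apply]
  split_ifs with h
  · rw [h]
  · rfl

theorem scaleAt_orbitPt (i : Fin n) (k : Idx n) :
    scaleAt (orbitPt q p k).1 i (q.1 ^ 2) = (orbitPt q p (k - root i)).1 := by
  funext m
  have h1 := orbitPt_add_root q p i (k - root i) m
  have h2 := orbitPt_add_root q p i (k - root i) i.castSucc.succ
  rw [sub_add_cancel] at h1 h2
  rw [if_pos rfl] at h2
  rw [scaleAt, Function.update_apply]
  split_ifs with h
  · rw [h, h2, mul_inv_cancel_left₀ q.sq_pos.ne']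
  · rw [h1, if_neg h]

/-- Quotient and product have the same sign. For y = 0 both sides are false, since x / 0 = 0; thus
the strict inequality includes that the denominator is nonzero. -/
theorem mul_div_pos_iff (s x y : ℝ) : 0 < s * (x / y) ↔ 0 < s * (x * y) := by
  rw [← mul_div_assoc, ← mul_assoc, div_pos_iff, mul_pos_iff (a := s * x)]

/-- Numerator and denominator are the two gaps up to powers of q², which are positive whatever the
sign of q. -/
theorem cond2_iff (i : Fin n) (k : Idx n) : Cond2 q ι (orbitPt q p k).1 i ↔
    0 < (U.sgn ι i : ℝ) * (gap q p i.castSucc (k i.castSucc + 1) * gap q p i.succ (k i.succ)) := by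
  have hq := q.sq_pos
  have h1 := orbitPt_sub_inv_succ (q := q) p i.castSucc k
  have h2 := orbitPt_sub_succ (q := q) p i.succ k
  have c3 : (i.succ.castSucc : Fin (n + 2)) = i.castSucc.succ := rfl
  rw [c3] at h2
  have h3 : q.1 ^ 2 * (orbitPt q p k).1 i.castSucc.castSucc - (orbitPt q p k).1 i.castSucc.succ =
      q.1 ^ 2 * ((q.1 ^ 2) ^ (-partialSum i.1 k) * gap q p i.castSucc (k i.castSucc + 1)) := by
    rw [← Fin.val_castSucc i, ← h1, mul_sub, mul_inv_cancel_left₀ hq.ne']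
  rw [Cond2, mul_div_pos_iff, h3, h2]
  have e : (U.sgn ι i : ℝ) * (q.1 ^ 2 * ((q.1 ^ 2) ^ (-partialSum i.1 k) *
      gap q p i.castSucc (k i.castSucc + 1)) * ((q.1 ^ 2) ^ (-partialSum i.succ.1 k) *
      gap q p i.succ (k i.succ))) = (q.1 ^ 2 * (q.1 ^ 2) ^ (-partialSum i.1 k) *
      (q.1 ^ 2) ^ (-partialSum i.succ.1 k)) * ((U.sgn ι i : ℝ) *
      (gap q p i.castSucc (k i.castSucc + 1) * gap q p i.succ (k i.succ))) := by ring
  rw [e, mul_pos_iff_of_pos_left]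
  have := zpow_pos hq (-partialSum i.1 k)
  have := zpow_pos hq (-partialSum i.succ.1 k)
  positivity

/-- (a) at the upper end of an edge is (b) at its lower end: passing along the root divides λ_i by
q², which multiplies both numerator and denominator by q⁻². -/
theorem cond1_iff (i : Fin n) (k : Idx n) : Cond1 q ι (orbitPt q p (k + root i)).1 i ↔
    0 < (U.sgn ι i : ℝ) * (gap q p i.castSucc (k i.castSucc + 1) * gap q p i.succ (k i.succ)) := by
  have hq := q.sq_pos
  rw [← cond2_iff, Cond1, Cond2, mul_div_pos_iff, mul_div_pos_iff, orbitPt_add_root,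
    orbitPt_add_root, orbitPt_add_root, if_neg (by simp [Fin.ext_iff]), if_pos rfl,
    if_neg (by simp [Fin.ext_iff])]
  generalize q.1 ^ 2 = t at hq
  rw [← mul_pos_iff_of_pos_left (pow_pos hq 2)]
  apply iff_of_eq
  congr 1
  field_simp

end conditions

/-! ### The two equivalences -/

section main
variable {q : Par} {n : ℕ} {p : Dom n} {ι : Fin (n + 1) → ℤˣ}

/-- The induced module is simple if it is a `*`-representation. -/
theorem radW_eq_bot (h : IsIrredStarRep (U.natStar ι) (momentRep q (W q p))) :
    radW q p = ⊥ := by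
  obtain ⟨H, _, _, _, j, -, hj, -, hadj, -, -⟩ := h
  have hW := isWeightBasis_W q p
  refine sSup_eq_bot.mpr fun N hN => (Submodule.eq_bot_iff N).mpr fun x hx => ?_
  -- This is the orthogonal complement of N. It is stable because N is stable under the adjoints, so
  -- once it contains the cyclic vector it is everything, and N is orthogonal to itself.
  let T : Submodule ℂ (W q p) :=
    { carrier := {w | ∀ y ∈ N, inner ℂ (j y) (j w) = 0}
      add_mem' := fun {a b} ha hb y hy => by
        rw [map_add, inner_add_right, ha y hy, hb y hy, add_zero]
      zero_mem' := fun y _ => by rw [map_zero, inner_zero_right]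
      smul_mem' := fun t a ha y hy => by rw [map_smul, inner_smul_right, ha y hy, mul_zero] }
  have hT : T = ⊤ := by
    refine hW.cyclic T (fun y hy => ?_) fun a w hw y hy => ?_
    -- N contains the weight components of its elements but not 1_χ, so the component at weight 0
    -- vanishes. Weight vectors are orthogonal, hence N is orthogonal to 1_χ.
    · have h0 : toLattice q p y 0 = 0 :=
        toLattice_apply_eq_zero q p (by rw [weightVec_zero]; exact hN) hy
      have hy' : y ∈ Submodule.span ℂ (Set.range fun k : rootLattice n => weightVec q p k) :=
        hW.span trivial
      have key : inner ℂ (j y) (j (weightVec q p 0)) = starRingEnd ℂ (toLattice q p y 0) *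
          inner ℂ (j (weightVec q p 0)) (j (weightVec q p 0)) := by
        refine Submodule.span_induction (p := fun y _ => inner ℂ (j y) (j (weightVec q p 0)) =
          starRingEnd ℂ (toLattice q p y 0) *
          inner ℂ (j (weightVec q p 0)) (j (weightVec q p 0))) ?_ (by simp)
          (fun x y _ _ hx hy => by
            rw [map_add, inner_add_left, hx, hy, map_add, Finsupp.add_apply, map_add, add_mul])
          (fun t x _ hx => by
            rw [map_smul, inner_smul_left, hx, map_smul, Finsupp.smul_apply, smul_eq_mul, map_mul,
              mul_assoc]) hy'
        rintro _ ⟨k, rfl⟩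
        simp only
        rw [toLattice_weightVec q p k.2]
        by_cases hk : k.1 = 0
        · rw [hk, Finsupp.single_eq_same, map_one, one_mul]
        · rw [hW.inner_eq_zero le_rfl hadj k.2 hW.zero_mem hk,
            Finsupp.single_eq_of_ne (Ne.symm hk), map_zero, zero_mul]
      rw [key, h0, map_zero, zero_mul]
    · have h1 := (IsAdj.symm (hadj a)) y w
      rw [momentRep_apply, momentRep_apply] at h1
      rw [← h1]
      exact hw _ (N.smul_mem _ hy)
  have hx0 : x ∈ T := hT ▸ Submodule.mem_top
  exact hj ((inner_self_eq_zero.mp (hx0 x hx)).trans (map_zero j).symm)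

/-- Once the radical is 0, every weight survives truncation, so no coefficient of E_i vanishes and
positivity follows on all edges. -/
theorem isIrredStarRep_W_iff :
    IsIrredStarRep (U.natStar ι) (momentRep q (W q p)) ↔ IsPositive q p ι (rootLattice n) := by
  refine ⟨fun h => ?_, (isWeightBasis_W q p).isIrredStarRep le_rfl⟩
  have hrad := radW_eq_bot h
  obtain ⟨H, _, _, _, j, -, hj, -, hadj, -, -⟩ := h
  intro k hk i hk'
  refine (isWeightBasis_W q p).pos_of_raiseCoef_ne_zero hj hadj hk'
    (raiseCoef_ne_zero_of_mem q p ?_ i)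
  change weightVec q p k ∉ radW q p
  rw [hrad, Submodule.mem_bot]
  exact (isWeightBasis_W q p).ne_zero hk

theorem isIrredStarRep_Wtr_iff : IsIrredStarRep (U.natStar ι) (momentRep q (Wtr q p)) ↔
    IsPositive q p ι (truncatedLattice q p) := by
  refine ⟨fun h => ?_, (isWeightBasis_Wtr q p).isIrredStarRep (truncatedLattice_subset q p)⟩
  obtain ⟨H, _, _, _, j, -, hj, -, hadj, -, -⟩ := h
  intro k hk i hk'
  exact (isWeightBasis_Wtr q p).pos_of_raiseCoef_ne_zero hj hadj hk'
    (raiseCoef_ne_zero_of_mem q p hk i)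

/-- Multiplying λ_i by q² or q⁻² leads to the neighbour k - `root i` or k + `root i`. So (a) and (b)
concern the edges that enter and leave k, and each edge is seen from both its ends. -/
theorem isPositive_iff {M : Type} [AddCommGroup M] [Module ℂ M] [Module (FX q n) M]
    [IsScalarTower ℂ (FX q n) M] {S : Set (Idx n)} {v : Idx n → M} (h : IsWeightBasis q p S v) :
    IsPositive q p ι S ↔ ∀ l ∈ spec q M, ∀ i : Fin n,
      (scaleAt l i (q.1 ^ 2) ∈ spec q M → Cond1 q ι l i) ∧
      (scaleAt l i (q.1 ^ 2)⁻¹ ∈ spec q M → Cond2 q ι l i) := by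
  have hmem : ∀ k, (orbitPt q p k).1 ∈ spec q M ↔ k ∈ S := fun k => by
    rw [h.mem_spec_iff]
    refine ⟨?_, fun hk => ⟨k, hk, rfl⟩⟩
    rintro ⟨l, hl, e⟩
    rwa [orbitPt_injective p (Subtype.ext e)]
  constructor
  · intro hpos l hl i
    obtain ⟨k, hk, rfl⟩ := (h.mem_spec_iff l).mp hl
    rw [scaleAt_orbitPt, scaleAt_orbitPt_inv, hmem, hmem, cond2_iff]
    refine ⟨fun hk' => ?_, hpos k hk i⟩
    have h1 := cond1_iff q p ι i (k - root i)
    rw [sub_add_cancel] at h1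
    exact h1.mpr (hpos _ hk' i (by rwa [sub_add_cancel]))
  · intro hc k hk i hk'
    have h1 := (hc _ ((hmem k).mpr hk) i).2
    rw [scaleAt_orbitPt_inv, hmem, cond2_iff] at h1
    exact h1 hk'

/-- In W both neighbours of a weight are always weights, so the side conditions disappear. -/
theorem isPositive_rootLattice_iff : IsPositive q p ι (rootLattice n) ↔
    ∀ l ∈ spec q (W q p), ∀ i : Fin n, Cond1 q ι l i ∧ Cond2 q ι l i := by
  have h := isWeightBasis_W q p
  rw [isPositive_iff h]
  refine forall₂_congr fun l hl => forall_congr' fun i => ?_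
  obtain ⟨k, hk, rfl⟩ := (h.mem_spec_iff l).mp hl
  have h1 : k - root i ∈ rootLattice n := by
    rwa [← add_root_mem_iff i, sub_add_cancel]
  rw [scaleAt_orbitPt, scaleAt_orbitPt_inv, imp_iff_right ((h.mem_spec_iff _).mpr ⟨_, h1, rfl⟩),
    imp_iff_right ((h.mem_spec_iff _).mpr ⟨_, (add_root_mem_iff i).mpr hk, rfl⟩)]

end main
end QOrbit
theorem mainTheorem4 (q : QOrbit.Par) (n : ℕ) (hn : 1 ≤ n)
    (ι : Fin (n + 1) → ℤˣ) (p : QOrbit.Dom n) (hp : ∀ i : Fin n, 0 < p.1 i.castSucc.succ)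
    (I : QOrbit.U q n ≃ₐ[ℂ] QOrbit.U q n)
    (hI : ∀ a, I (QOrbit.U.natStar ι a) = QOrbit.U.natStar ι (I a)) :
    (QOrbit.IsIrredStarRep (QOrbit.U.natStar ι) (QOrbit.rep q (QOrbit.W q p) I) ↔
      ∀ l ∈ QOrbit.spec q (QOrbit.W q p), ∀ i : Fin n,
        QOrbit.Cond1 q ι l i ∧ QOrbit.Cond2 q ι l i) ∧
    (QOrbit.IsIrredStarRep (QOrbit.U.natStar ι) (QOrbit.rep q (QOrbit.Wtr q p) I) ↔
      ∀ l ∈ QOrbit.spec q (QOrbit.Wtr q p), ∀ i : Fin n,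
        (QOrbit.scaleAt l i (q.1 ^ 2) ∈ QOrbit.spec q (QOrbit.Wtr q p) →
          QOrbit.Cond1 q ι l i) ∧
        (QOrbit.scaleAt l i (q.1 ^ 2)⁻¹ ∈ QOrbit.spec q (QOrbit.Wtr q p) →
          QOrbit.Cond2 q ι l i)) := by
  rw [QOrbit.isIrredStarRep_rep_iff q hI, QOrbit.isIrredStarRep_rep_iff q hI,
    QOrbit.isIrredStarRep_W_iff, QOrbit.isIrredStarRep_Wtr_iff]
  exact ⟨QOrbit.isPositive_rootLattice_iff, QOrbit.isPositive_iff (QOrbit.isWeightBasis_Wtr q p)⟩
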